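/- Theorem (Noisy location estimation). There are a single randomized algorithm, universal constants $C,K>0$, and polynomials $m(\cdot,\cdot,\cdot)$ and $T(\cdot,\cdot,\cdot,\cdot)$ with the following property. Let $d\ge 1$, $\alpha\in(0,1]$, $\eta,\delta\in(0,1)$ and $\sigma>0$ be given to the algorithm as input. Let $D_\xi, D_1, D_2$ be any probability distributions on $\mathbb R^d$ such that $\Pr_{\xi\sim D_\xi}[\xi=0]\ge\alpha$ and, for $i\in\{1,2\}$, $\mathbb E_{z\sim D_i}[z]=0$ and $\mathbb E_{z\sim D_i}[\|z\|_2^2]\le\sigma^2$ ($D_1$ and $D_2$ may differ), and let $v\in\mathbb R^d$ be any unknown shift. The algorithm can draw independent samples from the distribution of $\xi+z_1$ and from the distribution of $\xi+z_2+v$, where $\xi\sim D_\xi$ and $z_i\sim D_i$ are independent. The algorithm * draws at most $m\bigl(1/\eta,\,(K/\alpha)^{1/\eta},\,\log\frac{1}{\delta\eta\alpha}\bigr)$ samples from each of the two distributions, * runs in time at most $T\bigl(d,\,1/\eta,\,(K/\alpha)^{1/\eta},\,\log\frac{1}{\delta\eta\alpha}\bigr)$, and * with probability at least $1-\delta$ over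 the samples and its own random bits, outputs a vector $v'\in\mathbb R^d$ with $\|v'-v\|_2\le C\eta\sigma$. Running time is counted on a real-number random access machine: arithmetic operations ($+,-,\times,\div$ on exact real numbers; $+$, truncated subtraction and $\times$ on natural numbers), conversion of a natural number to a real, comparisons, memory accesses and random bits cost one step each, drawing one sample costs $d+1$ steps, and there is no rounding operation. -/

import Mathlib

open MeasureTheory

/-!
A randomized real-number random access machine, given as a structured imperative language with an
exact step count. A run has finitely many natural-number registers available to the program, and
arrays of exact real numbers that are addressed by natural-number expressions. The unit-cost
operations are `+`, truncated `-` and `*` on naturals, the four field operations on reals, the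
conversion of a natural number to a real number, and comparisons. There is no rounding operation
and no real constant other than those that a program builds from natural-number literals.
A program is a finite text, independent of the dimension and of all parameters.
-/
namespace RealRAM

/-- Natural-number expressions. -/
inductive IExp : Type
  | lit (n : ℕ)
  | reg (x : ℕ)
  | add (e f : IExp)
  | sub (e f : IExp)
  | mul (e f : IExp)

/-- Real expressions; `cell a i` is the entry of the array `a` at the index `i`. -/
inductive RExp : Type
  | ofNat (e : IExp)
  | cell (a : ℕ) (i : IExp)
  | add (e f : RExp)
  | sub (e f : RExp)
  | mul (e f : RExp)
  | div (e f : RExp)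

/-- Tests. -/
inductive BExp : Type
  | ltI (e f : IExp)
  | ltR (e f : RExp)
  | not (b : BExp)

/-- Programs. `toss x` puts a fresh fair random bit into the register `x`; `draw b a i` draws a
fresh sample, a vector, from the source number `b` and writes its coordinates into the consecutive
cells of the array `a` that start at the index `i`. -/
inductive Prog : Type
  | skip
  | setI (x : ℕ) (e : IExp)
  | setR (a : ℕ) (i : IExp) (e : RExp)
  | toss (x : ℕ)
  | draw (b : Fin 2) (a : ℕ) (i : IExp)
  | seq (p q : Prog)
  | ite (c : BExp) (p q : Prog)
  | while (c : BExp) (p : Prog)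

/-- The memory of the machine, together with the number of coin tosses used so far and the number
of samples drawn so far from each of the two sources. -/
structure State : Type where
  reg : ℕ → ℕ
  arr : ℕ → ℕ → ℝ
  tosses : ℕ
  drawn : Fin 2 → ℕ

/-- The external randomness of a run: an infinite sequence of bits, and an infinite sequence of
vectors in `ℝ^d` for each of the two sources. -/
abbrev Tape (d : ℕ) : Type :=
  (ℕ → Bool) × (ℕ → EuclideanSpace ℝ (Fin d)) × (ℕ → EuclideanSpace ℝ (Fin d))

/-- The `k`-th sample of the source `b`. -/
def Tape.sample {d : ℕ} (ω : Tape d) (b : Fin 2) (k : ℕ) : EuclideanSpace ℝ (Fin d) :=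
  if b = 0 then ω.2.1 k else ω.2.2 k

def IExp.eval (s : State) : IExp → ℕ
  | .lit n => n
  | .reg x => s.reg x
  | .add e f => e.eval s + f.eval s
  | .sub e f => e.eval s - f.eval s
  | .mul e f => e.eval s * f.eval s

/-- Number of steps for evaluating an expression. -/
def IExp.cost : IExp → ℕ
  | .lit _ => 1
  | .reg _ => 1
  | .add e f => e.cost + f.cost + 1
  | .sub e f => e.cost + f.cost + 1
  | .mul e f => e.cost + f.cost + 1

/-- Division by zero returns zero. -/
noncomputable def RExp.eval (s : State) : RExp → ℝ
  | .ofNat e => (e.eval s : ℝ)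
  | .cell a i => s.arr a (i.eval s)
  | .add e f => e.eval s + f.eval s
  | .sub e f => e.eval s - f.eval s
  | .mul e f => e.eval s * f.eval s
  | .div e f => e.eval s / f.eval s

def RExp.cost : RExp → ℕ
  | .ofNat e => e.cost + 1
  | .cell _ i => i.cost + 1
  | .add e f => e.cost + f.cost + 1
  | .sub e f => e.cost + f.cost + 1
  | .mul e f => e.cost + f.cost + 1
  | .div e f => e.cost + f.cost + 1

def BExp.Holds (s : State) : BExp → Prop
  | .ltI e f => e.eval s < f.eval s
  | .ltR e f => e.eval s < f.eval s
  | .not b => ¬ b.Holds s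

def BExp.cost : BExp → ℕ
  | .ltI e f => e.cost + f.cost + 1
  | .ltR e f => e.cost + f.cost + 1
  | .not b => b.cost + 1

def State.setI (s : State) (x n : ℕ) : State :=
  { s with reg := fun y => if y = x then n else s.reg y }

def State.setR (s : State) (a i : ℕ) (r : ℝ) : State :=
  { s with arr := fun a' i' => if a' = a ∧ i' = i then r else s.arr a' i' }

def State.toss {d : ℕ} (s : State) (ω : Tape d) (x : ℕ) : State :=
  { s with
    reg := fun y => if y = x then (ω.1 s.tosses).toNat else s.reg y
    tosses := s.tosses + 1 }

def State.draw {d : ℕ} (s : State) (ω : Tape d) (b : Fin 2) (a i : ℕ) : State :=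
  { s with
    arr := fun a' i' =>
      if h : a' = a ∧ i ≤ i' ∧ i' - i < d then ω.sample b (s.drawn b) ⟨i' - i, h.2.2⟩
      else s.arr a' i'
    drawn := fun c => if c = b then s.drawn c + 1 else s.drawn c }

/-- `Exec ω p s s' t`: started in the state `s` with the external randomness `ω`, the program `p`
halts in the state `s'` after exactly `t` steps. -/
inductive Exec {d : ℕ} (ω : Tape d) : Prog → State → State → ℕ → Prop
  | skip (s : State) : Exec ω .skip s s 1
  | setI (s : State) (x : ℕ) (e : IExp) :
      Exec ω (.setI x e) s (s.setI x (e.eval s)) (e.cost + 1)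
  | setR (s : State) (a : ℕ) (i : IExp) (e : RExp) :
      Exec ω (.setR a i e) s (s.setR a (i.eval s) (e.eval s)) (i.cost + e.cost + 1)
  | toss (s : State) (x : ℕ) : Exec ω (.toss x) s (s.toss ω x) 1
  | draw (s : State) (b : Fin 2) (a : ℕ) (i : IExp) :
      Exec ω (.draw b a i) s (s.draw ω b a (i.eval s)) (i.cost + d + 1)
  | seq {p q : Prog} {s s' s'' : State} {t t' : ℕ} :
      Exec ω p s s' t → Exec ω q s' s'' t' → Exec ω (.seq p q) s s'' (t + t')
  | ite_true {c : BExp} {p q : Prog} {s s' : State} {t : ℕ} :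
      c.Holds s → Exec ω p s s' t → Exec ω (.ite c p q) s s' (c.cost + t + 1)
  | ite_false {c : BExp} {p q : Prog} {s s' : State} {t : ℕ} :
      ¬ c.Holds s → Exec ω q s s' t → Exec ω (.ite c p q) s s' (c.cost + t + 1)
  | while_true {c : BExp} {p : Prog} {s s' s'' : State} {t t' : ℕ} :
      c.Holds s → Exec ω p s s' t → Exec ω (.while c p) s' s'' t' →
      Exec ω (.while c p) s s'' (c.cost + t + t' + 1)
  | while_false {c : BExp} {p : Prog} {s : State} :
      ¬ c.Holds s → Exec ω (.while c p) s s (c.cost + 1)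

/-- The machine is deterministic once the external randomness is fixed. -/
theorem Exec.unique {d : ℕ} {ω : Tape d} {p : Prog} {s s₁ : State} {t₁ : ℕ}
    (h₁ : Exec ω p s s₁ t₁) :
    ∀ {s₂ : State} {t₂ : ℕ}, Exec ω p s s₂ t₂ → s₁ = s₂ ∧ t₁ = t₂ := by
  induction h₁ with
  | skip s => intro _ _ h; cases h; exact ⟨rfl, rfl⟩
  | setI s x e => intro _ _ h; cases h; exact ⟨rfl, rfl⟩
  | setR s a i e => intro _ _ h; cases h; exact ⟨rfl, rfl⟩
  | toss s x => intro _ _ h; cases h; exact ⟨rfl, rfl⟩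
  | draw s b a i => intro _ _ h; cases h; exact ⟨rfl, rfl⟩
  | seq _ _ ih ih' =>
    intro _ _ h
    cases h with
    | seq k k' =>
      obtain ⟨rfl, rfl⟩ := ih k
      obtain ⟨rfl, rfl⟩ := ih' k'
      exact ⟨rfl, rfl⟩
  | ite_true hc _ ih =>
    intro _ _ h
    cases h with
    | ite_true _ k => obtain ⟨rfl, rfl⟩ := ih k; exact ⟨rfl, rfl⟩
    | ite_false hn _ => exact absurd hc hn
  | ite_false hc _ ih =>
    intro _ _ h
    cases h with
    | ite_true hn _ => exact absurd hn hc
    | ite_false _ k => obtain ⟨rfl, rfl⟩ := ih k; exact ⟨rfl, rfl⟩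
  | while_true hc _ _ ih ih' =>
    intro _ _ h
    cases h with
    | while_true _ k k' =>
      obtain ⟨rfl, rfl⟩ := ih k
      obtain ⟨rfl, rfl⟩ := ih' k'
      exact ⟨rfl, rfl⟩
    | while_false hn => exact absurd hc hn
  | while_false hc =>
    intro _ _ h
    cases h with
    | while_true hn _ _ => exact absurd hn hc
    | while_false _ => exact ⟨rfl, rfl⟩

/-- The initial state: the register `0` holds the dimension, the first four cells of the array `0`
hold the real parameters, and everything else is zero. -/
noncomputable def input (d : ℕ) (α η δ σ : ℝ) : State where
  reg := fun x => if x = 0 then d else 0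
  arr := fun a i =>
    if a = 0 then
      if i = 0 then α else if i = 1 then η else if i = 2 then δ else if i = 3 then σ else 0
    else 0
  tosses := 0
  drawn := fun _ => 0

/-- The output vector is read from the first `d` cells of the array `1`. -/
noncomputable def output (d : ℕ) (s : State) : EuclideanSpace ℝ (Fin d) :=
  WithLp.toLp 2 fun i : Fin d => s.arr 1 i

end RealRAM

/-- `D` is a mean-zero distribution with `𝔼 ‖z‖² ≤ σ²` for `z ∼ D`. -/
def IsCenteredNoise {d : ℕ} (D : Measure (EuclideanSpace ℝ (Fin d))) (σ : ℝ) : Prop :=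
  MemLp (fun z => z) 2 D ∧ ∫ z, z ∂D = 0 ∧ ∫ z, ‖z‖ ^ 2 ∂D ≤ σ ^ 2

/-- The law of `ξ + z` for independent `ξ ∼ Dξ` and `z ∼ D`. -/
noncomputable def noisyLaw {d : ℕ} (Dξ D : Measure (EuclideanSpace ℝ (Fin d))) :
    Measure (EuclideanSpace ℝ (Fin d)) :=
  Measure.conv Dξ D

/-- The joint law of the external randomness of a run: independent fair bits, independent samples
of `ξ + z₁` from the first source, and independent samples of `ξ + z₂ + v` from the second. -/
noncomputable def tapeLaw {d : ℕ} (Dξ D₁ D₂ : Measure (EuclideanSpace ℝ (Fin d)))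
    (v : EuclideanSpace ℝ (Fin d)) : Measure (RealRAM.Tape d) :=
  (Measure.infinitePi fun _ : ℕ => (PMF.uniformOfFintype Bool).toMeasure).prod
    ((Measure.infinitePi fun _ : ℕ => noisyLaw Dξ D₁).prod
      (Measure.infinitePi fun _ : ℕ => (noisyLaw Dξ D₂).map fun y => y + v))

/-! Write `ψ x = x / (1 + ‖x‖)` (`softClip`), fix the scale `r = 1 / (b * σ)` with `b ≈ 64 / η`, and
estimate the shift by a root `u` of the equation "mean of `ψ (r • (y₂ - u))` = mean of `ψ (r •
y₁)`". The two sides share the law of `ξ`, so at `u = v` they differ only through the noise. Because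
the noise is centred, the linear term of its effect vanishes, and the Taylor remainder of `ψ` at `r
• ξ` is at most a constant times `‖r • z‖ ^ 2 / (1 + ‖r • ξ‖) ^ 2` (`norm_softClip_add_sub_le`).
Hence the bias is `O(A / b ^ 2)` with `A = 𝔼 1 / (1 + ‖r • ξ‖) ^ 2` (`priorWeight`).

The map `ψ` is monotone with a modulus carrying the same weight `1 / (1 + ‖x‖) ^ 2`
(`softClip_strong_mono`, `clipMean_strong_mono`). So `A` cancels in the ratio of bias to modulus: a
root satisfies `‖r • (u - v)‖ = O(1 / b ^ 2)`, that is `‖u - v‖ = O(σ / b) = O(η * σ)`, with a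
constant free of `α` and of the law of `ξ`.

The atom of `ξ` at `0` has two uses. It gives `A ≥ α`, so empirical means accurate to `1 / (a * b ^
2)` with `a ≥ 1 / α` are as good as exact ones; a dimension-free Hoeffding inequality for bounded
vectors (`measure_empirical_mean_dev_le`) makes polynomially many samples enough. It also makes some
sample of the second source lie within `1 / r` of `v`. From such a start the descent `w ↦ w -
(clipMean n x w - t)` contracts, since `ψ` is cocoercive (`softClip_cocoercive`,
`exists_norm_descent_le`). The good start is not known, so descent is run from every sample, and a
point with small residual is returned; any such point is close to `v` (`GoodSample.norm_sub_le`).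

On the machine, norms are replaced by Newton iterates started at the `ℓ¹` norm, with an error that
is uniform in the vector (`norm_approxClip_sub_le`). The program is then verified with loop
invariants and frame conditions. -/

/-! ### The soft clipping map `x ↦ x / (1 + ‖x‖)` -/

section SoftClip

variable {E : Type*} [NormedAddCommGroup E] [InnerProductSpace ℝ E]

/-- The soft clipping map. -/
noncomputable def softClip (x : E) : E := (1 / (1 + ‖x‖)) • x

theorem norm_softClip (x : E) : ‖softClip x‖ = ‖x‖ / (1 + ‖x‖) := by
  have : 0 ≤ ‖x‖ := norm_nonneg x
  rw [softClip, norm_smul, Real.norm_of_nonneg (by positivity)]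
  ring

theorem norm_softClip_le (x : E) : ‖softClip x‖ ≤ 1 := by
  have : 0 ≤ ‖x‖ := norm_nonneg x
  rw [norm_softClip, div_le_one (by positivity)]
  linarith

theorem continuous_softClip : Continuous (softClip : E → E) := by
  unfold softClip
  refine Continuous.smul (Continuous.div continuous_const (by fun_prop) fun x => ?_) continuous_id
  positivity

/-- Over the common denominator the two sides differ by `(‖x‖ + ‖y‖) * (‖x‖ * ‖y‖ - ⟪x, y⟫)`, which
is nonnegative by Cauchy–Schwarz. -/
theorem softClip_strong_mono (x y : E) :
    ‖x - y‖ ^ 2 / ((1 + ‖x‖) * (1 + ‖y‖)) ≤ inner ℝ (softClip x - softClip y) (x - y) := by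
  have ha : 0 ≤ ‖x‖ := norm_nonneg x
  have hb : 0 ≤ ‖y‖ := norm_nonneg y
  have hc : inner ℝ x y ≤ ‖x‖ * ‖y‖ := real_inner_le_norm x y
  have e : inner ℝ (softClip x - softClip y) (x - y)
      = (‖x‖ ^ 2 * (1 + ‖y‖) + ‖y‖ ^ 2 * (1 + ‖x‖) - (2 + ‖x‖ + ‖y‖) * inner ℝ x y)
        / ((1 + ‖x‖) * (1 + ‖y‖)) := by
    simp only [softClip, inner_sub_left, inner_sub_right, real_inner_smul_left,
      real_inner_self_eq_norm_sq, real_inner_comm x y]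
    field_simp
    ring
  rw [e, norm_sub_sq_real]
  gcongr
  nlinarith [mul_nonneg (add_nonneg ha hb) (sub_nonneg.2 hc)]

/-- This is what permits descent with step size one. By Cauchy–Schwarz the inner product may be
replaced by `‖x‖ * ‖y‖`, and then the numerator is `(‖x‖ - ‖y‖) ^ 2 * (‖x‖ + ‖y‖ + ‖x‖ * ‖y‖)`. -/
theorem softClip_cocoercive (x y : E) :
    ‖softClip x - softClip y‖ ^ 2 ≤ inner ℝ (softClip x - softClip y) (x - y) := by
  have ha : 0 ≤ ‖x‖ := norm_nonneg x
  have hb : 0 ≤ ‖y‖ := norm_nonneg y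
  have hc : inner ℝ x y ≤ ‖x‖ * ‖y‖ := real_inner_le_norm x y
  have e : inner ℝ (softClip x - softClip y) (x - y) - ‖softClip x - softClip y‖ ^ 2
      = (‖x‖ ^ 3 * (1 + ‖y‖) ^ 2 + ‖y‖ ^ 3 * (1 + ‖x‖) ^ 2
          - (‖x‖ + ‖y‖) * ((1 + ‖x‖) * (1 + ‖y‖)) * inner ℝ x y)
        / ((1 + ‖x‖) ^ 2 * (1 + ‖y‖) ^ 2) := by
    rw [← real_inner_self_eq_norm_sq]
    simp only [softClip, inner_sub_left, inner_sub_right, real_inner_smul_left,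
      real_inner_smul_right]
    simp only [real_inner_self_eq_norm_sq, real_inner_comm x y]
    field_simp
    ring
  rw [← sub_nonneg, e]
  apply div_nonneg _ (by positivity)
  have h1 : (‖x‖ + ‖y‖) * ((1 + ‖x‖) * (1 + ‖y‖)) * inner ℝ x y
      ≤ (‖x‖ + ‖y‖) * ((1 + ‖x‖) * (1 + ‖y‖)) * (‖x‖ * ‖y‖) := by gcongr
  have h2 : 0 ≤ (‖x‖ - ‖y‖) ^ 2 * (‖x‖ + ‖y‖ + ‖x‖ * ‖y‖) := by positivity
  nlinarith [h1, h2]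

/-- The derivative of `softClip` at `x`. -/
noncomputable def softClipDeriv (x : E) : E →L[ℝ] E :=
  (1 / (1 + ‖x‖)) • ContinuousLinearMap.id ℝ E
    - (1 / (‖x‖ * (1 + ‖x‖) ^ 2)) • (innerSL ℝ x).smulRight x

theorem softClipDeriv_apply (x s : E) : softClipDeriv x s =
    (1 / (1 + ‖x‖)) • s - (1 / (‖x‖ * (1 + ‖x‖) ^ 2) * inner ℝ x s) • x := by
  simp [softClipDeriv, smul_smul]

theorem norm_softClipDeriv_apply_le (x s : E) :
    ‖softClipDeriv x s‖ ≤ 2 * ‖s‖ / (1 + ‖x‖) := by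
  have ha : 0 ≤ ‖x‖ := norm_nonneg x
  rw [softClipDeriv_apply]
  refine (norm_sub_le _ _).trans ?_
  rw [norm_smul, norm_smul, Real.norm_of_nonneg (by positivity), Real.norm_eq_abs, abs_mul,
    abs_of_nonneg (by positivity : 0 ≤ 1 / (‖x‖ * (1 + ‖x‖) ^ 2))]
  have h1 : 1 / (‖x‖ * (1 + ‖x‖) ^ 2) * |inner ℝ x s| * ‖x‖ ≤ ‖s‖ / (1 + ‖x‖) := by
    rcases ha.eq_or_lt with h0 | h0
    · rw [← h0]; simp
    have h2 := abs_real_inner_le_norm x s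
    calc 1 / (‖x‖ * (1 + ‖x‖) ^ 2) * |inner ℝ x s| * ‖x‖
        ≤ 1 / (‖x‖ * (1 + ‖x‖) ^ 2) * (‖x‖ * ‖s‖) * ‖x‖ := by gcongr
      _ = ‖s‖ / (1 + ‖x‖) * (‖x‖ / (1 + ‖x‖)) := by field_simp
      _ ≤ ‖s‖ / (1 + ‖x‖) * 1 := by
          gcongr
          rw [div_le_one (by positivity)]; linarith
      _ = _ := mul_one _
  calc _ ≤ 1 / (1 + ‖x‖) * ‖s‖ + ‖s‖ / (1 + ‖x‖) := by gcongr
    _ = _ := by ring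

/-- The decay `1 / (1 + ‖x‖) ^ 2` of the remainder, equal to that of the monotonicity modulus, is
the crux of the whole argument. If `‖s‖ ≥ (1 + ‖x‖) / 2`, the three terms are bounded separately and
the right-hand side is at least `3`; otherwise `1 + ‖x + s‖` is comparable to `1 + ‖x‖` and the
first-order parts cancel explicitly. At `x = 0` division by zero makes `softClipDeriv` the identity,
the correct derivative. -/
theorem norm_softClip_add_sub_le (x s : E) :
    ‖softClip (x + s) - softClip x - softClipDeriv x s‖ ≤ 12 * ‖s‖ ^ 2 / (1 + ‖x‖) ^ 2 := by
  have ha : 0 ≤ ‖x‖ := norm_nonneg x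
  have hs : 0 ≤ ‖s‖ := norm_nonneg s
  have hb : 0 ≤ ‖x + s‖ := norm_nonneg _
  have hab : |‖x + s‖ - ‖x‖| ≤ ‖s‖ := by
    simpa using abs_norm_sub_norm_le (x + s) x
  rcases le_total ((1 + ‖x‖) / 2) ‖s‖ with h | h
  · have h1 : 1 ≤ 2 * ‖s‖ / (1 + ‖x‖) := by
      rw [le_div_iff₀ (by positivity)]; linarith
    have h2 : 1 ≤ (2 * ‖s‖ / (1 + ‖x‖)) ^ 2 := one_le_pow₀ h1
    have h3 : 2 * ‖s‖ / (1 + ‖x‖) ≤ (2 * ‖s‖ / (1 + ‖x‖)) ^ 2 := by nlinarith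
    calc _ ≤ ‖softClip (x + s)‖ + ‖softClip x‖ + ‖softClipDeriv x s‖ :=
          (norm_sub_le _ _).trans (by gcongr; exact norm_sub_le _ _)
      _ ≤ 1 + 1 + 2 * ‖s‖ / (1 + ‖x‖) :=
          add_le_add (add_le_add (norm_softClip_le _) (norm_softClip_le _))
            (norm_softClipDeriv_apply_le x s)
      _ ≤ 3 * (2 * ‖s‖ / (1 + ‖x‖)) ^ 2 := by linarith
      _ = _ := by rw [div_pow]; ring
  · have h1 : (1 + ‖x‖) / 2 ≤ 1 + ‖x + s‖ := by
      have := (abs_le.1 hab).1; linarith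
    have hsq : ‖x + s‖ ^ 2 = ‖x‖ ^ 2 + 2 * inner ℝ x s + ‖s‖ ^ 2 := norm_add_sq_real x s
    set δ := ‖x + s‖ - ‖x‖ with hδ
    have hbe : ‖x + s‖ = ‖x‖ + δ := by ring
    have e : softClip (x + s) - softClip x - softClipDeriv x s
        = (-δ / ((1 + ‖x‖) * (1 + ‖x + s‖))) • s
          + (-δ / ((1 + ‖x‖) * (1 + ‖x + s‖)) + inner ℝ x s / (‖x‖ * (1 + ‖x‖) ^ 2)) • x := by
      rw [softClipDeriv_apply, softClip, softClip, smul_add]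
      have e1 : (1 / (1 + ‖x + s‖)) = 1 / (1 + ‖x‖) + -δ / ((1 + ‖x‖) * (1 + ‖x + s‖)) := by
        rw [hδ]; field_simp; ring
      rw [e1]
      module
    have k1 : |(-δ / ((1 + ‖x‖) * (1 + ‖x + s‖)))| * ‖s‖ ≤ 2 * ‖s‖ ^ 2 / (1 + ‖x‖) ^ 2 := by
      rw [abs_div, abs_neg, abs_of_nonneg (by positivity : 0 ≤ (1 + ‖x‖) * (1 + ‖x + s‖))]
      calc _ ≤ ‖s‖ / ((1 + ‖x‖) * ((1 + ‖x‖) / 2)) * ‖s‖ := by gcongr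
        _ = _ := by field_simp
    have k2 : |(-δ / ((1 + ‖x‖) * (1 + ‖x + s‖)) + inner ℝ x s / (‖x‖ * (1 + ‖x‖) ^ 2))| * ‖x‖
        ≤ 3 * ‖s‖ ^ 2 / (1 + ‖x‖) ^ 2 := by
      rcases ha.eq_or_lt with h0 | h0
      · rw [← h0]; simp
      -- Squaring `‖x + s‖ = ‖x‖ + δ` expresses the inner product through `δ`; the remaining terms
      -- are quadratic in `δ` and `‖s‖`.
      have hi : inner ℝ x s = ‖x‖ * δ + (δ ^ 2 - ‖s‖ ^ 2) / 2 := by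
        rw [hbe] at hsq; nlinarith
      have e2 : (-δ / ((1 + ‖x‖) * (1 + ‖x + s‖)) + inner ℝ x s / (‖x‖ * (1 + ‖x‖) ^ 2)) * ‖x‖
          = δ ^ 2 / ((1 + ‖x‖) * (1 + ‖x + s‖)) * (‖x‖ / (1 + ‖x‖))
            - ((‖s‖ ^ 2 - δ ^ 2) / 2) / (1 + ‖x‖) ^ 2 := by
        rw [hi, hbe]
        have : 1 + (‖x‖ + δ) ≠ 0 := by rw [← hbe]; positivity
        field_simp
        ring
      have hd2 : δ ^ 2 ≤ ‖s‖ ^ 2 := sq_le_sq.2 (by rwa [abs_of_nonneg hs])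
      have u1 : δ ^ 2 / ((1 + ‖x‖) * (1 + ‖x + s‖)) * (‖x‖ / (1 + ‖x‖))
          ≤ 2 * ‖s‖ ^ 2 / (1 + ‖x‖) ^ 2 := by
        calc _ ≤ ‖s‖ ^ 2 / ((1 + ‖x‖) * ((1 + ‖x‖) / 2)) * 1 := by
              gcongr
              rw [div_le_one (by positivity)]; linarith
          _ = _ := by field_simp
      have u0 : 0 ≤ δ ^ 2 / ((1 + ‖x‖) * (1 + ‖x + s‖)) * (‖x‖ / (1 + ‖x‖)) := by positivity
      have v0 : 0 ≤ ((‖s‖ ^ 2 - δ ^ 2) / 2) / (1 + ‖x‖) ^ 2 := by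
        apply div_nonneg (by linarith) (by positivity)
      have v1 : ((‖s‖ ^ 2 - δ ^ 2) / 2) / (1 + ‖x‖) ^ 2 ≤ ‖s‖ ^ 2 / (1 + ‖x‖) ^ 2 := by
        gcongr
        nlinarith [sq_nonneg δ]
      have e3 : |(-δ / ((1 + ‖x‖) * (1 + ‖x + s‖)) + inner ℝ x s / (‖x‖ * (1 + ‖x‖) ^ 2))| * ‖x‖
          = |(-δ / ((1 + ‖x‖) * (1 + ‖x + s‖))
              + inner ℝ x s / (‖x‖ * (1 + ‖x‖) ^ 2)) * ‖x‖| := by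
        rw [abs_mul, abs_of_nonneg ha]
      rw [e3, e2, abs_le]
      have e4 : 3 * ‖s‖ ^ 2 / (1 + ‖x‖) ^ 2
          = 2 * ‖s‖ ^ 2 / (1 + ‖x‖) ^ 2 + ‖s‖ ^ 2 / (1 + ‖x‖) ^ 2 := by ring
      have : 0 ≤ ‖s‖ ^ 2 / (1 + ‖x‖) ^ 2 := by positivity
      have : 0 ≤ 2 * ‖s‖ ^ 2 / (1 + ‖x‖) ^ 2 := by positivity
      constructor <;> linarith
    rw [e]
    refine (norm_add_le _ _).trans ?_
    rw [norm_smul, norm_smul, Real.norm_eq_abs, Real.norm_eq_abs]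
    calc _ ≤ 2 * ‖s‖ ^ 2 / (1 + ‖x‖) ^ 2 + 3 * ‖s‖ ^ 2 / (1 + ‖x‖) ^ 2 := add_le_add k1 k2
      _ = 5 * ‖s‖ ^ 2 / (1 + ‖x‖) ^ 2 := by ring
      _ ≤ _ := by gcongr; norm_num

end SoftClip

/-! ### A dimension-free Hoeffding inequality -/

section Hoeffding

open ProbabilityTheory

variable {E : Type*} [NormedAddCommGroup E]

/-- A smooth substitute for `‖s‖`. -/
noncomputable def smoothNorm (c : ℝ) (s : E) : ℝ := Real.sqrt (1 + c ^ 2 * ‖s‖ ^ 2)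

theorem le_smoothNorm {c : ℝ} (s : E) : c * ‖s‖ ≤ smoothNorm c s := by
  apply Real.le_sqrt_of_sq_le
  nlinarith

theorem one_le_smoothNorm (c : ℝ) (s : E) : 1 ≤ smoothNorm c s := by
  apply Real.le_sqrt_of_sq_le
  nlinarith [mul_nonneg (sq_nonneg c) (sq_nonneg ‖s‖)]

@[fun_prop]
theorem continuous_smoothNorm (c : ℝ) : Continuous (smoothNorm c : E → ℝ) := by
  unfold smoothNorm; fun_prop

variable [InnerProductSpace ℝ E]

/-- The square root lies below its tangent at `1 + c ^ 2 * ‖s‖ ^ 2`, and the slope there is at most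
`1 / 2`. -/
theorem smoothNorm_add_le (c : ℝ) (s x : E) :
    smoothNorm c (s + x) ≤ smoothNorm c s + inner ℝ ((c ^ 2 / smoothNorm c s) • s) x
      + c ^ 2 * ‖x‖ ^ 2 / 2 := by
  have h1 := one_le_smoothNorm c s
  have hsq : smoothNorm c s ^ 2 = 1 + c ^ 2 * ‖s‖ ^ 2 := Real.sq_sqrt (by positivity)
  have h2 : smoothNorm c (s + x) ≤ smoothNorm c s
      + (c ^ 2 * (2 * inner ℝ s x + ‖x‖ ^ 2)) / (2 * smoothNorm c s) := by
    have hnn : 0 ≤ smoothNorm c (s + x) := Real.sqrt_nonneg _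
    have hsq' : smoothNorm c (s + x) ^ 2 = 1 + c ^ 2 * ‖s + x‖ ^ 2 := Real.sq_sqrt (by positivity)
    rw [norm_add_sq_real] at hsq'
    rw [← sub_le_iff_le_add', le_div_iff₀ (by positivity)]
    nlinarith [sq_nonneg (smoothNorm c (s + x) - smoothNorm c s)]
  refine h2.trans ?_
  have e : (c ^ 2 * (2 * inner ℝ s x + ‖x‖ ^ 2)) / (2 * smoothNorm c s)
      = inner ℝ ((c ^ 2 / smoothNorm c s) • s) x + c ^ 2 * ‖x‖ ^ 2 / (2 * smoothNorm c s) := by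
    rw [real_inner_smul_left]; field_simp
  rw [e, ← add_assoc]
  gcongr
  linarith

variable [CompleteSpace E] [MeasurableSpace E] [BorelSpace E] [SecondCountableTopology E]

/-- The linear term of the increment is the pairing of `X` with a fixed vector `p` of norm at most
`c`, so it has mean zero and modulus at most `2 * c ≤ 1`, where `exp t ≤ 1 + t + t ^ 2`. The
exponent `6 * c ^ 2` collects `2 * c ^ 2` from the quadratic term and `4 * c ^ 2` from `t ^ 2`. -/
theorem integral_exp_smoothNorm_add_le {Ω : Type*} [MeasurableSpace Ω] (μ : Measure Ω)
    [IsProbabilityMeasure μ] {X : Ω → E} (hX : Measurable X) (hb : ∀ ω, ‖X ω‖ ≤ 2)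
    (h0 : ∫ ω, X ω ∂μ = 0) {c : ℝ} (hc : 0 ≤ c) (hc' : c ≤ 1 / 2) (s : E) :
    ∫ ω, Real.exp (smoothNorm c (s + X ω)) ∂μ
      ≤ Real.exp (smoothNorm c s) * Real.exp (6 * c ^ 2) := by
  have h1 := one_le_smoothNorm c s
  set p : E := (c ^ 2 / smoothNorm c s) • s with hp
  have hpn : ‖p‖ ≤ c := by
    rw [hp, norm_smul, Real.norm_of_nonneg (by positivity), div_mul_eq_mul_div, div_le_iff₀
      (by positivity)]
    nlinarith [le_smoothNorm (c := c) s]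
  have hXi : Integrable X μ := by
    refine Integrable.of_bound hX.aestronglyMeasurable 2 (Filter.Eventually.of_forall hb)
  have hti : Integrable (fun ω => inner ℝ p (X ω)) μ := hXi.const_inner p
  have ht0 : ∫ ω, inner ℝ p (X ω) ∂μ = 0 := by
    rw [integral_inner hXi, h0, inner_zero_right]
  have hpt : ∀ ω, |inner ℝ p (X ω)| ≤ c * 2 := fun ω =>
    (abs_real_inner_le_norm _ _).trans (mul_le_mul hpn (hb ω) (norm_nonneg _) hc)
  have key : ∀ ω, Real.exp (smoothNorm c (s + X ω)) ≤ Real.exp (smoothNorm c s) *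
      Real.exp (2 * c ^ 2) * (1 + inner ℝ p (X ω) + 4 * c ^ 2) := by
    intro ω
    have e1 : smoothNorm c (s + X ω) ≤ smoothNorm c s + inner ℝ p (X ω) + 2 * c ^ 2 := by
      refine (smoothNorm_add_le c s (X ω)).trans ?_
      have : ‖X ω‖ ^ 2 ≤ 2 ^ 2 := pow_le_pow_left₀ (norm_nonneg _) (hb ω) 2
      nlinarith [sq_nonneg c]
    have e2 : Real.exp (inner ℝ p (X ω)) ≤ 1 + inner ℝ p (X ω) + 4 * c ^ 2 := by
      have := (abs_le.1 (Real.abs_exp_sub_one_sub_id_le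
        (x := inner ℝ p (X ω)) ((hpt ω).trans (by linarith)))).2
      have : (inner ℝ p (X ω)) ^ 2 ≤ (c * 2) ^ 2 := sq_le_sq.2 (by
        rw [abs_of_nonneg (by positivity : 0 ≤ c * 2)]; exact hpt ω)
      nlinarith
    calc _ ≤ Real.exp (smoothNorm c s + inner ℝ p (X ω) + 2 * c ^ 2) := Real.exp_le_exp.2 e1
      _ = Real.exp (smoothNorm c s) * Real.exp (2 * c ^ 2) * Real.exp (inner ℝ p (X ω)) := by
        rw [Real.exp_add, Real.exp_add]; ring
      _ ≤ _ := by gcongr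
  calc _ ≤ ∫ ω, Real.exp (smoothNorm c s) *
      Real.exp (2 * c ^ 2) * (1 + inner ℝ p (X ω) + 4 * c ^ 2) ∂μ := by
        apply integral_mono_of_nonneg (Filter.Eventually.of_forall fun ω => (Real.exp_pos _).le)
        · exact ((((integrable_const _).add hti).add (integrable_const _)).const_mul _)
        · exact Filter.Eventually.of_forall key
    _ = Real.exp (smoothNorm c s) * Real.exp (2 * c ^ 2) * (1 + 4 * c ^ 2) := by
        have e1 : ∫ ω, (1 + inner ℝ p (X ω) + 4 * c ^ 2) ∂μ = 1 + 4 * c ^ 2 := by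
          rw [integral_add (f := fun ω => 1 + inner ℝ p (X ω))
            ((integrable_const _).add hti) (integrable_const _),
            integral_add (integrable_const _) hti, ht0]
          simp
        rw [integral_const_mul, e1]
    _ ≤ Real.exp (smoothNorm c s) * Real.exp (2 * c ^ 2) * Real.exp (4 * c ^ 2) := by
        gcongr
        linarith [Real.add_one_le_exp (4 * c ^ 2)]
    _ = _ := by rw [mul_assoc, ← Real.exp_add]; ring_nf

/-- The last summand is independent of the earlier ones, so Fubini allows it to be integrated out
first with the partial sum frozen. The summand `1` in the exponent is `smoothNorm c 0`. -/
theorem integral_exp_smoothNorm_sum_le {Ω : Type*} [MeasurableSpace Ω] {μ : Measure Ω}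
    [IsProbabilityMeasure μ] {X : ℕ → Ω → E} (hX : ∀ i, Measurable (X i))
    (hb : ∀ i ω, ‖X i ω‖ ≤ 2) (h0 : ∀ i, ∫ ω, X i ω ∂μ = 0) (hind : iIndepFun X μ)
    {c : ℝ} (hc : 0 ≤ c) (hc' : c ≤ 1 / 2) (n : ℕ) :
    ∫ ω, Real.exp (smoothNorm c (∑ i ∈ Finset.range n, X i ω)) ∂μ
      ≤ Real.exp (1 + n * (6 * c ^ 2)) := by
  induction n with
  | zero => simp [smoothNorm]
  | succ n ih =>
    set S : Ω → E := fun ω => ∑ i ∈ Finset.range n, X i ω with hS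
    have hSm : Measurable S := by
      rw [hS]; exact Finset.measurable_sum _ fun i _ => hX i
    have hSb : ∀ ω, ‖S ω‖ ≤ n * 2 := fun ω => by
      refine (norm_sum_le_of_le _ (fun i _ => hb i ω)).trans (by simp)
    have hi : IndepFun S (X n) μ := by
      have := hind.indepFun_finsetSum_of_notMem hX (s := Finset.range n) (i := n) (by simp)
      convert this using 1
      ext ω; simp [hS]
    have hsn : ∀ (s : E) (B : ℝ), 0 ≤ B → ‖s‖ ≤ B →
        Real.exp (smoothNorm c s) ≤ Real.exp (Real.sqrt (1 + c ^ 2 * B ^ 2)) := by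
      intro s B _ h
      unfold smoothNorm
      gcongr
    have hce : Continuous fun s : E => Real.exp (smoothNorm c s) :=
      Real.continuous_exp.comp (continuous_smoothNorm c)
    have hce2 : Continuous fun q : E × E => Real.exp (smoothNorm c (q.1 + q.2)) :=
      hce.comp continuous_add
    have hmap := (indepFun_iff_map_prod_eq_prod_map_map hSm.aemeasurable
      (hX n).aemeasurable).1 hi
    have : IsProbabilityMeasure (μ.map S) := Measure.isProbabilityMeasure_map hSm.aemeasurable
    have : IsProbabilityMeasure (μ.map (X n)) :=
      Measure.isProbabilityMeasure_map (hX n).aemeasurable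
    have hint : Integrable (fun q : E × E => Real.exp (smoothNorm c (q.1 + q.2)))
        ((μ.map S).prod (μ.map (X n))) := by
      rw [← hmap, integrable_map_measure hce2.aestronglyMeasurable (by fun_prop)]
      refine Integrable.of_bound (C := Real.exp (Real.sqrt (1 + c ^ 2 * (n * 2 + 2) ^ 2))) ?_ ?_
      · exact (hce.measurable.comp (hSm.add (hX n))).aestronglyMeasurable
      · refine Filter.Eventually.of_forall fun ω => ?_
        simp only [Function.comp]
        rw [Real.norm_of_nonneg (Real.exp_pos _).le]
        exact hsn _ _ (by positivity) ((norm_add_le _ _).trans (add_le_add (hSb ω) (hb n ω)))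
    have hint' : Integrable (fun ω => Real.exp (smoothNorm c (S ω))) μ := by
      refine Integrable.of_bound (C := Real.exp (Real.sqrt (1 + c ^ 2 * (n * 2) ^ 2)))
        (hce.measurable.comp hSm).aestronglyMeasurable (Filter.Eventually.of_forall fun ω => ?_)
      rw [Real.norm_of_nonneg (Real.exp_pos _).le]
      exact hsn _ _ (by positivity) (hSb ω)
    calc ∫ ω, Real.exp (smoothNorm c (∑ i ∈ Finset.range (n + 1), X i ω)) ∂μ
        = ∫ ω, Real.exp (smoothNorm c (S ω + X n ω)) ∂μ := by simp [Finset.sum_range_succ, hS]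
      _ = ∫ q, Real.exp (smoothNorm c (q.1 + q.2)) ∂(μ.map fun ω => (S ω, X n ω)) := by
          rw [integral_map (by fun_prop) hce2.aestronglyMeasurable]
      _ = ∫ s, ∫ x, Real.exp (smoothNorm c (s + x)) ∂(μ.map (X n)) ∂(μ.map S) := by
          rw [hmap, integral_prod _ hint]
      _ = ∫ ω, ∫ ω', Real.exp (smoothNorm c (S ω + X n ω')) ∂μ ∂μ := by
          rw [integral_map hSm.aemeasurable hint.integral_prod_left.aestronglyMeasurable]
          congr 1
          ext ω
          exact integral_map (hX n).aemeasurable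
            (hce.comp (continuous_const.add continuous_id)).aestronglyMeasurable
      _ ≤ ∫ ω, Real.exp (smoothNorm c (S ω)) * Real.exp (6 * c ^ 2) ∂μ := by
          apply integral_mono_of_nonneg
          · exact Filter.Eventually.of_forall fun ω => integral_nonneg fun _ => (Real.exp_pos _).le
          · exact hint'.mul_const _
          · exact Filter.Eventually.of_forall fun ω =>
              integral_exp_smoothNorm_add_le μ (hX n) (hb n) (h0 n) hc hc' (S ω)
      _ ≤ Real.exp (1 + n * (6 * c ^ 2)) * Real.exp (6 * c ^ 2) := by
          rw [integral_mul_const]; gcongr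
      _ = _ := by rw [← Real.exp_add]; push_cast; ring_nf

/-- Dimension-free Hoeffding inequality for centred vectors of norm at most `2`. -/
theorem measure_norm_sum_ge_le {Ω : Type*} [MeasurableSpace Ω] {μ : Measure Ω}
    [IsProbabilityMeasure μ] {X : ℕ → Ω → E} (hX : ∀ i, Measurable (X i))
    (hb : ∀ i ω, ‖X i ω‖ ≤ 2) (h0 : ∀ i, ∫ ω, X i ω ∂μ = 0) (hind : iIndepFun X μ)
    {ε : ℝ} (hε : 0 < ε) (hε' : ε ≤ 1) (n : ℕ) :
    μ {ω | n * ε ≤ ‖∑ i ∈ Finset.range n, X i ω‖}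
      ≤ ENNReal.ofReal (Real.exp (1 - n * ε ^ 2 / 24)) := by
  -- This choice minimises the exponent `1 + 6 * n * c ^ 2 - c * n * ε` of the Markov bound.
  set c := ε / 12 with hc
  have hce : Continuous fun s : E => Real.exp (smoothNorm c s) :=
    Real.continuous_exp.comp (continuous_smoothNorm c)
  have hSm : Measurable fun ω => ∑ i ∈ Finset.range n, X i ω :=
    Finset.measurable_sum _ fun i _ => hX i
  have hint : Integrable (fun ω => Real.exp (smoothNorm c (∑ i ∈ Finset.range n, X i ω))) μ := by
    refine Integrable.of_bound (C := Real.exp (Real.sqrt (1 + c ^ 2 * (n * 2) ^ 2)))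
      (hce.measurable.comp hSm).aestronglyMeasurable (Filter.Eventually.of_forall fun ω => ?_)
    rw [Real.norm_of_nonneg (Real.exp_pos _).le]
    unfold smoothNorm
    gcongr
    refine (norm_sum_le_of_le _ (fun i _ => hb i ω)).trans (by simp)
  have hM := mul_meas_ge_le_integral_of_nonneg
    (Filter.Eventually.of_forall fun ω => (Real.exp_pos _).le) hint (Real.exp (c * (n * ε)))
  have hI := integral_exp_smoothNorm_sum_le hX hb h0 hind (c := c) (by positivity)
    (by rw [hc]; linarith) n
  have hsub : {ω | n * ε ≤ ‖∑ i ∈ Finset.range n, X i ω‖} ⊆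
      {ω | Real.exp (c * (n * ε)) ≤ Real.exp (smoothNorm c (∑ i ∈ Finset.range n, X i ω))} := by
    intro ω hω
    simp only [Set.mem_ofPred_eq, Real.exp_le_exp] at hω ⊢
    exact (mul_le_mul_of_nonneg_left hω (by positivity)).trans (le_smoothNorm _)
  refine (measure_mono hsub).trans ?_
  rw [← ofReal_measureReal]
  apply ENNReal.ofReal_le_ofReal
  have h3 : Real.exp (c * (n * ε)) * μ.real {ω | Real.exp (c * (n * ε)) ≤
      Real.exp (smoothNorm c (∑ i ∈ Finset.range n, X i ω))} ≤ Real.exp (1 + n * (6 * c ^ 2)) :=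
    hM.trans hI
  rw [← le_div_iff₀' (Real.exp_pos _), ← Real.exp_sub] at h3
  refine h3.trans (Real.exp_le_exp.2 (le_of_eq ?_))
  rw [hc]; ring

/-- Empirical means of a bounded function of independent samples concentrate. -/
theorem measure_empirical_mean_dev_le {S : Type*} [MeasurableSpace S] (ν : Measure S)
    [IsProbabilityMeasure ν] {f : S → E} (hf : Measurable f) (hb : ∀ x, ‖f x‖ ≤ 1)
    {ε : ℝ} (hε : 0 < ε) (hε' : ε ≤ 1) {n : ℕ} (hn : 0 < n) :
    Measure.infinitePi (fun _ : ℕ => ν)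
        {ω | ε ≤ ‖(1 / (n : ℝ)) • ∑ i ∈ Finset.range n, f (ω i) - ∫ x, f x ∂ν‖}
      ≤ ENNReal.ofReal (Real.exp (1 - n * ε ^ 2 / 24)) := by
  set m := ∫ x, f x ∂ν with hm
  have hmn : ‖m‖ ≤ 1 := by
    have := norm_integral_le_of_norm_le_const (μ := ν) (Filter.Eventually.of_forall hb)
    simpa using this
  have hfi : Integrable f ν :=
    Integrable.of_bound hf.aestronglyMeasurable 1 (Filter.Eventually.of_forall hb)
  have hind : iIndepFun (fun i (ω : ℕ → S) => f (ω i) - m)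
      (Measure.infinitePi (fun _ : ℕ => ν)) :=
    iIndepFun_infinitePi (P := fun _ : ℕ => ν) (X := fun _ x => f x - m)
      (fun _ => hf.sub_const m)
  have h := measure_norm_sum_ge_le (μ := Measure.infinitePi (fun _ : ℕ => ν))
    (X := fun i ω => f (ω i) - m)
    (fun i => (hf.comp (measurable_pi_apply i)).sub_const m)
    (fun i ω => (norm_sub_le _ _).trans (by linarith [hb (ω i)]))
    (fun i => by
      have h1 := (measurePreserving_eval_infinitePi (fun _ : ℕ => ν) i).map_eq
      have h2 : ∫ x, (f x - m) ∂ν = 0 := by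
        rw [integral_sub hfi (integrable_const _)]; simp [hm]
      rw [← h1, integral_map (measurable_pi_apply i).aemeasurable
        (hf.sub_const m).aestronglyMeasurable] at h2
      exact h2) hind hε hε' n
  refine le_trans (measure_mono fun ω hω => ?_) h
  simp only [Set.mem_ofPred_eq] at hω ⊢
  have hn' : (0 : ℝ) < n := by exact_mod_cast hn
  have e : ∑ i ∈ Finset.range n, (f (ω i) - m)
      = (n : ℝ) • ((1 / (n : ℝ)) • ∑ i ∈ Finset.range n, f (ω i) - m) := by
    rw [Finset.sum_sub_distrib, smul_sub, smul_smul]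
    simp [hn'.ne', Nat.cast_smul_eq_nsmul]
  rw [e, norm_smul, Real.norm_of_nonneg hn'.le]
  gcongr

end Hoeffding

/-! ### Approximate gradient descent for the empirical soft-clipping equation -/

section Descent

variable {E : Type*} [NormedAddCommGroup E] [InnerProductSpace ℝ E]

/-- The mean of the soft-clipped vectors `x i + w`, `i < n`. -/
noncomputable def clipMean (n : ℕ) (x : ℕ → E) (w : E) : E :=
  (1 / (n : ℝ)) • ∑ i ∈ Finset.range n, softClip (x i + w)

/-- The modulus of monotonicity of `clipMean n x` near `0`. -/
noncomputable def clipWeight (n : ℕ) (x : ℕ → E) : ℝ :=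
  (1 / (n : ℝ)) • ∑ i ∈ Finset.range n, 1 / (1 + ‖x i‖) ^ 2

theorem norm_mean_le {F : Type*} [NormedAddCommGroup F] [NormedSpace ℝ F] {n : ℕ} {y : ℕ → F} {B : ℝ} (hB : 0 ≤ B) (h : ∀ i < n, ‖y i‖ ≤ B) :
    ‖(1 / (n : ℝ)) • ∑ i ∈ Finset.range n, y i‖ ≤ B := by
  rcases Nat.eq_zero_or_pos n with rfl | hn
  · simpa using hB
  have hn' : (0 : ℝ) < n := by exact_mod_cast hn
  rw [norm_smul, Real.norm_of_nonneg (by positivity), one_div, inv_mul_le_iff₀ hn']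
  refine (norm_sum_le_of_le _ fun i hi => h i (Finset.mem_range.1 hi)).trans ?_
  simp

theorem clipWeight_nonneg {E : Type*} [NormedAddCommGroup E] (n : ℕ) (x : ℕ → E) : 0 ≤ clipWeight n x := by
  unfold clipWeight
  exact smul_nonneg (by positivity) (Finset.sum_nonneg fun i _ => by positivity)

theorem clipWeight_le_one {E : Type*} [NormedAddCommGroup E] (n : ℕ) (x : ℕ → E) : clipWeight n x ≤ 1 := by
  have := norm_mean_le (n := n) (y := fun i => 1 / (1 + ‖x i‖) ^ 2) zero_le_one (fun i _ => by
    have : 0 ≤ ‖x i‖ := norm_nonneg _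
    rw [Real.norm_of_nonneg (by positivity), div_le_one (by positivity)]
    nlinarith)
  exact (Real.le_norm_self _).trans this

theorem clipMean_sub (n : ℕ) (x : ℕ → E) (w w' : E) : clipMean n x w - clipMean n x w' =
    (1 / (n : ℝ)) • ∑ i ∈ Finset.range n, (softClip (x i + w) - softClip (x i + w')) := by
  rw [clipMean, clipMean, ← smul_sub, Finset.sum_sub_distrib]

theorem norm_clipMean_le (n : ℕ) (x : ℕ → E) (w : E) : ‖clipMean n x w‖ ≤ 1 :=
  norm_mean_le zero_le_one fun _ _ => norm_softClip_le _

/-- Cocoercivity passes to averages because the squared norm of a mean is at most the mean of the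
squared norms. -/
theorem clipMean_cocoercive (n : ℕ) (x : ℕ → E) (w w' : E) :
    ‖clipMean n x w - clipMean n x w'‖ ^ 2
      ≤ inner ℝ (clipMean n x w - clipMean n x w') (w - w') := by
  rcases Nat.eq_zero_or_pos n with rfl | hn
  · simp [clipMean]
  have hn' : (0 : ℝ) < n := by exact_mod_cast hn
  rw [clipMean_sub, real_inner_smul_left, sum_inner, norm_smul, mul_pow,
    Real.norm_of_nonneg (by positivity)]
  set D := fun i => softClip (x i + w) - softClip (x i + w')
  have h1 : ‖∑ i ∈ Finset.range n, D i‖ ^ 2 ≤ n * ∑ i ∈ Finset.range n, ‖D i‖ ^ 2 := by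
    calc _ ≤ (∑ i ∈ Finset.range n, ‖D i‖) ^ 2 := by gcongr; exact norm_sum_le _ _
      _ ≤ _ := by simpa using sq_sum_le_card_mul_sum_sq (s := Finset.range n) (f := fun i => ‖D i‖)
  have h2 : ∀ i, ‖D i‖ ^ 2 ≤ inner ℝ (D i) (w - w') := fun i => by
    simpa using softClip_cocoercive (x i + w) (x i + w')
  calc (1 / (n : ℝ)) ^ 2 * ‖∑ i ∈ Finset.range n, D i‖ ^ 2
      ≤ (1 / (n : ℝ)) ^ 2 * (n * ∑ i ∈ Finset.range n, ‖D i‖ ^ 2) := by gcongr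
    _ = 1 / (n : ℝ) * ∑ i ∈ Finset.range n, ‖D i‖ ^ 2 := by field_simp
    _ ≤ _ := by gcongr with i; exact h2 i

/-- The bound `1 + ‖x i + w‖ ≤ (1 + ‖x i‖) * (1 + ‖w‖)` separates the samples from the arguments, so
that one weight serves all `w` and `w'`. -/
theorem clipMean_strong_mono (n : ℕ) (x : ℕ → E) (w w' : E) :
    clipWeight n x / ((1 + ‖w‖) * (1 + ‖w'‖)) * ‖w - w'‖ ^ 2
      ≤ inner ℝ (clipMean n x w - clipMean n x w') (w - w') := by
  rw [clipMean_sub, real_inner_smul_left, sum_inner, clipWeight, smul_eq_mul, mul_div_assoc,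
    mul_assoc, Finset.sum_div, Finset.sum_mul]
  gcongr with i
  have := softClip_strong_mono (x i + w) (x i + w')
  rw [add_sub_add_left_eq_sub] at this
  refine le_trans ?_ this
  have h0 := norm_nonneg (x i)
  have h1 := norm_nonneg w
  have h2 := norm_nonneg w'
  have k : ∀ v : E, 1 + ‖x i + v‖ ≤ (1 + ‖x i‖) * (1 + ‖v‖) := fun v => by
    nlinarith [norm_add_le (x i) v, mul_nonneg h0 (norm_nonneg v)]
  calc 1 / (1 + ‖x i‖) ^ 2 / ((1 + ‖w‖) * (1 + ‖w'‖)) * ‖w - w'‖ ^ 2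
      = ‖w - w'‖ ^ 2 / (((1 + ‖x i‖) * (1 + ‖w‖)) * ((1 + ‖x i‖) * (1 + ‖w'‖))) := by
        field_simp
    _ ≤ _ := by gcongr <;> exact k _

/-- An approximate solution of the clipping equation is close to `0`, if `0` is one too. -/
theorem norm_le_of_clipMean_near {n : ℕ} {x : ℕ → E} {t w : E} {c : ℝ}
    (hA : 0 < clipWeight n x) (hc : c ≤ 1 / 2)
    (h : ‖clipMean n x w - t‖ + ‖clipMean n x 0 - t‖ ≤ c * clipWeight n x) : ‖w‖ ≤ 2 * c := by
  have hw := norm_nonneg w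
  have h1 := clipMean_strong_mono n x w 0
  have h2 : inner ℝ (clipMean n x w - clipMean n x 0) (w - 0) ≤ c * clipWeight n x * ‖w‖ := by
    refine (real_inner_le_norm _ _).trans ?_
    rw [sub_zero]
    gcongr
    refine le_trans ?_ h
    rw [← norm_neg (clipMean n x 0 - t)]
    refine le_trans (le_of_eq ?_) (norm_add_le _ _)
    congr 1; abel
  have h3 := h1.trans h2
  simp only [norm_zero, add_zero, mul_one, sub_zero] at h3
  have hc0 : 0 ≤ c := by
    by_contra hneg
    push Not at hneg
    have : c * clipWeight n x < 0 := mul_neg_of_neg_of_pos hneg hA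
    linarith [norm_nonneg (clipMean n x w - t), norm_nonneg (clipMean n x 0 - t)]
  rw [div_mul_eq_mul_div, div_le_iff₀ (by positivity)] at h3
  rcases hw.eq_or_lt with h0 | h0
  · rw [← h0]; positivity
  -- Monotonicity gives only `W * ‖w‖ ^ 2 / (1 + ‖w‖) ≤ c * W * ‖w‖`; the condition `c ≤ 1 / 2`
  -- absorbs the factor `1 + ‖w‖`.
  have h4 : ‖w‖ ≤ c * (1 + ‖w‖) := by
    have h5 : (clipWeight n x * ‖w‖) * ‖w‖ ≤ (clipWeight n x * ‖w‖) * (c * (1 + ‖w‖)) := by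
      nlinarith
    exact le_of_mul_le_mul_left h5 (by positivity)
  nlinarith

/-- One exact descent step contracts the unit ball. -/
theorem norm_descent_sub_le {n : ℕ} {x : ℕ → E} (t : E) {w w' : E} (hw : ‖w‖ ≤ 1)
    (hw' : ‖w'‖ ≤ 1) :
    ‖(w - (clipMean n x w - t)) - (w' - (clipMean n x w' - t))‖
      ≤ (1 - clipWeight n x / 8) * ‖w - w'‖ := by
  have hA0 := clipWeight_nonneg n x
  have hA1 := clipWeight_le_one n x
  have h1 := clipMean_strong_mono n x w w'
  have h2 := clipMean_cocoercive n x w w'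
  set g := clipMean n x w - clipMean n x w' with hg
  have e : (w - (clipMean n x w - t)) - (w' - (clipMean n x w' - t)) = (w - w') - g := by
    rw [hg]; abel
  rw [e]
  -- Half of `2 * inner` pays for `‖g‖ ^ 2` by cocoercivity. The other half contracts the squared
  -- distance by `1 - A / 4`, which is at most `(1 - A / 8) ^ 2`.
  have h3 : clipWeight n x / 4 * ‖w - w'‖ ^ 2 ≤ inner ℝ g (w - w') := by
    refine le_trans ?_ h1
    gcongr
    nlinarith [norm_nonneg w, norm_nonneg w']
  apply le_of_sq_le_sq _ (mul_nonneg (by linarith) (norm_nonneg _))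
  rw [norm_sub_sq_real, real_inner_comm, mul_pow]
  have : 0 ≤ (clipWeight n x / 8) ^ 2 * ‖w - w'‖ ^ 2 := by positivity
  nlinarith

/-- Descent with an inexact map `g` reaches a point at which `g` is small. -/
theorem exists_norm_descent_le {n : ℕ} {x : ℕ → E} {t : E} {g : E → E} {e τ : ℝ} {N : ℕ}
    (hA : 0 < clipWeight n x) (hg : ∀ w, ‖g w - (clipMean n x w - t)‖ ≤ e) (ht : ‖t‖ ≤ 1)
    (h0 : ‖clipMean n x 0 - t‖ + e ≤ clipWeight n x / 8)
    (he : 32 * e ≤ clipWeight n x * τ) (hN : 48 ≤ clipWeight n x * τ * N)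
    {w : ℕ → E} (hw0 : ‖w 0‖ ≤ 1) (hw : ∀ k, w (k + 1) = w k - g (w k)) :
    ‖g (w N)‖ ≤ τ := by
  set A := clipWeight n x with hAdef
  have hA1 : A ≤ 1 := clipWeight_le_one n x
  have hen : 0 ≤ e := (norm_nonneg _).trans (hg 0)
  -- Comparison with the step from `0` leaves a slack `A / 8`, which `h0` reserves for the residual
  -- at `0` and the inexactness.
  have hball : ∀ k, ‖w k‖ ≤ 1 := by
    intro k
    induction k with
    | zero => exact hw0
    | succ k ih =>
      have h1 := norm_descent_sub_le (n := n) (x := x) t ih (w' := 0) (by simp)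
      rw [hw k]
      have e1 : w k - g (w k) = ((w k - (clipMean n x (w k) - t)) - (0 - (clipMean n x 0 - t)))
          - (g (w k) - (clipMean n x (w k) - t)) - (clipMean n x 0 - t) := by abel
      rw [e1]
      refine (norm_sub_le _ _).trans ?_
      refine (add_le_add_left (norm_sub_le _ _) _).trans ?_
      rw [sub_zero, ← hAdef] at h1
      have h2 := hg (w k)
      have h3 : (1 - A / 8) * ‖w k‖ ≤ (1 - A / 8) * 1 := by gcongr; linarith
      linarith
  -- Up to errors, `g (w (k + 1))` is the difference of the exact steps taken from `w k` and `w (k +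
  -- 1)`, two points at distance `‖g (w k)‖`. So the residual itself contracts, and no root need
  -- exist.
  have hstep : ∀ k, ‖g (w (k + 1))‖ ≤ (1 - A / 8) * ‖g (w k)‖ + 2 * e := by
    intro k
    have h1 := norm_descent_sub_le (n := n) (x := x) t (hball k) (hball (k + 1))
    have e2 : w k - w (k + 1) = g (w k) := by rw [hw k]; abel
    rw [e2] at h1
    have e1 : g (w (k + 1)) = ((w k - (clipMean n x (w k) - t))
          - (w (k + 1) - (clipMean n x (w (k + 1)) - t)))
          - (g (w k) - (clipMean n x (w k) - t))
          + (g (w (k + 1)) - (clipMean n x (w (k + 1)) - t)) := by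
      rw [hw k]; abel
    rw [e1]
    refine (norm_add_le _ _).trans ?_
    refine (add_le_add_left (norm_sub_le _ _) _).trans ?_
    linarith [hg (w k), hg (w (k + 1))]
  have hg0 : ‖g (w 0)‖ ≤ 3 := by
    have e1 : g (w 0) = (g (w 0) - (clipMean n x (w 0) - t)) + (clipMean n x (w 0) - t) := by abel
    rw [e1]
    refine (norm_add_le _ _).trans ?_
    have h1 := hg (w 0)
    have h2 := norm_sub_le (clipMean n x (w 0)) t
    have h3 := norm_clipMean_le n x (w 0)
    have h4 := norm_nonneg (clipMean n x 0 - t)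
    linarith
  -- `16 * e / A` is the fixed point of the recursion in `hstep`.
  have hind : ∀ k : ℕ, ‖g (w k)‖ ≤ (1 - A / 8) ^ k * 3 + 16 * e / A := by
    intro k
    induction k with
    | zero =>
      have : 0 ≤ 16 * e / A := by positivity
      simp only [pow_zero]; linarith
    | succ k ih =>
      have h1 : (1 - A / 8) * ‖g (w k)‖ ≤ (1 - A / 8) * ((1 - A / 8) ^ k * 3 + 16 * e / A) := by
        gcongr; linarith
      have h2 : (1 - A / 8) * (16 * e / A) = 16 * e / A - 2 * e := by field_simp; ring
      rw [pow_succ]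
      linarith [hstep k]
  -- Bernoulli's inequality for `(1 + A / 8) ^ N` replaces a logarithm, at the price of a larger
  -- `N`.
  have hpow : (1 - A / 8) ^ N * (N * (A / 8)) ≤ 1 := by
    have hb : 1 + (N : ℝ) * (A / 8) ≤ (1 + A / 8) ^ N :=
      one_add_mul_le_pow (by linarith) N
    have hm : (1 - A / 8) ^ N * (1 + A / 8) ^ N ≤ 1 := by
      rw [← mul_pow]
      apply pow_le_one₀
      · apply mul_nonneg <;> linarith
      · nlinarith
    have hp : 0 ≤ (1 - A / 8) ^ N := pow_nonneg (by linarith) _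
    nlinarith
  have hτ : 0 ≤ τ := by
    by_contra hneg
    push Not at hneg
    have : A * τ < 0 := mul_neg_of_pos_of_neg hA hneg
    have : A * τ * N ≤ 0 := mul_nonpos_of_nonpos_of_nonneg this.le (by positivity)
    linarith
  have hfin : (1 - A / 8) ^ N * 3 ≤ τ / 2 := by
    have hp : 0 ≤ (1 - A / 8) ^ N := pow_nonneg (by linarith) _
    have : (1 - A / 8) ^ N * 48 ≤ (1 - A / 8) ^ N * (A * τ * N) := by gcongr
    nlinarith
  have h2 : 16 * e / A ≤ τ / 2 := by
    rw [div_le_iff₀ hA]; linarith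
  linarith [hind N]

end Descent

/-! ### Bias of the soft-clipped samples, and the event on which descent succeeds -/

section Bias

variable {d : ℕ} {Dξ D D₁ D₂ : Measure (EuclideanSpace ℝ (Fin d))} [IsProbabilityMeasure Dξ]
  [IsProbabilityMeasure D] [IsProbabilityMeasure D₁] [IsProbabilityMeasure D₂]
  {F : Type*} [NormedAddCommGroup F] [NormedSpace ℝ F] [MeasurableSpace F] [BorelSpace F]
  [SecondCountableTopology F]

instance : IsProbabilityMeasure (noisyLaw Dξ D) := by
  unfold noisyLaw; infer_instance

/-- The total weight of the noise-free part at scale `1 / r`. -/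
noncomputable def priorWeight (Dξ : Measure (EuclideanSpace ℝ (Fin d))) (r : ℝ) : ℝ :=
  ∫ ξ, 1 / (1 + ‖r • ξ‖) ^ 2 ∂Dξ

theorem measurable_inv_sq_norm :
    Measurable fun x : EuclideanSpace ℝ (Fin d) => 1 / (1 + ‖x‖) ^ 2 := by
  fun_prop

theorem inv_sq_norm_mem (x : EuclideanSpace ℝ (Fin d)) :
    0 ≤ 1 / (1 + ‖x‖) ^ 2 ∧ 1 / (1 + ‖x‖) ^ 2 ≤ 1 := by
  have : 0 ≤ ‖x‖ := norm_nonneg _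
  refine ⟨by positivity, ?_⟩
  rw [div_le_one (by positivity)]
  nlinarith

theorem integrable_of_bounded {F : Type*} [NormedAddCommGroup F] [MeasurableSpace F]
    [BorelSpace F] [SecondCountableTopology F] {f : EuclideanSpace ℝ (Fin d) → F} (hf : Measurable f)
    (hb : ∀ x, ‖f x‖ ≤ 1) (μ : Measure (EuclideanSpace ℝ (Fin d))) [IsProbabilityMeasure μ] :
    Integrable f μ :=
  Integrable.of_bound hf.aestronglyMeasurable 1 (Filter.Eventually.of_forall hb)

theorem integral_noisyLaw {f : EuclideanSpace ℝ (Fin d) → F} (hf : Measurable f)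
    (hb : ∀ x, ‖f x‖ ≤ 1) :
    ∫ y, f y ∂(noisyLaw Dξ D) = ∫ ξ, ∫ z, f (ξ + z) ∂D ∂Dξ :=
  integral_conv (integrable_of_bounded hf hb (noisyLaw Dξ D))

theorem integrable_integral_add {f : EuclideanSpace ℝ (Fin d) → F} (hf : Measurable f)
    (hb : ∀ x, ‖f x‖ ≤ 1) : Integrable (fun ξ => ∫ z, f (ξ + z) ∂D) Dξ := by
  have : Integrable (fun q : EuclideanSpace ℝ (Fin d) × EuclideanSpace ℝ (Fin d) =>
      f (q.1 + q.2)) (Dξ.prod D) :=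
    Integrable.of_bound (hf.comp measurable_add).aestronglyMeasurable 1
      (Filter.Eventually.of_forall fun q => hb _)
  exact this.integral_prod_left

theorem IsCenteredNoise.integrable {σ : ℝ} (h : IsCenteredNoise D σ) :
    Integrable (fun z => z) D := h.1.integrable (by norm_num)

theorem IsCenteredNoise.integrable_norm_sq {D : Measure (EuclideanSpace ℝ (Fin d))} {σ : ℝ}
    (h : IsCenteredNoise D σ) :
    Integrable (fun z => ‖z‖ ^ 2) D := h.1.integrable_norm_pow (by norm_num)

theorem integrable_priorWeight (r : ℝ) : Integrable (fun ξ => 1 / (1 + ‖r • ξ‖) ^ 2) Dξ := by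
  refine integrable_of_bounded (f := fun ξ => 1 / (1 + ‖r • ξ‖) ^ 2)
    (measurable_inv_sq_norm.comp (measurable_const_smul r)) (fun x => ?_) Dξ
  rw [Real.norm_of_nonneg (inv_sq_norm_mem _).1]
  exact (inv_sq_norm_mem _).2

theorem measurable_softClip_smul (r : ℝ) :
    Measurable fun x : EuclideanSpace ℝ (Fin d) => softClip (r • x) :=
  (continuous_softClip.comp (continuous_const_smul r)).measurable

/-- The derivative term integrates to zero because the noise is centred; the second moment bounds
the Taylor remainder. -/
theorem norm_integral_softClip_add_sub_le {σ r : ℝ} (h : IsCenteredNoise D σ)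
    (ξ : EuclideanSpace ℝ (Fin d)) :
    ‖∫ z, softClip (r • (ξ + z)) ∂D - softClip (r • ξ)‖
      ≤ 12 * (r * σ) ^ 2 * (1 / (1 + ‖r • ξ‖) ^ 2) := by
  have hi : Integrable (fun z => softClip (r • (ξ + z))) D :=
    integrable_of_bounded ((measurable_softClip_smul r).comp (measurable_const_add ξ))
      (fun _ => norm_softClip_le _) D
  have hrz : Integrable (fun z : EuclideanSpace ℝ (Fin d) => r • z) D := h.integrable.smul r
  have hi' : Integrable (fun z => softClip (r • (ξ + z)) - softClip (r • ξ)) D :=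
    hi.sub (integrable_const _)
  have hL : Integrable (fun z => softClipDeriv (r • ξ) (r • z)) D :=
    (softClipDeriv (r • ξ)).integrable_comp hrz
  have hL0 : ∫ z, softClipDeriv (r • ξ) (r • z) ∂D = 0 := by
    rw [(softClipDeriv (r • ξ)).integral_comp_comm hrz, integral_smul, h.2.1]
    simp
  have e : ∫ z, softClip (r • (ξ + z)) ∂D - softClip (r • ξ)
      = ∫ z, (softClip (r • ξ + r • z) - softClip (r • ξ) - softClipDeriv (r • ξ) (r • z)) ∂D := by
    simp only [← smul_add]
    rw [integral_sub hi' hL, integral_sub hi (integrable_const _), hL0]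
    simp
  rw [e]
  have hr : ∀ z : EuclideanSpace ℝ (Fin d), 12 * ‖r • z‖ ^ 2 / (1 + ‖r • ξ‖) ^ 2
      = (12 * r ^ 2 * (1 / (1 + ‖r • ξ‖) ^ 2)) * ‖z‖ ^ 2 := fun z => by
    rw [norm_smul, mul_pow, Real.norm_eq_abs, sq_abs]; ring
  calc _ ≤ ∫ z, (12 * r ^ 2 * (1 / (1 + ‖r • ξ‖) ^ 2)) * ‖z‖ ^ 2 ∂D := by
        refine norm_integral_le_of_norm_le (h.integrable_norm_sq.const_mul _)
          (Filter.Eventually.of_forall fun z => ?_)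
        rw [← hr]
        exact norm_softClip_add_sub_le _ _
    _ = (12 * r ^ 2 * (1 / (1 + ‖r • ξ‖) ^ 2)) * ∫ z, ‖z‖ ^ 2 ∂D := integral_const_mul _ _
    _ ≤ (12 * r ^ 2 * (1 / (1 + ‖r • ξ‖) ^ 2)) * σ ^ 2 := by
        gcongr
        exact h.2.2
    _ = _ := by ring

/-- The comparison value depends on `Dξ` only, so it serves as a common reference point for the two
sources. -/
theorem norm_integral_softClip_noisyLaw_sub_le {σ r : ℝ} (h : IsCenteredNoise D σ) :
    ‖∫ y, softClip (r • y) ∂(noisyLaw Dξ D) - ∫ ξ, softClip (r • ξ) ∂Dξ‖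
      ≤ 12 * (r * σ) ^ 2 * priorWeight Dξ r := by
  have hm := measurable_softClip_smul (d := d) r
  have hb : ∀ x : EuclideanSpace ℝ (Fin d), ‖softClip (r • x)‖ ≤ 1 := fun _ => norm_softClip_le _
  rw [integral_noisyLaw (f := fun y => softClip (r • y)) hm hb, ← integral_sub
    (integrable_integral_add (f := fun y => softClip (r • y)) hm hb)
    (integrable_of_bounded hm hb Dξ), priorWeight, ← integral_const_mul]
  exact norm_integral_le_of_norm_le ((integrable_priorWeight r).const_mul _)
    (Filter.Eventually.of_forall fun ξ => norm_integral_softClip_add_sub_le h ξ)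

/-- Noise cannot destroy much of the modulus: `1 / (1 + s) ^ 2 ≥ 3 / 4 - 4 * s ^ 2`, and the mean of
`‖r • z‖ ^ 2` is at most `1 / 64`. -/
theorem le_integral_inv_sq_noisyLaw {σ r : ℝ} (h : IsCenteredNoise D σ) (hr : (r * σ) ^ 2 ≤ 1 / 64) :
    5 / 8 * priorWeight Dξ r ≤ ∫ y, 1 / (1 + ‖r • y‖) ^ 2 ∂(noisyLaw Dξ D) := by
  have hm : Measurable fun y : EuclideanSpace ℝ (Fin d) => 1 / (1 + ‖r • y‖) ^ 2 :=
    measurable_inv_sq_norm.comp (measurable_const_smul r)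
  have hb : ∀ y : EuclideanSpace ℝ (Fin d), ‖1 / (1 + ‖r • y‖) ^ 2‖ ≤ 1 := fun y => by
    rw [Real.norm_of_nonneg (inv_sq_norm_mem _).1]
    exact (inv_sq_norm_mem _).2
  rw [integral_noisyLaw hm hb, priorWeight, ← integral_const_mul]
  refine integral_mono ((integrable_priorWeight r).const_mul _) (integrable_integral_add hm hb) ?_
  intro ξ
  set q := 1 / (1 + ‖r • ξ‖) ^ 2 with hq
  have hq0 : 0 ≤ q := (inv_sq_norm_mem _).1
  have hi : Integrable (fun z => q * (3 / 4 - 4 * r ^ 2 * ‖z‖ ^ 2)) D :=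
    ((integrable_const _).sub (h.integrable_norm_sq.const_mul _)).const_mul _
  have hpt : ∀ z, q * (3 / 4 - 4 * r ^ 2 * ‖z‖ ^ 2) ≤ 1 / (1 + ‖r • (ξ + z)‖) ^ 2 := by
    intro z
    have e : 4 * r ^ 2 * ‖z‖ ^ 2 = 4 * ‖r • z‖ ^ 2 := by
      rw [norm_smul, mul_pow, Real.norm_eq_abs, sq_abs]; ring
    rw [e, smul_add]
    set a := ‖r • ξ‖
    set s := ‖r • z‖
    have ha : 0 ≤ a := norm_nonneg _
    have hs : 0 ≤ s := norm_nonneg _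
    have h1 : 1 + ‖r • ξ + r • z‖ ≤ (1 + a) * (1 + s) := by
      nlinarith [norm_add_le (r • ξ) (r • z), mul_nonneg ha hs]
    have h2 : 3 / 4 - 4 * s ^ 2 ≤ 1 / (1 + s) ^ 2 := by
      rw [le_div_iff₀ (by positivity)]
      nlinarith [sq_nonneg (s - 1 / 4), sq_nonneg s, pow_nonneg hs 3, pow_nonneg hs 4]
    calc q * (3 / 4 - 4 * s ^ 2) ≤ q * (1 / (1 + s) ^ 2) := by gcongr
      _ = 1 / ((1 + a) * (1 + s)) ^ 2 := by rw [hq, mul_pow]; field_simp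
      _ ≤ _ := by gcongr
  have hval : ∫ z, q * (3 / 4 - 4 * r ^ 2 * ‖z‖ ^ 2) ∂D
      = q * (3 / 4 - 4 * r ^ 2 * ∫ z, ‖z‖ ^ 2 ∂D) := by
    rw [integral_const_mul, integral_sub (integrable_const _) (h.integrable_norm_sq.const_mul _),
      integral_const_mul]
    simp
  calc 5 / 8 * q ≤ q * (3 / 4 - 4 * r ^ 2 * ∫ z, ‖z‖ ^ 2 ∂D) := by
        have : 4 * r ^ 2 * ∫ z, ‖z‖ ^ 2 ∂D ≤ 4 * r ^ 2 * σ ^ 2 := by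
          gcongr
          exact h.2.2
        nlinarith
    _ = _ := hval.symm
    _ ≤ _ := integral_mono hi (integrable_of_bounded
        (f := fun z => 1 / (1 + ‖r • (ξ + z)‖) ^ 2) (hm.comp (measurable_const_add ξ))
        (fun z => hb _) D) hpt

theorem measurable_indicator_ball (r : ℝ) : Measurable fun y : EuclideanSpace ℝ (Fin d) =>
    if ‖r • y‖ ≤ 1 then (1 : ℝ) else 0 :=
  Measurable.ite (measurableSet_le (by fun_prop) (by fun_prop)) (by fun_prop) (by fun_prop)

theorem norm_indicator_ball_le (r : ℝ) (y : EuclideanSpace ℝ (Fin d)) :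
    ‖if ‖r • y‖ ≤ 1 then (1 : ℝ) else 0‖ ≤ 1 := by
  split_ifs <;> simp

/-- Only the event `ξ = 0` is kept; there Chebyshev, in the form `1 - ‖r • z‖ ^ 2 ≤` indicator,
gives conditional probability at least `1 / 2`. This provides a starting point for the descent. -/
theorem le_integral_indicator_noisyLaw {α σ r : ℝ} (h : IsCenteredNoise D σ)
    (hr : (r * σ) ^ 2 ≤ 1 / 64) (hα : ENNReal.ofReal α ≤ Dξ {0}) :
    α / 2 ≤ ∫ y, (if ‖r • y‖ ≤ 1 then (1 : ℝ) else 0) ∂(noisyLaw Dξ D) := by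
  have hm := measurable_indicator_ball (d := d) r
  have hb := norm_indicator_ball_le (d := d) r
  rw [integral_noisyLaw hm hb]
  have hα' : α ≤ Dξ.real {0} := by
    rw [measureReal_def]
    exact (ENNReal.ofReal_le_iff_le_toReal (measure_ne_top _ _)).1 hα
  have h0 : 1 / 2 ≤ ∫ z, (if ‖r • ((0 : EuclideanSpace ℝ (Fin d)) + z)‖ ≤ 1 then (1 : ℝ) else 0)
      ∂D := by
    calc (1 : ℝ) / 2 ≤ 1 - r ^ 2 * ∫ z, ‖z‖ ^ 2 ∂D := by
          have : r ^ 2 * ∫ z, ‖z‖ ^ 2 ∂D ≤ r ^ 2 * σ ^ 2 := by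
            gcongr
            exact h.2.2
          nlinarith
      _ = ∫ z, (1 - r ^ 2 * ‖z‖ ^ 2) ∂D := by
          rw [integral_sub (integrable_const _) (h.integrable_norm_sq.const_mul _),
            integral_const_mul]
          simp
      _ ≤ _ := by
          refine integral_mono ((integrable_const _).sub (h.integrable_norm_sq.const_mul _))
            (integrable_of_bounded (hm.comp (measurable_const_add 0)) (fun z => hb _) D) ?_
          intro z
          simp only [zero_add]
          have e : r ^ 2 * ‖z‖ ^ 2 = ‖r • z‖ ^ 2 := by
            rw [norm_smul, mul_pow, Real.norm_eq_abs, sq_abs]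
          rw [e]
          split_ifs with hz
          · nlinarith [sq_nonneg ‖r • z‖]
          · nlinarith
  calc α / 2 ≤ ∫ ξ, Set.indicator {0} (fun _ => (1 : ℝ) / 2) ξ ∂Dξ := by
        rw [integral_indicator_const _ (measurableSet_singleton 0), smul_eq_mul]
        linarith
    _ ≤ _ := by
        refine integral_mono ((integrable_const _).indicator (measurableSet_singleton 0))
          (integrable_integral_add hm hb) fun ξ => ?_
        by_cases hξ : ξ = 0
        · subst hξ
          simpa using h0
        · rw [Set.indicator_of_notMem (by simpa using hξ)]
          exact integral_nonneg fun z => by split_ifs <;> norm_num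

theorem le_priorWeight {α r : ℝ} (hα : ENNReal.ofReal α ≤ Dξ {0}) : α ≤ priorWeight Dξ r := by
  have hα' : α ≤ Dξ.real {0} := by
    rw [measureReal_def]
    exact (ENNReal.ofReal_le_iff_le_toReal (measure_ne_top _ _)).1 hα
  calc α ≤ ∫ ξ, Set.indicator {0} (fun _ => (1 : ℝ)) ξ ∂Dξ := by
        rw [integral_indicator_const _ (measurableSet_singleton 0), smul_eq_mul]
        linarith
    _ ≤ _ := by
        refine integral_mono ((integrable_const _).indicator (measurableSet_singleton 0))
          (integrable_priorWeight r) fun ξ => ?_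
        by_cases hξ : ξ = 0
        · subst hξ; simp
        · rw [Set.indicator_of_notMem (by simpa using hξ)]
          exact (inv_sq_norm_mem _).1


/-! ### The deterministic conditions on the samples. -/

/-- The samples are such that descent from some sample of the second source succeeds: the
clipping equation has sufficiently monotone left-hand side, holds at the true shift `v` up to a
small error, and some sample is close to `v`. -/
structure GoodSample (a b n : ℕ) (r : ℝ) (v : EuclideanSpace ℝ (Fin d))
    (y₁ y₂ : ℕ → EuclideanSpace ℝ (Fin d)) : Prop where
  weight : 1 ≤ 2 * a * clipWeight n fun i => r • (y₂ i - v)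
  residual : ‖clipMean n (fun i => r • (y₂ i - v)) 0 - clipMean n (fun i => r • y₁ i) 0‖
    ≤ 52 / b ^ 2 * clipWeight n fun i => r • (y₂ i - v)
  start : ∃ i < n, ‖r • (y₂ i - v)‖ ≤ 1

/-- `ε` bounds the deviation of the empirical mean of `f` from its mean. -/
def MeanDev (n : ℕ) (ε : ℝ) (f : EuclideanSpace ℝ (Fin d) → F) (m : F)
    (y : ℕ → EuclideanSpace ℝ (Fin d)) : Prop :=
  ‖(1 / (n : ℝ)) • ∑ i ∈ Finset.range n, f (y i) - m‖ < ε

/-- The accuracy `1 / (a * b ^ 2)` is at most `A / b ^ 2`, the order of the bias, because `1 / a ≤ α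
≤ A`. -/
theorem goodSample_of_meanDev {a b n : ℕ} {α σ r : ℝ} (ha : 0 < a) (hb : 64 ≤ b)
    (hαa : 1 ≤ α * a) (hα : ENNReal.ofReal α ≤ Dξ {0}) (hr : (r * σ) ^ 2 = 1 / b ^ 2)
    (h₁ : IsCenteredNoise D₁ σ) (h₂ : IsCenteredNoise D₂ σ) {v : EuclideanSpace ℝ (Fin d)}
    {y₁ y₂ : ℕ → EuclideanSpace ℝ (Fin d)}
    (e1 : MeanDev n (1 / (a * b ^ 2)) (fun y => softClip (r • y))
      (∫ y, softClip (r • y) ∂(noisyLaw Dξ D₁)) y₁)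
    (e2 : MeanDev n (1 / (a * b ^ 2)) (fun y => softClip (r • (y - v)))
      (∫ y, softClip (r • y) ∂(noisyLaw Dξ D₂)) y₂)
    (e3 : MeanDev n (1 / (a * b ^ 2)) (fun y => 1 / (1 + ‖r • (y - v)‖) ^ 2)
      (∫ y, 1 / (1 + ‖r • y‖) ^ 2 ∂(noisyLaw Dξ D₂)) y₂)
    (e4 : MeanDev n (1 / (a * b ^ 2)) (fun y => if ‖r • (y - v)‖ ≤ 1 then (1 : ℝ) else 0)
      (∫ y, (if ‖r • y‖ ≤ 1 then (1 : ℝ) else 0) ∂(noisyLaw Dξ D₂)) y₂) :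
    GoodSample a b n r v y₁ y₂ := by
  have hb' : (64 : ℝ) ≤ b := by exact_mod_cast hb
  have ha' : (0 : ℝ) < a := by exact_mod_cast ha
  have hb2 : (64 : ℝ) ^ 2 ≤ (b : ℝ) ^ 2 := by gcongr
  have hib : 1 / (b : ℝ) ^ 2 ≤ 1 / 64 ^ 2 := by gcongr
  have hr' : (r * σ) ^ 2 ≤ 1 / 64 := by rw [hr]; linarith
  set A := priorWeight Dξ r with hA
  have hAα : α ≤ A := le_priorWeight hα
  have hia : 1 / (a : ℝ) ≤ α := by rwa [div_le_iff₀ ha']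
  have hia0 : 0 < 1 / (a : ℝ) := by positivity
  have hε : 1 / ((a : ℝ) * b ^ 2) = 1 / a * (1 / b ^ 2) := by field_simp
  have hεA : 1 / ((a : ℝ) * b ^ 2) ≤ A * (1 / b ^ 2) := by
    rw [hε]; gcongr; linarith
  have hib0 : 0 < 1 / (b : ℝ) ^ 2 := by positivity
  have b1 := norm_integral_softClip_noisyLaw_sub_le (Dξ := Dξ) (r := r) h₁
  have b2 := norm_integral_softClip_noisyLaw_sub_le (Dξ := Dξ) (r := r) h₂
  have b3 := le_integral_inv_sq_noisyLaw (Dξ := Dξ) h₂ hr'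
  have b4 := le_integral_indicator_noisyLaw (Dξ := Dξ) h₂ hr' hα
  unfold MeanDev at e1 e2 e3 e4
  set m1 := ∫ y, softClip (r • y) ∂(noisyLaw Dξ D₁)
  set m2 := ∫ y, softClip (r • y) ∂(noisyLaw Dξ D₂)
  rw [hr, ← hA] at b1 b2
  set W := clipWeight n fun i => r • (y₂ i - v) with hW
  have hWA : A ≤ 2 * W := by
    have := (abs_lt.1 e3).1
    have e : W = (1 / (n : ℝ)) • ∑ i ∈ Finset.range n, 1 / (1 + ‖r • (y₂ i - v)‖) ^ 2 := rfl
    rw [← e] at this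
    nlinarith
  refine ⟨?_, ?_, ?_⟩
  · have : 1 ≤ A * a := by nlinarith
    nlinarith
  · have c1 : clipMean n (fun i => r • y₁ i) 0
        = (1 / (n : ℝ)) • ∑ i ∈ Finset.range n, softClip (r • y₁ i) := by simp [clipMean]
    have c2 : clipMean n (fun i => r • (y₂ i - v)) 0
        = (1 / (n : ℝ)) • ∑ i ∈ Finset.range n, softClip (r • (y₂ i - v)) := by simp [clipMean]
    rw [← c1] at e1
    rw [← c2] at e2
    set M1 := clipMean n (fun i => r • y₁ i) 0
    set M2 := clipMean n (fun i => r • (y₂ i - v)) 0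
    set p := ∫ ξ, softClip (r • ξ) ∂Dξ
    -- Each source contributes a sampling error of at most `A / b ^ 2` and a bias of at most `12 * A
    -- / b ^ 2` relative to `p`; the total `26 * A / b ^ 2` becomes `52 * W / b ^ 2` by `hWA`.
    have e : M2 - M1 = (M2 - m2) + (m2 - p) - (m1 - p) - (M1 - m1) := by abel
    rw [e]
    have k1 := norm_sub_le ((M2 - m2) + (m2 - p) - (m1 - p)) (M1 - m1)
    have k2 := norm_sub_le ((M2 - m2) + (m2 - p)) (m1 - p)
    have k3 := norm_add_le (M2 - m2) (m2 - p)
    have k4 : A * (1 / (b : ℝ) ^ 2) ≤ 2 * W * (1 / b ^ 2) := by gcongr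
    have k5 : 52 / (b : ℝ) ^ 2 * W = 52 * (W * (1 / b ^ 2)) := by ring
    rw [k5]
    nlinarith
  -- Without a sample near `v` the empirical frequency is `0`, although its mean is at least `α /
  -- 2`, above the allowed deviation.
  · by_contra hcon
    push Not at hcon
    have h0 : ∑ i ∈ Finset.range n, (if ‖r • (y₂ i - v)‖ ≤ 1 then (1 : ℝ) else 0) = 0 :=
      Finset.sum_eq_zero fun i hi => if_neg (not_le.2 (hcon i (Finset.mem_range.1 hi)))
    rw [h0, smul_zero, zero_sub, norm_neg] at e4
    have := (Real.le_norm_self _).trans_lt e4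
    have : 1 / ((a : ℝ) * b ^ 2) ≤ α / 4 := by
      rw [hε]
      nlinarith
    have : 0 < α := lt_of_lt_of_le hia0 hia
    linarith


end Bias

/-! ### Probability of the good event under the law of the tape. -/

section GoodEvent

variable {d : ℕ} {Dξ D₁ D₂ : Measure (EuclideanSpace ℝ (Fin d))} [IsProbabilityMeasure Dξ]
  [IsProbabilityMeasure D₁] [IsProbabilityMeasure D₂]
  {H : Type*} [NormedAddCommGroup H] [InnerProductSpace ℝ H] [CompleteSpace H]
  [MeasurableSpace H] [BorelSpace H] [SecondCountableTopology H]

instance isProbabilityMeasure_shift (D : Measure (EuclideanSpace ℝ (Fin d)))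
    [IsProbabilityMeasure D] (v : EuclideanSpace ℝ (Fin d)) :
    IsProbabilityMeasure (D.map fun y => y + v) :=
  Measure.isProbabilityMeasure_map (by fun_prop)

/-- An inequality suffices for the union bound and, unlike equality, holds for arbitrary `s`, so the
bad events need not be shown measurable. -/
theorem tapeLaw_fst_le (v : EuclideanSpace ℝ (Fin d))
    (s : Set (ℕ → EuclideanSpace ℝ (Fin d))) :
    tapeLaw Dξ D₁ D₂ v {ω | ω.2.1 ∈ s} ≤ Measure.infinitePi (fun _ : ℕ => noisyLaw Dξ D₁) s := by
  have hp : MeasurePreserving (fun ω : RealRAM.Tape d => ω.2.1) (tapeLaw Dξ D₁ D₂ v)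
      (Measure.infinitePi fun _ : ℕ => noisyLaw Dξ D₁) :=
    measurePreserving_fst.comp measurePreserving_snd
  rw [← hp.map_eq]
  exact Measure.le_map_apply hp.measurable.aemeasurable s

theorem tapeLaw_snd_le (v : EuclideanSpace ℝ (Fin d))
    (s : Set (ℕ → EuclideanSpace ℝ (Fin d))) :
    tapeLaw Dξ D₁ D₂ v {ω | ω.2.2 ∈ s}
      ≤ Measure.infinitePi (fun _ : ℕ => (noisyLaw Dξ D₂).map fun y => y + v) s := by
  have hp : MeasurePreserving (fun ω : RealRAM.Tape d => ω.2.2) (tapeLaw Dξ D₁ D₂ v)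
      (Measure.infinitePi fun _ : ℕ => (noisyLaw Dξ D₂).map fun y => y + v) :=
    measurePreserving_snd.comp measurePreserving_snd
  rw [← hp.map_eq]
  exact Measure.le_map_apply hp.measurable.aemeasurable s

theorem tapeLaw_not_meanDev_fst_le (v : EuclideanSpace ℝ (Fin d))
    {f : EuclideanSpace ℝ (Fin d) → H} (hf : Measurable f) (hb : ∀ x, ‖f x‖ ≤ 1)
    {ε : ℝ} (hε : 0 < ε) (hε' : ε ≤ 1) {n : ℕ} (hn : 0 < n) :
    tapeLaw Dξ D₁ D₂ v {ω | ¬ MeanDev n ε f (∫ y, f y ∂(noisyLaw Dξ D₁)) ω.2.1}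
      ≤ ENNReal.ofReal (Real.exp (1 - n * ε ^ 2 / 24)) := by
  refine le_trans ?_ (measure_empirical_mean_dev_le (noisyLaw Dξ D₁) hf hb hε hε' hn)
  refine le_trans (measure_mono fun ω hω => ?_) (tapeLaw_fst_le (D₂ := D₂) v _)
  exact not_lt.1 hω

theorem tapeLaw_not_meanDev_snd_le (v : EuclideanSpace ℝ (Fin d))
    {f : EuclideanSpace ℝ (Fin d) → H} (hf : Measurable f) (hb : ∀ x, ‖f x‖ ≤ 1)
    {ε : ℝ} (hε : 0 < ε) (hε' : ε ≤ 1) {n : ℕ} (hn : 0 < n) :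
    tapeLaw Dξ D₁ D₂ v {ω | ¬ MeanDev n ε (fun y => f (y - v))
        (∫ y, f y ∂(noisyLaw Dξ D₂)) ω.2.2}
      ≤ ENNReal.ofReal (Real.exp (1 - n * ε ^ 2 / 24)) := by
  have hf' : Measurable fun y => f (y - v) := hf.comp (measurable_sub_const v)
  have e : ∫ y, f (y - v) ∂((noisyLaw Dξ D₂).map fun y => y + v)
      = ∫ y, f y ∂(noisyLaw Dξ D₂) := by
    rw [integral_map (by fun_prop) hf'.aestronglyMeasurable]
    simp
  refine le_trans ?_ (measure_empirical_mean_dev_le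
    ((noisyLaw Dξ D₂).map fun y => y + v) hf' (fun x => hb _) hε hε' hn)
  refine le_trans (measure_mono fun ω hω => ?_) (tapeLaw_snd_le (D₁ := D₁) v _)
  rw [e]
  exact not_lt.1 hω

/-- A union bound over the four deviation events, each of probability at most `δ / 4`. -/
theorem tapeLaw_not_goodSample_le {a b n : ℕ} {α δ σ r : ℝ} (ha : 0 < a) (hb : 64 ≤ b) (hn : 0 < n)
    (hαa : 1 ≤ α * a) (hα : ENNReal.ofReal α ≤ Dξ {0}) (hr : (r * σ) ^ 2 = 1 / b ^ 2)
    (h₁ : IsCenteredNoise D₁ σ) (h₂ : IsCenteredNoise D₂ σ) (v : EuclideanSpace ℝ (Fin d))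
    (hδ : Real.exp (1 - n * (1 / ((a : ℝ) * b ^ 2)) ^ 2 / 24) ≤ δ / 4) :
    tapeLaw Dξ D₁ D₂ v {ω | ¬ GoodSample a b n r v ω.2.1 ω.2.2} ≤ ENNReal.ofReal δ := by
  have ha' : (1 : ℝ) ≤ a := by exact_mod_cast ha
  have hb' : (64 : ℝ) ≤ b := by exact_mod_cast hb
  set ε := 1 / ((a : ℝ) * b ^ 2) with hεd
  have hε : 0 < ε := by positivity
  have hε' : ε ≤ 1 := by
    rw [hεd, div_le_one (by positivity)]
    nlinarith [mul_le_mul ha' (one_le_pow₀ (by linarith : (1 : ℝ) ≤ b) (n := 2)) zero_le_one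
      (by linarith)]
  have hm : Measurable fun y : EuclideanSpace ℝ (Fin d) => 1 / (1 + ‖r • y‖) ^ 2 :=
    measurable_inv_sq_norm.comp (measurable_const_smul r)
  have hmb : ∀ y : EuclideanSpace ℝ (Fin d), ‖1 / (1 + ‖r • y‖) ^ 2‖ ≤ 1 := fun y => by
    rw [Real.norm_of_nonneg (inv_sq_norm_mem _).1]
    exact (inv_sq_norm_mem _).2
  have p1 := tapeLaw_not_meanDev_fst_le (Dξ := Dξ) (D₁ := D₁) (D₂ := D₂) v
    (measurable_softClip_smul r) (fun _ => norm_softClip_le _) hε hε' hn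
  have p2 := tapeLaw_not_meanDev_snd_le (Dξ := Dξ) (D₁ := D₁) (D₂ := D₂) v
    (measurable_softClip_smul r) (fun _ => norm_softClip_le _) hε hε' hn
  have p3 := tapeLaw_not_meanDev_snd_le (Dξ := Dξ) (D₁ := D₁) (D₂ := D₂) v hm hmb hε hε' hn
  have p4 := tapeLaw_not_meanDev_snd_le (Dξ := Dξ) (D₁ := D₁) (D₂ := D₂) v
    (measurable_indicator_ball r) (norm_indicator_ball_le r) hε hε' hn
  have hδ' := ENNReal.ofReal_le_ofReal hδ
  have hδ0 : 0 ≤ δ / 4 := (Real.exp_pos _).le.trans hδ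
  calc _ ≤ tapeLaw Dξ D₁ D₂ v (_ ∪ _ ∪ _ ∪ _) := measure_mono fun ω hω => by
        by_contra hcon
        simp only [Set.mem_union, not_or] at hcon
        obtain ⟨⟨⟨q1, q2⟩, q3⟩, q4⟩ := hcon
        exact hω (goodSample_of_meanDev ha hb hαa hα hr h₁ h₂ (not_not.1 q1) (not_not.1 q2)
          (not_not.1 q3) (not_not.1 q4))
    _ ≤ ENNReal.ofReal (δ / 4) + ENNReal.ofReal (δ / 4) + ENNReal.ofReal (δ / 4)
        + ENNReal.ofReal (δ / 4) :=
      (measure_union_le _ _).trans (add_le_add ((measure_union_le _ _).trans (add_le_add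
        ((measure_union_le _ _).trans (add_le_add (p1.trans hδ') (p2.trans hδ')))
        (p3.trans hδ'))) (p4.trans hδ'))
    _ = ENNReal.ofReal δ := by
      rw [← ENNReal.ofReal_add hδ0 hδ0, ← ENNReal.ofReal_add (by positivity) hδ0,
        ← ENNReal.ofReal_add (by positivity) hδ0]
      congr 1; ring

end GoodEvent

/-! ### Soft clipping with Newton's square root, and descent with it -/

section Newton

/-- Newton's iteration for the square root of `q`. -/
noncomputable def newtonSqrt (q y : ℝ) (K : ℕ) : ℝ := (fun y => (y + q / y) / 2)^[K] y

theorem newtonSqrt_succ (q y : ℝ) (K : ℕ) :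
    newtonSqrt q y (K + 1) = (newtonSqrt q y K + q / newtonSqrt q y K) / 2 :=
  Function.iterate_succ_apply' _ _ _

/-- A Newton step sends `z` to `s + (z - s) ^ 2 / (2 * z)`, so from above it stays above `s` and at
least halves the error. For `s = 0` the iteration stays at `0`, since division by zero gives zero.
-/
theorem newtonSqrt_mem {s y e : ℝ} (hs : 0 ≤ s) (h1 : s ≤ y) (h2 : y ≤ (1 + e) * s) (K : ℕ) :
    s ≤ newtonSqrt (s ^ 2) y K ∧ newtonSqrt (s ^ 2) y K ≤ (1 + e / 2 ^ K) * s := by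
  induction K with
  | zero => simpa [newtonSqrt] using ⟨h1, h2⟩
  | succ K ih =>
    rw [newtonSqrt_succ]
    set z := newtonSqrt (s ^ 2) y K
    rcases hs.eq_or_lt with h0 | h0
    · rw [← h0] at ih ⊢
      have hz : z = 0 := le_antisymm (by simpa using ih.2) ih.1
      simp [hz]
    have hz : 0 < z := h0.trans_le ih.1
    have e1 : (z + s ^ 2 / z) / 2 = s + (z - s) / 2 * ((z - s) / z) := by field_simp; ring
    have hle : (z - s) / z ≤ 1 := by rw [div_le_one hz]; linarith
    have hnn : 0 ≤ (z - s) / z := div_nonneg (by linarith [ih.1]) hz.le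
    have hzs : 0 ≤ (z - s) / 2 := by linarith [ih.1]
    have e2 : (1 + e / 2 ^ (K + 1)) * s = s + (e / 2 ^ K * s) / 2 := by rw [pow_succ]; field_simp
    rw [e1, e2]
    constructor
    · nlinarith
    · have := mul_le_mul_of_nonneg_left hle hzs
      linarith [ih.2]

variable {d : ℕ}

/-- The approximate Euclidean norm computed with `K` steps of Newton's iteration. -/
noncomputable def approxNorm (K : ℕ) (x : EuclideanSpace ℝ (Fin d)) : ℝ :=
  newtonSqrt (∑ c, x c ^ 2) (∑ c, |x c|) K

/-- Soft clipping with the approximate norm. -/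
noncomputable def approxClip (K : ℕ) (x : EuclideanSpace ℝ (Fin d)) : EuclideanSpace ℝ (Fin d) :=
  (1 / (1 + approxNorm K x)) • x

/-- The `ℓ¹` norm is a start computable without roots: it lies between `‖x‖` and `d * ‖x‖`. -/
theorem approxNorm_mem (K : ℕ) (x : EuclideanSpace ℝ (Fin d)) :
    ‖x‖ ≤ approxNorm K x ∧ approxNorm K x ≤ (1 + (d : ℝ) / 2 ^ K) * ‖x‖ := by
  unfold approxNorm
  have hn : ∑ c, x c ^ 2 = ‖x‖ ^ 2 := by
    rw [EuclideanSpace.norm_sq_eq]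
    simp
  rw [hn]
  refine newtonSqrt_mem (norm_nonneg x) ?_ ?_ K
  · apply le_of_sq_le_sq _ (Finset.sum_nonneg fun c _ => abs_nonneg _)
    rw [← hn]
    calc ∑ c, x c ^ 2 = ∑ c, |x c| ^ 2 := by simp
      _ ≤ _ := Finset.sum_sq_le_sq_sum_of_nonneg fun c _ => abs_nonneg _
  · calc ∑ c, |x c| ≤ ∑ _c : Fin d, ‖x‖ := Finset.sum_le_sum fun c _ => by
          simpa using PiLp.norm_apply_le x c
      _ = d * ‖x‖ := by simp
      _ ≤ _ := by nlinarith [norm_nonneg x]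

/-- A relative error of the norm turns into an absolute error of the clipped vector, uniformly in
`x`, because `‖x‖ ^ 2 ≤ (1 + y) * (1 + ‖x‖)`. -/
theorem norm_approxClip_sub_le (K : ℕ) (x : EuclideanSpace ℝ (Fin d)) :
    ‖approxClip K x - softClip x‖ ≤ (d : ℝ) / 2 ^ K := by
  obtain ⟨h1, h2⟩ := approxNorm_mem K x
  have hs : 0 ≤ ‖x‖ := norm_nonneg x
  set s := ‖x‖ with hsd
  set y := approxNorm K x with hy
  have hy0 : 0 ≤ y := hs.trans h1
  have e : approxClip K x - softClip x = (-((y - s) / ((1 + y) * (1 + s)))) • x := by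
    rw [approxClip, softClip, ← sub_smul, ← hy, ← hsd]
    congr 1
    field_simp
    ring
  have hnn : 0 ≤ (y - s) / ((1 + y) * (1 + s)) := div_nonneg (by linarith) (by positivity)
  rw [e, norm_smul, norm_neg, Real.norm_of_nonneg hnn, ← hsd, div_mul_eq_mul_div,
    div_le_iff₀ (by positivity)]
  have hE : 0 ≤ (d : ℝ) / 2 ^ K := by positivity
  calc (y - s) * s ≤ ((d : ℝ) / 2 ^ K * s) * s := by gcongr; linarith
    _ = (d : ℝ) / 2 ^ K * (s * s) := by ring
    _ ≤ _ := by gcongr <;> linarith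

/-! ### The computable residual and the descent along it. -/

/-- The mean of the approximately soft-clipped vectors `r • (y i - u)`, `i < n`. -/
noncomputable def approxMean (K n : ℕ) (r : ℝ) (y : ℕ → EuclideanSpace ℝ (Fin d))
    (u : EuclideanSpace ℝ (Fin d)) : EuclideanSpace ℝ (Fin d) :=
  (1 / (n : ℝ)) • ∑ i ∈ Finset.range n, approxClip K (r • (y i - u))

/-- The residual of the clipping equation at the candidate shift `u`. -/
noncomputable def clipResidual (K n : ℕ) (r : ℝ) (y₁ y₂ : ℕ → EuclideanSpace ℝ (Fin d))
    (u : EuclideanSpace ℝ (Fin d)) : EuclideanSpace ℝ (Fin d) :=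
  approxMean K n r y₂ u - approxMean K n r y₁ 0

/-- The `k`-th point of the descent started at `u`. -/
noncomputable def clipDescent (K n : ℕ) (r : ℝ) (y₁ y₂ : ℕ → EuclideanSpace ℝ (Fin d))
    (u : EuclideanSpace ℝ (Fin d)) : ℕ → EuclideanSpace ℝ (Fin d)
  | 0 => u
  | k + 1 => clipDescent K n r y₁ y₂ u k
      + (1 / r) • clipResidual K n r y₁ y₂ (clipDescent K n r y₁ y₂ u k)

/-- The substitution `w = r • (v - u)` centres the candidate at the unknown shift, so the descent
lemmas apply with `v` moved to `0`. -/
theorem norm_approxMean_sub_le (K n : ℕ) (r : ℝ) (y : ℕ → EuclideanSpace ℝ (Fin d))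
    (u v : EuclideanSpace ℝ (Fin d)) :
    ‖approxMean K n r y u - clipMean n (fun i => r • (y i - v)) (r • (v - u))‖ ≤ d / 2 ^ K := by
  have e : ∀ i, r • (y i - v) + r • (v - u) = r • (y i - u) := fun i => by
    rw [← smul_add]; congr 1; abel
  simp only [approxMean, clipMean, e]
  rw [← smul_sub, ← Finset.sum_sub_distrib]
  exact norm_mean_le (by positivity) fun i _ => norm_approxClip_sub_le _ _

theorem norm_residual_sub_le (K n : ℕ) (r : ℝ) (y₁ y₂ : ℕ → EuclideanSpace ℝ (Fin d))
    (u v : EuclideanSpace ℝ (Fin d)) :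
    ‖clipResidual K n r y₁ y₂ u - (clipMean n (fun i => r • (y₂ i - v)) (r • (v - u))
      - clipMean n (fun i => r • y₁ i) 0)‖ ≤ 2 * (d / 2 ^ K) := by
  have h1 := norm_approxMean_sub_le K n r y₂ u v
  have h2 := norm_approxMean_sub_le K n r y₁ 0 0
  simp only [sub_zero, smul_zero] at h2
  have e : clipResidual K n r y₁ y₂ u - (clipMean n (fun i => r • (y₂ i - v)) (r • (v - u))
      - clipMean n (fun i => r • y₁ i) 0)
      = (approxMean K n r y₂ u - clipMean n (fun i => r • (y₂ i - v)) (r • (v - u)))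
        - (approxMean K n r y₁ 0 - clipMean n (fun i => r • y₁ i) 0) := by
    rw [clipResidual]; abel
  rw [e]
  refine (norm_sub_le _ _).trans ?_
  linarith

/-- The crude bound `K < 2 ^ K` is enough; the factor `d` in `K` cancels the initial relative error
`d`. -/
theorem newton_error_le {a b : ℕ} (ha : 0 < a) (hb : 0 < b) :
    (d : ℝ) / 2 ^ (256 * a * a * b * b * d) ≤ 1 / (256 * (a * b) ^ 2) := by
  rcases Nat.eq_zero_or_pos d with rfl | hd
  · simp only [Nat.cast_zero, zero_div]; positivity
  have h : ((256 * a * a * b * b * d : ℕ) : ℝ) < 2 ^ (256 * a * a * b * b * d) := by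
    exact_mod_cast Nat.lt_two_pow_self
  have hp : (0 : ℝ) < ((256 * a * a * b * b * d : ℕ) : ℝ) := by
    have : 0 < 256 * a * a * b * b * d := by positivity
    exact_mod_cast this
  calc (d : ℝ) / 2 ^ (256 * a * a * b * b * d) ≤ d / ((256 * a * a * b * b * d : ℕ) : ℝ) := by
        gcongr
    _ = _ := by
        have : (d : ℝ) ≠ 0 := by positivity
        push_cast
        field_simp

variable {a b n : ℕ} {r : ℝ} {v : EuclideanSpace ℝ (Fin d)}
  {y₁ y₂ : ℕ → EuclideanSpace ℝ (Fin d)}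

/-- The certificate: a small computed residual forces closeness to `v`, however the point was found.
The test tolerance plus the Newton error is at most `4 * W / b ^ 2`, and the residual at `v` is at
most `52 * W / b ^ 2`; their sum `56 * W / b ^ 2` yields `112 / b ^ 2`. -/
theorem GoodSample.norm_sub_le (h : GoodSample a b n r v y₁ y₂) (ha : 0 < a) (hb : 64 ≤ b)
    {u : EuclideanSpace ℝ (Fin d)}
    (hu : ‖clipResidual (256 * a * a * b * b * d) n r y₁ y₂ u‖ ≤ 1 / (a * b ^ 2)) :
    ‖r • (u - v)‖ ≤ 112 / b ^ 2 := by
  have hb' : (64 : ℝ) ≤ b := by exact_mod_cast hb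
  have ha' : (1 : ℝ) ≤ a := by exact_mod_cast ha
  have hb2 : (64 : ℝ) ^ 2 ≤ (b : ℝ) ^ 2 := by gcongr
  have hib : 1 / (b : ℝ) ^ 2 ≤ 1 / 64 ^ 2 := by gcongr
  have hib0 : 0 < 1 / (b : ℝ) ^ 2 := by positivity
  have hia0 : 0 < 1 / (a : ℝ) := by positivity
  have h1 := h.weight
  have h2 := h.residual
  set W := clipWeight n fun i => r • (y₂ i - v) with hW
  have hWa : 1 / (a : ℝ) ≤ 2 * W := by rw [div_le_iff₀ (by linarith)]; linarith
  have hW0 : 0 < W := by linarith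
  have h3 := norm_residual_sub_le (256 * a * a * b * b * d) n r y₁ y₂ u v
  have h4 := newton_error_le (d := d) ha (by omega : 0 < b)
  have hτ : 1 / ((a : ℝ) * b ^ 2) ≤ 2 * W * (1 / b ^ 2) := by
    have : 1 / ((a : ℝ) * b ^ 2) = 1 / a * (1 / b ^ 2) := by field_simp
    rw [this]; gcongr
  have h5 : 1 / (256 * ((a : ℝ) * b) ^ 2) ≤ 1 / 2 * (1 / (a * b ^ 2)) := by
    rw [div_mul_div_comm, one_mul]
    gcongr 1 / ?_
    have : 0 ≤ (b : ℝ) ^ 2 * (a * (256 * a - 2)) := by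
      apply mul_nonneg (by positivity); nlinarith
    nlinarith
  have h6 : ‖clipMean n (fun i => r • (y₂ i - v)) (r • (v - u))
      - clipMean n (fun i => r • y₁ i) 0‖ ≤ 2 * (1 / (a * b ^ 2)) := by
    have := norm_sub_norm_le (clipMean n (fun i => r • (y₂ i - v)) (r • (v - u))
      - clipMean n (fun i => r • y₁ i) 0) (clipResidual (256 * a * a * b * b * d) n r y₁ y₂ u)
    rw [norm_sub_rev] at h3
    linarith
  have h7 := norm_le_of_clipMean_near (c := 56 / b ^ 2) (t := clipMean n (fun i => r • y₁ i) 0)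
    (w := r • (v - u)) (x := fun i => r • (y₂ i - v)) (n := n) hW0 (by
      have : 56 / (b : ℝ) ^ 2 = 56 * (1 / b ^ 2) := by ring
      rw [this]; linarith) (by
      have e1 : 56 / (b : ℝ) ^ 2 * W = 2 * (2 * W * (1 / b ^ 2)) + 52 / b ^ 2 * W := by ring
      rw [e1]
      linarith)
  rw [← norm_neg, ← smul_neg, neg_sub]
  refine h7.trans (le_of_eq (by ring))

/-- In the variable `w = r • (v - u)` the program's update becomes `w - g w`, so `v` occurs only in
the analysis. With `N = 96 * a ^ 2 * b ^ 2` the number `W * τ * N` equals `48 * (2 * a * W) ≥ 48`.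
-/
theorem GoodSample.exists_descent (h : GoodSample a b n r v y₁ y₂) (hr : r ≠ 0) (ha : 0 < a)
    (hb : 64 ≤ b) : ∃ i < n, ‖clipResidual (256 * a * a * b * b * d) n r y₁ y₂
      (clipDescent (256 * a * a * b * b * d) n r y₁ y₂ (y₂ i) (96 * a * a * b * b))‖
        ≤ 1 / (a * b ^ 2) := by
  have hb' : (64 : ℝ) ≤ b := by exact_mod_cast hb
  have ha' : (1 : ℝ) ≤ a := by exact_mod_cast ha
  have hb2 : (64 : ℝ) ^ 2 ≤ (b : ℝ) ^ 2 := by gcongr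
  have hib : 1 / (b : ℝ) ^ 2 ≤ 1 / 64 ^ 2 := by gcongr
  have hib0 : 0 < 1 / (b : ℝ) ^ 2 := by positivity
  have hia0 : 0 < 1 / (a : ℝ) := by positivity
  have hia1 : 1 / (a : ℝ) ≤ 1 := by rw [div_le_one (by linarith)]; exact ha'
  have h1 := h.weight
  have h2 := h.residual
  obtain ⟨i, hin, hi⟩ := h.start
  set W := clipWeight n fun i => r • (y₂ i - v) with hW
  have hWa : 1 / (a : ℝ) ≤ 2 * W := by rw [div_le_iff₀ (by linarith)]; linarith
  have hW0 : 0 < W := by linarith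
  set K := 256 * a * a * b * b * d with hK
  have h4 : (d : ℝ) / 2 ^ K ≤ 1 / (256 * (a * b) ^ 2) :=
    newton_error_le (d := d) ha (by omega : 0 < b)
  have h5 : 1 / (256 * ((a : ℝ) * b) ^ 2) = 1 / 256 * (1 / a * (1 / a) * (1 / b ^ 2)) := by
    field_simp
  have hτ : 1 / ((a : ℝ) * b ^ 2) = 1 / a * (1 / b ^ 2) := by field_simp
  have h6 : 1 / (a : ℝ) * (1 / a) * (1 / b ^ 2) ≤ 2 * W * (1 / a) * (1 / b ^ 2) := by gcongr
  have h7 : 2 * W * (1 / (a : ℝ)) * (1 / b ^ 2) ≤ 2 * W * 1 * (1 / 64 ^ 2) := by gcongr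
  refine ⟨i, hin, ?_⟩
  have key := exists_norm_descent_le (n := n) (x := fun i => r • (y₂ i - v))
    (t := clipMean n (fun i => r • y₁ i) 0)
    (g := fun w => clipResidual K n r y₁ y₂ (v - (1 / r) • w)) (e := 2 * (d / 2 ^ K))
    (τ := 1 / (a * b ^ 2)) (N := 96 * a * a * b * b)
    (w := fun k => r • (v - clipDescent K n r y₁ y₂ (y₂ i) k)) hW0
    (fun w => by
      have := norm_residual_sub_le K n r y₁ y₂ (v - (1 / r) • w) v
      rwa [sub_sub_cancel, smul_smul, mul_one_div_cancel hr, one_smul] at this)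
    (norm_clipMean_le _ _ _)
    (by
      have e1 : 52 / (b : ℝ) ^ 2 * W = 52 * (W * (1 / b ^ 2)) := by ring
      have e2 : W * (1 / (b : ℝ) ^ 2) ≤ W * (1 / 64 ^ 2) := by gcongr
      rw [← hW]
      linarith)
    (by
      have : 0 < 1 / (a : ℝ) * (1 / a) * (1 / b ^ 2) := by positivity
      rw [← hW, hτ]
      linarith)
    (by
      rw [← hW]
      push_cast
      have e1 : W * (1 / ((a : ℝ) * b ^ 2)) * (96 * a * a * b * b) = 48 * (2 * a * W) := by
        field_simp
        norm_num
      rw [e1]; linarith)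
    (by
      simp only [clipDescent]
      rw [← norm_neg, ← smul_neg, neg_sub]
      exact hi)
    (fun k => by
      simp only [clipDescent, smul_smul, one_div_mul_cancel hr, one_smul, sub_sub_cancel]
      rw [← sub_sub, smul_sub, smul_smul, mul_one_div_cancel hr, one_smul])
  simpa only [smul_smul, one_div_mul_cancel hr, one_smul, sub_sub_cancel] using key

end Newton

/-! ### Reasoning about programs -/

namespace RealRAM

/-- The registers that a program may change. -/
def Prog.regs : Prog → List ℕ
  | .skip => []
  | .setI x _ => [x]
  | .setR _ _ _ => []
  | .toss x => [x]
  | .draw _ _ _ => []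
  | .seq p q => p.regs ++ q.regs
  | .ite _ p q => p.regs ++ q.regs
  | .while _ p => p.regs

/-- The arrays that a program may change. -/
def Prog.arrs : Prog → List ℕ
  | .skip => []
  | .setI _ _ => []
  | .setR a _ _ => [a]
  | .toss _ => []
  | .draw _ a _ => [a]
  | .seq p q => p.arrs ++ q.arrs
  | .ite _ p q => p.arrs ++ q.arrs
  | .while _ p => p.arrs

/-- Does the program contain an instruction for drawing a sample? -/
def Prog.draws : Prog → Bool
  | .draw _ _ _ => true
  | .seq p q => p.draws || q.draws
  | .ite _ p q => p.draws || q.draws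
  | .while _ p => p.draws
  | _ => false

/-- The states `s` and `s'` agree except on the registers `R` and the arrays `A`. -/
structure Frame (R A : List ℕ) (s s' : State) : Prop where
  reg : ∀ x ∉ R, s'.reg x = s.reg x
  arr : ∀ a ∉ A, s'.arr a = s.arr a

theorem Frame.refl (R A : List ℕ) (s : State) : Frame R A s s := ⟨fun _ _ => rfl, fun _ _ => rfl⟩

theorem Frame.trans {R A : List ℕ} {s s' s'' : State} (h : Frame R A s s') (h' : Frame R A s' s'') :
    Frame R A s s'' :=
  ⟨fun x hx => (h'.reg x hx).trans (h.reg x hx), fun a ha => (h'.arr a ha).trans (h.arr a ha)⟩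

theorem Frame.mono {R A R' A' : List ℕ} {s s' : State} (h : Frame R A s s') (hR : R ⊆ R')
    (hA : A ⊆ A') : Frame R' A' s s' :=
  ⟨fun x hx => h.reg x fun hx' => hx (hR hx'), fun a ha => h.arr a fun ha' => ha (hA ha')⟩

variable {d : ℕ} {ω : Tape d}

/-- Since the lists of written registers and arrays are syntactic, preservation of all other memory
is decided from the program text alone. -/
theorem Exec.frame {p : Prog} {s s' : State} {t : ℕ} (h : Exec ω p s s' t) :
    Frame p.regs p.arrs s s' := by
  induction h with
  | skip s => exact Frame.refl _ _ _
  | setI s x e =>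
    exact ⟨fun y hy => by simp [State.setI, Prog.regs] at hy ⊢; tauto, fun _ _ => rfl⟩
  | setR s a i e =>
    refine ⟨fun _ _ => rfl, fun b hb => ?_⟩
    simp only [Prog.arrs, List.mem_singleton] at hb
    funext j
    simp [State.setR, hb]
  | toss s x =>
    exact ⟨fun y hy => by simp [State.toss, Prog.regs] at hy ⊢; tauto, fun _ _ => rfl⟩
  | draw s b a i =>
    refine ⟨fun _ _ => rfl, fun b hb => ?_⟩
    simp only [Prog.arrs, List.mem_singleton] at hb
    funext j
    simp [State.draw, hb]
  | seq _ _ ih ih' =>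
    exact (ih.mono (List.subset_append_left _ _) (List.subset_append_left _ _)).trans
      (ih'.mono (List.subset_append_right _ _) (List.subset_append_right _ _))
  | ite_true _ _ ih => exact ih.mono (List.subset_append_left _ _) (List.subset_append_left _ _)
  | ite_false _ _ ih => exact ih.mono (List.subset_append_right _ _) (List.subset_append_right _ _)
  | while_true _ _ _ ih ih' => exact ih.trans ih'
  | while_false _ => exact Frame.refl _ _ _

theorem Exec.drawn_eq {p : Prog} {s s' : State} {t : ℕ} (h : Exec ω p s s' t)
    (hp : p.draws = false) : s'.drawn = s.drawn := by
  induction h with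
  | draw s b a i => simp [Prog.draws] at hp
  | seq _ _ ih ih' =>
    simp only [Prog.draws, Bool.or_eq_false_iff] at hp
    rw [ih' hp.2, ih hp.1]
  | ite_true _ _ ih =>
    simp only [Prog.draws, Bool.or_eq_false_iff] at hp
    exact ih hp.1
  | ite_false _ _ ih =>
    simp only [Prog.draws, Bool.or_eq_false_iff] at hp
    exact ih hp.2
  | while_true _ _ _ ih ih' => rw [ih' hp, ih hp]
  | _ => rfl

/-- Started in `s`, the program halts within `T` steps in a state that satisfies `Q`. -/
def Runs (ω : Tape d) (p : Prog) (s : State) (T : ℕ) (Q : State → Prop) : Prop :=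
  ∃ s' t, Exec ω p s s' t ∧ t ≤ T ∧ Q s'

variable {p q : Prog} {s : State} {T T' : ℕ} {Q Q' : State → Prop}

theorem Runs.mono (h : Runs ω p s T Q) (hT : T ≤ T')
    (hQ : ∀ s', Frame p.regs p.arrs s s' → Q s' → Q' s') : Runs ω p s T' Q' := by
  obtain ⟨s', t, he, ht, hq⟩ := h
  exact ⟨s', t, he, ht.trans hT, hQ s' he.frame hq⟩

theorem Runs.seq (h : Runs ω p s T Q)
    (h' : ∀ s', Frame p.regs p.arrs s s' → Q s' → Runs ω q s' T' Q') :
    Runs ω (.seq p q) s (T + T') Q' := by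
  obtain ⟨s', t, he, ht, hq⟩ := h
  obtain ⟨s'', t', he', ht', hq'⟩ := h' s' he.frame hq
  exact ⟨s'', t + t', he.seq he', add_le_add ht ht', hq'⟩

theorem Runs.setI {x : ℕ} {e : IExp} (h : Q (s.setI x (e.eval s))) :
    Runs ω (.setI x e) s (e.cost + 1) Q := ⟨_, _, .setI s x e, le_rfl, h⟩

theorem Runs.setI_seq {x : ℕ} {e : IExp} (h : Runs ω q (s.setI x (e.eval s)) T Q) :
    Runs ω (.seq (.setI x e) q) s (e.cost + 1 + T) Q := by
  obtain ⟨s', t, he, ht, hq⟩ := h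
  exact ⟨s', _, (Exec.setI s x e).seq he, by omega, hq⟩

theorem Runs.setR_seq {a : ℕ} {i : IExp} {e : RExp}
    (h : Runs ω q (s.setR a (i.eval s) (e.eval s)) T Q) :
    Runs ω (.seq (.setR a i e) q) s (i.cost + e.cost + 1 + T) Q := by
  obtain ⟨s', t, he, ht, hq⟩ := h
  exact ⟨s', _, (Exec.setR s a i e).seq he, by omega, hq⟩

theorem Runs.setR_le {a : ℕ} {i : IExp} {e : RExp} (h : Q (s.setR a (i.eval s) (e.eval s)))
    (hT : i.cost + e.cost + 1 ≤ T) : Runs ω (.setR a i e) s T Q :=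
  ⟨_, _, .setR s a i e, hT, h⟩

theorem Runs.le (h : Runs ω p s T Q) (hT : T ≤ T') : Runs ω p s T' Q :=
  h.mono hT fun _ _ h => h

theorem Runs.drawn (h : Runs ω p s T Q) (hp : p.draws = false) :
    Runs ω p s T fun s' => s'.drawn = s.drawn ∧ Q s' := by
  obtain ⟨s', t, he, ht, hq⟩ := h
  exact ⟨s', t, he, ht, he.drawn_eq hp, hq⟩

theorem Runs.skip (h : Q s) : Runs ω .skip s 1 Q := ⟨_, _, .skip s, le_rfl, h⟩

theorem Runs.draw {b : Fin 2} {a : ℕ} {i : IExp} (h : Q (s.draw ω b a (i.eval s))) :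
    Runs ω (.draw b a i) s (i.cost + d + 1) Q := ⟨_, _, .draw s b a i, le_rfl, h⟩

theorem Runs.draw_le {b : Fin 2} {a : ℕ} {i : IExp} (h : Q (s.draw ω b a (i.eval s)))
    (hT : i.cost + d + 1 ≤ T) : Runs ω (.draw b a i) s T Q := ⟨_, _, .draw s b a i, hT, h⟩

theorem Runs.ite {c : BExp} (h : c.Holds s → Runs ω p s T Q) (h' : ¬ c.Holds s → Runs ω q s T Q) :
    Runs ω (.ite c p q) s (c.cost + T + 1) Q := by
  by_cases hc : c.Holds s
  · obtain ⟨s', t, he, ht, hq⟩ := h hc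
    exact ⟨s', _, .ite_true hc he, by omega, hq⟩
  · obtain ⟨s', t, he, ht, hq⟩ := h' hc
    exact ⟨s', _, .ite_false hc he, by omega, hq⟩

/-- A loop that is passed exactly `n` times. -/
theorem Runs.while {c : BExp} (n : ℕ) (I : ℕ → State → Prop)
    (hstep : ∀ k < n, ∀ s, I k s → c.Holds s ∧ Runs ω p s T (I (k + 1)))
    (hend : ∀ s, I n s → ¬ c.Holds s) (h0 : I 0 s) :
    Runs ω (.while c p) s (n * (T + c.cost + 1) + c.cost + 1) (I n) := by
  suffices h : ∀ m k s, k + m = n → I k s →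
      Runs ω (.while c p) s (m * (T + c.cost + 1) + c.cost + 1) (I n) from
    h n 0 s (zero_add n) h0
  intro m
  induction m with
  | zero =>
    intro k s hk hI
    obtain rfl : k = n := by omega
    exact ⟨s, _, .while_false (hend s hI), by omega, hI⟩
  | succ m ih =>
    intro k s hk hI
    obtain ⟨hc, s', t, he, ht, hI'⟩ := hstep k (by omega) s hI
    obtain ⟨s'', t', he', ht', hI''⟩ := ih (k + 1) s' (by omega) hI'
    refine ⟨s'', _, .while_true hc he he', ?_, hI''⟩
    rw [Nat.succ_mul]
    omega

/-- `for i < e do p`. -/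
def forLoop (i : ℕ) (e : IExp) (p : Prog) : Prog :=
  .seq (.setI i (.lit 0)) (.while (.ltI (.reg i) e) (.seq p (.setI i (.add (.reg i) (.lit 1)))))

/-- The frame relative to the initial state is carried along, so `I` need only describe what the
body changes. The body establishes `I (k + 1)` for the state in which the counter has already been
advanced. -/
theorem Runs.for {i : ℕ} {e : IExp} (n : ℕ) (I : ℕ → State → Prop) (hi : i ∉ p.regs)
    (he : ∀ s', Frame (i :: p.regs) p.arrs s s' → e.eval s' = n)
    (h0 : I 0 (s.setI i 0))
    (hstep : ∀ k < n, ∀ s', Frame (i :: p.regs) p.arrs s s' → s'.reg i = k → I k s' →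
      Runs ω p s' T fun s'' => I (k + 1) (s''.setI i (k + 1))) :
    Runs ω (forLoop i e p) s ((n + 1) * (T + e.cost + 7)) (I n) := by
  have hF0 : Frame (i :: p.regs) p.arrs s (s.setI i 0) :=
    ⟨fun x hx => by
      simp only [List.mem_cons, not_or] at hx
      simp [State.setI, hx.1], fun _ _ => rfl⟩
  have key := Runs.while (ω := ω) (c := .ltI (.reg i) e)
    (p := .seq p (.setI i (.add (.reg i) (.lit 1)))) (T := T + 4) (s := s.setI i 0) n
    (fun k s' => (Frame (i :: p.regs) p.arrs s s' ∧ s'.reg i = k) ∧ I k s')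
    (by
      rintro k hk s' ⟨⟨hF, hr⟩, hI⟩
      refine ⟨by simp only [BExp.Holds, IExp.eval, he s' hF, hr]; exact hk, ?_⟩
      refine Runs.seq (hstep k hk s' hF hr hI) fun s'' hF' hI' => ?_
      have hr' : s''.reg i = k := (hF'.reg i hi).trans hr
      refine Runs.setI (e := .add (.reg i) (.lit 1)) ?_
      simp only [IExp.eval, hr']
      refine ⟨⟨?_, by simp [State.setI]⟩, hI'⟩
      refine hF.trans ((hF'.mono (List.subset_cons_self _ _) (List.Subset.refl _)).trans
        ⟨fun x hx => ?_, fun _ _ => rfl⟩)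
      simp only [List.mem_cons, not_or] at hx
      simp [State.setI, hx.1])
    (by
      rintro s' ⟨⟨hF, hr⟩, hI⟩
      simp [BExp.Holds, IExp.eval, he s' hF, hr])
    ⟨⟨hF0, by simp [State.setI]⟩, h0⟩
  obtain ⟨s', t, hE, ht, hQ⟩ := key
  refine ⟨s', _, (Exec.setI s i (.lit 0)).seq hE, ?_, hQ.2⟩
  simp only [IExp.cost, BExp.cost] at ht ⊢
  nlinarith

end RealRAM

/-! ### The soft-clipping subroutines

The registers `0`, `1`, `2`, `5`, `6`, `7` hold the dimension, the inverse accuracies `a` and `b`, the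
sample size, the number of descent steps and the number of Newton steps; the registers from `8` on
are loop counters. The arrays `2` and `3` hold the samples of the two sources, the array `4` the
current candidate, the arrays `5` and `12` means of clipped vectors, and the arrays `6` to `9` are
temporary. -/

namespace RealRAM

@[simp] theorem State.setI_reg (s : State) (x n y : ℕ) :
    (s.setI x n).reg y = if y = x then n else s.reg y := rfl

@[simp] theorem State.setI_arr (s : State) (x n : ℕ) : (s.setI x n).arr = s.arr := rfl

@[simp] theorem State.setI_drawn (s : State) (x n : ℕ) : (s.setI x n).drawn = s.drawn := rfl

@[simp] theorem State.setR_reg (s : State) (a i : ℕ) (r : ℝ) : (s.setR a i r).reg = s.reg := rfl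

@[simp] theorem State.setR_arr (s : State) (a i : ℕ) (r : ℝ) (a' i' : ℕ) :
    (s.setR a i r).arr a' i' = if a' = a ∧ i' = i then r else s.arr a' i' := rfl

/-- The parameters that the subroutines read. -/
structure Params (d a b n N K : ℕ) (σ : ℝ) (s : State) : Prop where
  dim : s.reg 0 = d
  accA : s.reg 1 = a
  accB : s.reg 2 = b
  size : s.reg 5 = n
  steps : s.reg 6 = N
  newton : s.reg 7 = K
  scale : s.arr 0 3 = σ

variable {d a b n N K B : ℕ} {σ : ℝ} {s : State} {ω : Tape d}

/-- Parameters live in registers below `8` and in array `0`, which the clipping and descent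
subroutines never write. -/
theorem Frame.params {R A : List ℕ} {s' : State} (h : Frame R A s s')
    (hR : ∀ x ∈ R, 8 ≤ x) (hA : 0 ∉ A) (hp : Params d a b n N K σ s) :
    Params d a b n N K σ s' := by
  have hR' : ∀ x < 8, s'.reg x = s.reg x := fun x hx => h.reg x fun hx' => by
    have := hR x hx'; omega
  exact ⟨(hR' 0 (by norm_num)).trans hp.dim, (hR' 1 (by norm_num)).trans hp.accA,
    (hR' 2 (by norm_num)).trans hp.accB, (hR' 5 (by norm_num)).trans hp.size,
    (hR' 6 (by norm_num)).trans hp.steps, (hR' 7 (by norm_num)).trans hp.newton,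
    (congrFun (h.arr 0 hA) 3).trans hp.scale⟩

/-- The expression for `b * σ`. -/
def scaleExp : RExp := .mul (.ofNat (.reg 2)) (.cell 0 (.lit 3))

/-- Compute a shifted and scaled sample, its squared Euclidean norm, and its `ℓ¹` norm. -/
def loadProg (S : ℕ) : Prog := forLoop 11 (.reg 0) <|
  .seq (.setR 6 (.reg 11) (.div (.sub (.cell S (.add (.mul (.reg 10) (.reg 0)) (.reg 11)))
    (.cell 4 (.reg 11))) scaleExp)) <|
  .seq (.setR 7 (.lit 0) (.add (.cell 7 (.lit 0)) (.mul (.cell 6 (.reg 11)) (.cell 6 (.reg 11))))) <|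
  .ite (.ltR (.cell 6 (.reg 11)) (.ofNat (.lit 0)))
    (.setR 8 (.lit 0) (.sub (.cell 8 (.lit 0)) (.cell 6 (.reg 11))))
    (.setR 8 (.lit 0) (.add (.cell 8 (.lit 0)) (.cell 6 (.reg 11))))

/-- Newton's iteration. -/
def newtonProg : Prog := forLoop 12 (.reg 7) <|
  .setR 8 (.lit 0) (.div (.add (.cell 8 (.lit 0)) (.div (.cell 7 (.lit 0)) (.cell 8 (.lit 0))))
    (.ofNat (.lit 2)))

/-- Add the clipped vector, divided by the sample size, to the array `A`. -/
def accumProg (A : ℕ) : Prog := forLoop 11 (.reg 0) <|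
  .setR A (.reg 11) (.add (.cell A (.reg 11)) (.div (.cell 6 (.reg 11))
    (.mul (.add (.ofNat (.lit 1)) (.cell 8 (.lit 0))) (.ofNat (.reg 5)))))

/-- Add one clipped sample to the array `A`. -/
def addClipProg (S A : ℕ) : Prog :=
  .seq (.setR 7 (.lit 0) (.ofNat (.lit 0))) <| .seq (.setR 8 (.lit 0) (.ofNat (.lit 0))) <|
  .seq (loadProg S) <| .seq newtonProg (accumProg A)

/-- Compute the mean of the clipped samples. -/
def meanProg (S A : ℕ) : Prog :=
  .seq (forLoop 11 (.reg 0) (.setR A (.reg 11) (.ofNat (.lit 0))))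
    (forLoop 10 (.reg 5) (addClipProg S A))

/-- The entry number `c` of the shifted and scaled sample number `j`. -/
noncomputable def scaledEntry (d b : ℕ) (σ : ℝ) (y u : ℕ → ℝ) (j c : ℕ) : ℝ :=
  (y (j * d + c) - u c) / (b * σ)

theorem runs_loadProg {S : ℕ} (hS : S ≠ 6 ∧ S ≠ 7 ∧ S ≠ 8) (hp : Params d a b n N K σ s)
    (h7 : s.arr 7 0 = 0) (h8 : s.arr 8 0 = 0) :
    Runs ω (loadProg S) s ((d + 1) * 70) fun s' =>
      (∀ c < d, s'.arr 6 c = scaledEntry d b σ (s.arr S) (s.arr 4) (s.reg 10) c) ∧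
      s'.arr 7 0 = ∑ c ∈ Finset.range d,
        scaledEntry d b σ (s.arr S) (s.arr 4) (s.reg 10) c ^ 2 ∧
      s'.arr 8 0 = ∑ c ∈ Finset.range d,
        |scaledEntry d b σ (s.arr S) (s.arr 4) (s.reg 10) c| := by
  set X := scaledEntry d b σ (s.arr S) (s.arr 4) (s.reg 10) with hX
  refine Runs.le (Runs.for (T := 55) d (fun k s' => (∀ c < k, s'.arr 6 c = X c) ∧
    s'.arr 7 0 = ∑ c ∈ Finset.range k, X c ^ 2 ∧ s'.arr 8 0 = ∑ c ∈ Finset.range k, |X c|)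
    (by simp [Prog.regs]) (fun s' hF => (hF.reg 0 (by simp [Prog.regs])).trans hp.dim)
    (by simp [h7, h8]) ?_) (by simp [IExp.cost])
  rintro k hk s' hF hr ⟨i6, i7, i8⟩
  have e10 : s'.reg 10 = s.reg 10 := hF.reg 10 (by simp [Prog.regs])
  have hp' : Params d a b n N K σ s' :=
    hF.params (by simp [Prog.regs]) (by simp [Prog.arrs]) hp
  have eS : s'.arr S = s.arr S := hF.arr S (by simp [Prog.arrs]; tauto)
  have e4 : s'.arr 4 = s.arr 4 := hF.arr 4 (by simp [Prog.arrs])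
  have hval : (RExp.div (.sub (.cell S (.add (.mul (.reg 10) (.reg 0)) (.reg 11)))
      (.cell 4 (.reg 11))) scaleExp).eval s' = X k := by
    simp [RExp.eval, IExp.eval, scaleExp, e10, hp'.dim, hp'.accB, eS, e4, hp'.scale, hr, hX,
      scaledEntry]
  have h6 : ∀ c ≤ k, (if c = k then X k else s'.arr 6 c) = X c := fun c hc => by
    split_ifs with h
    · rw [h]
    · exact i6 c (by omega)
  refine Runs.le (Runs.setR_seq (Runs.setR_seq (Runs.ite (T := 7) (fun hc => Runs.setR_le ?_ ?_)
    (fun hc => Runs.setR_le ?_ ?_)))) (by simp [IExp.cost, RExp.cost, BExp.cost, scaleExp])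
  · rw [hval] at hc ⊢
    simp [BExp.Holds, IExp.eval, RExp.eval, hr] at hc ⊢
    exact ⟨h6, by rw [Finset.sum_range_succ, i7, sq], by
      rw [Finset.sum_range_succ, i8, abs_of_neg hc, sub_eq_add_neg]⟩
  · simp [IExp.cost, RExp.cost]
  · rw [hval] at hc ⊢
    simp [BExp.Holds, IExp.eval, RExp.eval, hr] at hc ⊢
    exact ⟨h6, by rw [Finset.sum_range_succ, i7, sq], by
      rw [Finset.sum_range_succ, i8, abs_of_nonneg hc]⟩
  · simp [IExp.cost, RExp.cost]

theorem runs_newtonProg (hp : Params d a b n N K σ s) :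
    Runs ω newtonProg s ((K + 1) * 23) fun s' =>
      s'.arr 8 0 = newtonSqrt (s.arr 7 0) (s.arr 8 0) K := by
  refine Runs.le (Runs.for (T := 15) K (fun k s' => s'.arr 8 0 =
    newtonSqrt (s.arr 7 0) (s.arr 8 0) k)
    (by simp [Prog.regs]) (fun s' hF => (hF.reg 7 (by simp [Prog.regs])).trans hp.newton)
    (by simp [newtonSqrt]) ?_) (by simp [IExp.cost])
  intro k hk s' hF hr hI
  have e7 : s'.arr 7 = s.arr 7 := hF.arr 7 (by simp [Prog.arrs])
  refine Runs.setR_le ?_ (by simp [IExp.cost, RExp.cost])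
  simp [IExp.eval, RExp.eval, hI, e7, newtonSqrt_succ]

theorem runs_accumProg {A : ℕ} (hA : A ≠ 0 ∧ A ≠ 6 ∧ A ≠ 8) (hp : Params d a b n N K σ s) :
    Runs ω (accumProg A) s ((d + 1) * 30) fun s' =>
      ∀ c < d, s'.arr A c = s.arr A c + s.arr 6 c / ((1 + s.arr 8 0) * n) := by
  refine Runs.mono (Runs.for (T := 22) d (fun k s' =>
    (∀ c < k, s'.arr A c = s.arr A c + s.arr 6 c / ((1 + s.arr 8 0) * n)) ∧
    -- The update is in place, so the entries not yet visited must be known to hold their old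
    -- values.
    ∀ c, k ≤ c → s'.arr A c = s.arr A c)
    (by simp [Prog.regs]) (fun s' hF => (hF.reg 0 (by simp [Prog.regs])).trans hp.dim)
    (by simp) ?_) (by simp [IExp.cost]) fun _ _ h => h.1
  rintro k hk s' hF hr ⟨h1, h2⟩
  have hp' : Params d a b n N K σ s' :=
    hF.params (by simp [Prog.regs]) (by simp [Prog.arrs]; tauto) hp
  have e6 : s'.arr 6 = s.arr 6 := hF.arr 6 (by simp [Prog.arrs]; tauto)
  have e8 : s'.arr 8 = s.arr 8 := hF.arr 8 (by simp [Prog.arrs]; tauto)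
  refine Runs.setR_le ?_ (by simp [IExp.cost, RExp.cost])
  simp only [IExp.eval, RExp.eval, hr, e6, e8, hp'.size, h2 k le_rfl, State.setI_arr,
    State.setR_arr, true_and, Nat.cast_one]
  refine ⟨fun c hc => ?_, fun c hc => ?_⟩
  · split_ifs with h
    · rw [h]
    · exact h1 c (by omega)
  · rw [if_neg (by omega)]
    exact h2 c (by omega)

/-- The value of `newtonProg` on the sample number `j`. -/
noncomputable def scaledNorm (d b K : ℕ) (σ : ℝ) (y u : ℕ → ℝ) (j : ℕ) : ℝ :=
  newtonSqrt (∑ c ∈ Finset.range d, scaledEntry d b σ y u j c ^ 2)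
    (∑ c ∈ Finset.range d, |scaledEntry d b σ y u j c|) K

/-- A single bound `B` for all sizes turns every running time into a monomial in `B`. -/
theorem runs_addClipProg {S A : ℕ} (hS : S ≠ 6 ∧ S ≠ 7 ∧ S ≠ 8)
    (hA : A ≠ 0 ∧ A ≠ 6 ∧ A ≠ 7 ∧ A ≠ 8) (hp : Params d a b n N K σ s)
    (hB : 1 ≤ B) (hdB : d ≤ B) (hKB : K ≤ B) :
    Runs ω (addClipProg S A) s (260 * B) fun s' => ∀ c < d, s'.arr A c = s.arr A c +
      scaledEntry d b σ (s.arr S) (s.arr 4) (s.reg 10) c /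
        ((1 + scaledNorm d b K σ (s.arr S) (s.arr 4) (s.reg 10)) * n) := by
  set s₁ := (s.setR 7 0 0).setR 8 0 0 with hs₁
  have hp₁ : Params d a b n N K σ s₁ := ⟨hp.1, hp.2, hp.3, hp.4, hp.5, hp.6, by
    simpa [hs₁] using hp.7⟩
  have e₁ : ∀ x, x ≠ 7 → x ≠ 8 → s₁.arr x = s.arr x := fun x h7 h8 => by
    funext i; simp [hs₁, h7, h8]
  refine Runs.le (Runs.setR_seq (Runs.setR_seq (T := (d + 1) * 70 + ((K + 1) * 23 + (d + 1) * 30))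
    ?_)) (by simp only [IExp.cost, RExp.cost]; nlinarith)
  have hs : ((s.setR 7 ((IExp.lit 0).eval s) ((RExp.ofNat (.lit 0)).eval s)).setR 8
      ((IExp.lit 0).eval (s.setR 7 ((IExp.lit 0).eval s) ((RExp.ofNat (.lit 0)).eval s)))
      ((RExp.ofNat (.lit 0)).eval (s.setR 7 ((IExp.lit 0).eval s)
        ((RExp.ofNat (.lit 0)).eval s)))) = s₁ := by
    simp [RExp.eval, IExp.eval, hs₁]
  rw [hs]
  refine Runs.seq (runs_loadProg hS hp₁ (by simp [hs₁]) (by simp [hs₁])) ?_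
  rintro s₂ hF₂ ⟨k6, k7, k8⟩
  have hp₂ := hF₂.params (by simp [Prog.regs, loadProg, forLoop])
    (by simp [Prog.arrs, loadProg, forLoop]) hp₁
  refine Runs.seq (runs_newtonProg hp₂) ?_
  intro s₃ hF₃ m8
  have hp₃ := hF₃.params (by simp [Prog.regs, newtonProg, forLoop])
    (by simp [Prog.arrs, newtonProg, forLoop]) hp₂
  refine (runs_accumProg ⟨hA.1, hA.2.1, hA.2.2.2⟩ hp₃).mono le_rfl fun s₄ _ h c hc => ?_
  have r10 : s₁.reg 10 = s.reg 10 := rfl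
  have eA₂ : s₂.arr A = s.arr A := (hF₂.arr A (by
    simp [Prog.arrs, loadProg, forLoop]; tauto)).trans (e₁ A hA.2.2.1 hA.2.2.2)
  have eA₃ : s₃.arr A = s₂.arr A := hF₃.arr A (by simp [Prog.arrs, newtonProg, forLoop]; tauto)
  have e6₃ : s₃.arr 6 = s₂.arr 6 := hF₃.arr 6 (by simp [Prog.arrs, newtonProg, forLoop])
  rw [h c hc, eA₃, eA₂, e6₃, m8, k6 c hc, k7, k8, r10, e₁ S hS.2.1 hS.2.2,
    e₁ 4 (by norm_num) (by norm_num), scaledNorm]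

/-- The vector in the `d` cells from the index `o` on. -/
noncomputable def vec (d : ℕ) (f : ℕ → ℝ) (o : ℕ) : EuclideanSpace ℝ (Fin d) :=
  WithLp.toLp 2 fun c => f (o + c)

theorem vec_apply (f : ℕ → ℝ) (o : ℕ) (c : Fin d) : vec d f o c = f (o + c) := rfl

/-- Links the flat memory layout, sample `j` in the `d` cells from `j * d` on, with vectors. -/
theorem scaledEntry_eq (y u : ℕ → ℝ) (j : ℕ) (c : Fin d) : scaledEntry d b σ y u j c =
    ((1 / (b * σ)) • (vec d y (j * d) - vec d u 0)) c := by
  simp [scaledEntry, vec_apply, div_eq_inv_mul]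

theorem scaledNorm_eq (y u : ℕ → ℝ) (j : ℕ) : scaledNorm d b K σ y u j =
    approxNorm K ((1 / (b * σ)) • (vec d y (j * d) - vec d u 0)) := by
  simp only [scaledNorm, approxNorm, ← scaledEntry_eq, Finset.sum_range]

theorem runs_meanProg {S A : ℕ} (hS : S ≠ 6 ∧ S ≠ 7 ∧ S ≠ 8) (hSA : S ≠ A)
    (hA : A ≠ 0 ∧ A ≠ 4 ∧ A ≠ 6 ∧ A ≠ 7 ∧ A ≠ 8) (hp : Params d a b n N K σ s)
    (hB : 1 ≤ B) (hdB : d ≤ B) (hKB : K ≤ B) (hnB : n ≤ B) :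
    Runs ω (meanProg S A) s (600 * B ^ 2) fun s' => vec d (s'.arr A) 0 =
      approxMean K n (1 / (b * σ)) (fun j => vec d (s.arr S) (j * d)) (vec d (s.arr 4) 0) := by
  refine Runs.le (Runs.seq (T := (d + 1) * (4 + 1 + 7)) (Runs.for (T := 4) d
    (fun k s' => ∀ c < k, s'.arr A c = 0)
    (by simp [Prog.regs]) (fun s' hF => (hF.reg 0 (by simp [Prog.regs])).trans hp.dim)
    (by simp) ?_) (T' := (n + 1) * (260 * B + 1 + 7)) ?_) ?_
  · intro k hk s' hF hr hI
    refine Runs.setR_le ?_ (by simp [IExp.cost, RExp.cost])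
    intro c hc
    simp only [IExp.eval, RExp.eval, hr, State.setI_arr, State.setR_arr, true_and, Nat.cast_zero]
    split_ifs with h
    · rfl
    · exact hI c (by omega)
  · intro s₁ hF₁ h₁
    have hp₁ := hF₁.params (by simp [Prog.regs, forLoop])
      (by simp [Prog.arrs, forLoop]; tauto) hp
    have e4₁ : s₁.arr 4 = s.arr 4 := hF₁.arr 4 (by simp [Prog.arrs, forLoop]; tauto)
    have eS₁ : s₁.arr S = s.arr S := hF₁.arr S (by simp [Prog.arrs, forLoop]; tauto)
    refine Runs.mono (Runs.for (T := 260 * B) n (fun k s' => ∀ c < d, s'.arr A c =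
      ∑ j ∈ Finset.range k, scaledEntry d b σ (s.arr S) (s.arr 4) j c /
        ((1 + scaledNorm d b K σ (s.arr S) (s.arr 4) j) * n))
      (by simp [Prog.regs, addClipProg, loadProg, newtonProg, accumProg, forLoop])
      (fun s' hF => (hF.reg 5 (by
        simp [Prog.regs, addClipProg, loadProg, newtonProg, accumProg, forLoop])).trans hp₁.size)
      (by simpa using h₁) ?_) (by simp [IExp.cost]) ?_
    · intro k hk s' hF hr hI
      have hp' := hF.params
        (by simp [Prog.regs, addClipProg, loadProg, newtonProg, accumProg, forLoop])
        (by simp [Prog.arrs, addClipProg, loadProg, newtonProg, accumProg, forLoop]; tauto) hp₁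
      have e4 : s'.arr 4 = s.arr 4 := (hF.arr 4 (by
        simp [Prog.arrs, addClipProg, loadProg, newtonProg, accumProg, forLoop]; tauto)).trans e4₁
      have eS : s'.arr S = s.arr S := (hF.arr S (by
        simp [Prog.arrs, addClipProg, loadProg, newtonProg, accumProg, forLoop]; tauto)).trans eS₁
      refine (runs_addClipProg hS ⟨hA.1, hA.2.2⟩ hp' hB hdB hKB).mono le_rfl fun s'' _ h c hc => ?_
      rw [State.setI_arr, h c hc, hI c hc, Finset.sum_range_succ, hr, e4, eS]
    · intro s₂ _ h₂
      ext c
      rw [vec_apply, zero_add, h₂ c c.2]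
      simp only [approxMean, approxClip, PiLp.smul_apply, WithLp.ofLp_sum, Finset.sum_apply,
        smul_eq_mul, Finset.mul_sum]
      refine Finset.sum_congr rfl fun j _ => ?_
      rw [scaledNorm_eq, scaledEntry_eq, PiLp.smul_apply, smul_eq_mul, div_eq_mul_inv, mul_inv]
      ring
  · nlinarith

end RealRAM

/-! ### The descent program -/

namespace RealRAM

/-- Copy `d` cells of the array `S`, from the index `o` on, to the array `A`. -/
def copyProg (A S : ℕ) (o : IExp) : Prog :=
  forLoop 11 (.reg 0) (.setR A (.reg 11) (.cell S (.add o (.reg 11))))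

/-- Subtract the array `12` from the array `5`, and compute the square of its norm. -/
def residualProg : Prog := forLoop 11 (.reg 0) <|
  .seq (.setR 5 (.reg 11) (.sub (.cell 5 (.reg 11)) (.cell 12 (.reg 11)))) <|
  .setR 9 (.lit 0) (.add (.cell 9 (.lit 0)) (.mul (.cell 5 (.reg 11)) (.cell 5 (.reg 11))))

/-- Move the candidate along the residual. -/
def moveProg : Prog := forLoop 11 (.reg 0)
  (.setR 4 (.reg 11) (.add (.cell 4 (.reg 11)) (.mul scaleExp (.cell 5 (.reg 11)))))

/-- The expression for `(a * b ^ 2) ^ 2`. -/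
def thresholdExp : IExp :=
  .mul (.mul (.reg 1) (.mul (.reg 2) (.reg 2))) (.mul (.reg 1) (.mul (.reg 2) (.reg 2)))

/-- One step of the descent; the candidate is copied to the output if its residual is small. -/
def stepProg : Prog :=
  .seq (meanProg 3 5) <| .seq (.setR 9 (.lit 0) (.ofNat (.lit 0))) <| .seq residualProg <|
  .seq (.ite (.ltR (.ofNat (.lit 1)) (.mul (.cell 9 (.lit 0)) (.ofNat thresholdExp)))
    .skip (copyProg 1 4 (.lit 0))) moveProg

/-- Descent from the sample number `i` of the second source, for all `i`. -/
def searchProg : Prog := forLoop 8 (.reg 5) <|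
  .seq (copyProg 4 3 (.mul (.reg 8) (.reg 0))) (forLoop 9 (.reg 6) stepProg)

variable {d a b n N K B : ℕ} {σ : ℝ} {s : State} {ω : Tape d}

theorem runs_copyProg {A S o₀ : ℕ} {o : IExp} (hSA : S ≠ A)
    (ho : ∀ s', Frame [11] [A] s s' → o.eval s' = o₀) (hc : o.cost ≤ 3) (h0 : s.reg 0 = d) :
    Runs ω (copyProg A S o) s ((d + 1) * 20) fun s' => vec d (s'.arr A) 0 = vec d (s.arr S) o₀ := by
  refine Runs.mono (Runs.for (T := 12) d (fun k s' => ∀ c < k, s'.arr A c = s.arr S (o₀ + c))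
    (by simp [Prog.regs]) (fun s' hF => (hF.reg 0 (by simp [Prog.regs])).trans h0)
    (by simp) ?_) (by simp [IExp.cost]) fun s' _ h => ?_
  · intro k hk s' hF hr hI
    have eS : s'.arr S = s.arr S := hF.arr S (by simpa [Prog.arrs] using hSA)
    refine Runs.setR_le ?_ (by simp only [IExp.cost, RExp.cost]; omega)
    intro c hc
    simp only [IExp.eval, RExp.eval, hr, State.setI_arr, State.setR_arr, true_and, eS,
      ho s' (by simpa [Prog.regs, Prog.arrs] using hF)]
    split_ifs with h
    · rw [h]
    · exact hI c (by omega)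
  · ext c
    rw [vec_apply, vec_apply, zero_add, h c c.2]

theorem runs_residualProg (h0 : s.reg 0 = d) (h9 : s.arr 9 0 = 0) :
    Runs ω residualProg s ((d + 1) * 30) fun s' =>
      vec d (s'.arr 5) 0 = vec d (s.arr 5) 0 - vec d (s.arr 12) 0 ∧
      s'.arr 9 0 = ‖vec d (s.arr 5) 0 - vec d (s.arr 12) 0‖ ^ 2 := by
  refine Runs.mono (Runs.for (T := 22) d (fun k s' =>
    (∀ c < k, s'.arr 5 c = s.arr 5 c - s.arr 12 c) ∧ (∀ c, k ≤ c → s'.arr 5 c = s.arr 5 c) ∧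
    s'.arr 9 0 = ∑ c ∈ Finset.range k, (s.arr 5 c - s.arr 12 c) ^ 2)
    (by simp [Prog.regs]) (fun s' hF => (hF.reg 0 (by simp [Prog.regs])).trans h0)
    (by simp [h9]) ?_) (by simp [IExp.cost]) fun s' _ h => ?_
  · rintro k hk s' hF hr ⟨h1, h2, h3⟩
    have e12 : s'.arr 12 = s.arr 12 := hF.arr 12 (by simp [Prog.arrs])
    refine Runs.le (Runs.setR_seq (Runs.setR_le (T := 11) ?_ (by simp [IExp.cost, RExp.cost])))
      (by simp [IExp.cost, RExp.cost])
    simp only [IExp.eval, RExp.eval, hr, State.setI_arr, State.setR_arr, true_and, e12,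
      h2 k le_rfl, h3, State.setR_reg, Finset.sum_range_succ]
    refine ⟨fun c hc => ?_, fun c hc => ?_, ?_⟩
    · simp only [Nat.reduceEqDiff, false_and, if_false]
      split_ifs with h
      · rw [h]
      · exact h1 c (by omega)
    · simp only [Nat.reduceEqDiff, false_and, if_false]
      rw [if_neg (by omega)]
      exact h2 c (by omega)
    · simp [sq]
  · obtain ⟨h1, -, h3⟩ := h
    refine ⟨?_, ?_⟩
    · ext c
      rw [PiLp.sub_apply, vec_apply, vec_apply, vec_apply, zero_add, h1 c c.2]
    · rw [h3, EuclideanSpace.norm_sq_eq, Finset.sum_range]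
      simp [vec_apply]

theorem runs_moveProg (hp : Params d a b n N K σ s) :
    Runs ω moveProg s ((d + 1) * 30) fun s' =>
      vec d (s'.arr 4) 0 = vec d (s.arr 4) 0 + ((b : ℝ) * σ) • vec d (s.arr 5) 0 := by
  refine Runs.mono (Runs.for (T := 22) d (fun k s' =>
    (∀ c < k, s'.arr 4 c = s.arr 4 c + b * σ * s.arr 5 c) ∧
    (∀ c, k ≤ c → s'.arr 4 c = s.arr 4 c))
    (by simp [Prog.regs]) (fun s' hF => (hF.reg 0 (by simp [Prog.regs])).trans hp.dim)
    (by simp) ?_) (by simp [IExp.cost]) fun s' _ h => ?_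
  · rintro k hk s' hF hr ⟨h1, h2⟩
    have hp' := hF.params (by simp [Prog.regs]) (by simp [Prog.arrs]) hp
    have e5 : s'.arr 5 = s.arr 5 := hF.arr 5 (by simp [Prog.arrs])
    refine Runs.setR_le ?_ (by simp [IExp.cost, RExp.cost, scaleExp])
    simp only [IExp.eval, RExp.eval, scaleExp, hr, State.setI_arr, State.setR_arr, true_and, e5,
      h2 k le_rfl, hp'.accB, hp'.scale]
    refine ⟨fun c hc => ?_, fun c hc => ?_⟩
    · split_ifs with h
      · rw [h]
      · exact h1 c (by omega)
    · rw [if_neg (by omega)]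
      exact h2 c (by omega)
  · ext c
    rw [PiLp.add_apply, PiLp.smul_apply, vec_apply, vec_apply, vec_apply, zero_add, h.1 c c.2,
      smul_eq_mul]

/-- The test compares squares, so no root is taken, and the candidate is tested before it moves. The
move has length `b * σ = 1 / r` times the residual. -/
theorem runs_stepProg (hp : Params d a b n N K σ s)
    (hB : 1 ≤ B) (hdB : d ≤ B) (hKB : K ≤ B) (hnB : n ≤ B)
    {u g : EuclideanSpace ℝ (Fin d)} (hu : vec d (s.arr 4) 0 = u)
    (hg : approxMean K n (1 / (b * σ)) (fun j => vec d (s.arr 3) (j * d)) u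
      - vec d (s.arr 12) 0 = g) :
    Runs ω stepProg s (900 * B ^ 2) fun s' =>
      vec d (s'.arr 4) 0 = u + ((b : ℝ) * σ) • g ∧
      vec d (s'.arr 1) 0 =
        if 1 < ‖g‖ ^ 2 * ((a : ℝ) * b ^ 2) ^ 2 then vec d (s.arr 1) 0 else u := by
  refine Runs.le (Runs.seq (runs_meanProg (by norm_num) (by norm_num) (by norm_num) hp
    hB hdB hKB hnB) (T' := 5 + ((d + 1) * 30 + (((d + 1) * 20 + 22) + (d + 1) * 30))) ?_)
    (by nlinarith)
  intro s₁ hF₁ h₁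
  have hp₁ := hF₁.params
    (by simp [Prog.regs, meanProg, addClipProg, loadProg, newtonProg, accumProg, forLoop])
    (by simp [Prog.arrs, meanProg, addClipProg, loadProg, newtonProg, accumProg, forLoop]) hp
  have k : ∀ x, x ≠ 5 → x ≠ 6 → x ≠ 7 → x ≠ 8 → s₁.arr x = s.arr x := fun x _ _ _ _ =>
    hF₁.arr x (by
      simp [Prog.arrs, meanProg, addClipProg, loadProg, newtonProg, accumProg, forLoop]; tauto)
  refine Runs.le (Runs.setR_seq (T := (d + 1) * 30 + (((d + 1) * 20 + 22) + (d + 1) * 30)) ?_)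
    (by simp only [IExp.cost, RExp.cost]; omega)
  set s₂ := s₁.setR 9 ((IExp.lit 0).eval s₁) ((RExp.ofNat (.lit 0)).eval s₁) with hs₂
  have e₂ : ∀ x, x ≠ 9 → s₂.arr x = s₁.arr x := fun x h => by
    funext i; simp [hs₂, h]
  have hp₂ : Params d a b n N K σ s₂ := ⟨hp₁.1, hp₁.2, hp₁.3, hp₁.4, hp₁.5, hp₁.6, by
    rw [e₂ 0 (by norm_num)]; exact hp₁.7⟩
  refine Runs.seq (runs_residualProg hp₂.dim (by simp [hs₂, IExp.eval, RExp.eval])) ?_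
  rintro s₃ hF₃ ⟨h5, h9⟩
  have hp₃ := hF₃.params (by simp [Prog.regs, residualProg, forLoop])
    (by simp [Prog.arrs, residualProg, forLoop]) hp₂
  have k₃ : ∀ x, x ≠ 5 → x ≠ 6 → x ≠ 7 → x ≠ 8 → x ≠ 9 → s₃.arr x = s.arr x :=
    fun x h5 h6 h7 h8 h9 => (hF₃.arr x (by
      simp [Prog.arrs, residualProg, forLoop]; tauto)).trans ((e₂ x h9).trans (k x h5 h6 h7 h8))
  have hgv : vec d (s₂.arr 5) 0 - vec d (s₂.arr 12) 0 = g := by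
    rw [e₂ 5 (by norm_num), e₂ 12 (by norm_num), k 12 (by norm_num) (by norm_num) (by norm_num)
      (by norm_num), h₁, hu, hg]
  rw [hgv] at h5 h9
  have e4 : s₃.arr 4 = s.arr 4 :=
    k₃ 4 (by norm_num) (by norm_num) (by norm_num) (by norm_num) (by norm_num)
  have e1 : s₃.arr 1 = s.arr 1 :=
    k₃ 1 (by norm_num) (by norm_num) (by norm_num) (by norm_num) (by norm_num)
  have htest : (BExp.ltR (.ofNat (.lit 1)) (.mul (.cell 9 (.lit 0)) (.ofNat thresholdExp))).Holds s₃
      ↔ 1 < ‖g‖ ^ 2 * ((a : ℝ) * b ^ 2) ^ 2 := by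
    simp only [BExp.Holds, RExp.eval, IExp.eval, thresholdExp, h9, hp₃.accA, hp₃.accB]
    push_cast
    rw [sq ((a : ℝ) * b ^ 2), sq (b : ℝ)]
  have hite : Runs ω (.ite (.ltR (.ofNat (.lit 1)) (.mul (.cell 9 (.lit 0)) (.ofNat thresholdExp)))
      .skip (copyProg 1 4 (.lit 0))) s₃ ((d + 1) * 20 + 22) fun s' => vec d (s'.arr 1) 0 =
        if 1 < ‖g‖ ^ 2 * ((a : ℝ) * b ^ 2) ^ 2 then vec d (s.arr 1) 0 else u := by
    refine Runs.le (Runs.ite (T := (d + 1) * 20) (fun hc => Runs.le (Runs.skip ?_) (by omega))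
      (fun hc => (runs_copyProg (o₀ := 0) (by norm_num) (fun _ _ => rfl) (by simp [IExp.cost])
        hp₃.dim).mono le_rfl fun s' _ h => ?_))
      (by simp only [BExp.cost, RExp.cost, IExp.cost, thresholdExp]; omega)
    · rw [if_pos (htest.1 hc), e1]
    · rw [if_neg (fun hc' => hc (htest.2 hc')), h, e4, hu]
  refine Runs.seq hite fun s₄ hF₄ h₄ => ?_
  have hp₄ := hF₄.params (by simp [Prog.regs, copyProg, forLoop])
    (by simp [Prog.arrs, copyProg, forLoop]) hp₃
  refine (runs_moveProg hp₄).mono le_rfl fun s₅ hF₅ h => ⟨?_, ?_⟩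
  · rw [h, hF₄.arr 4 (by simp [Prog.arrs, copyProg, forLoop]), e4, hu,
      hF₄.arr 5 (by simp [Prog.arrs, copyProg, forLoop]), h5]
  · rw [hF₅.arr 1 (by simp [Prog.arrs, moveProg, forLoop]), h₄]

/-- If descent from some sample meets a point with small residual, then the output is such a
point. -/
theorem runs_searchProg (ha : 0 < a) (hb : 0 < b) (hp : Params d a b n N K σ s)
    (hB : 1 ≤ B) (hdB : d ≤ B) (hKB : K ≤ B) (hnB : n ≤ B) (hNB : N ≤ B)
    {y₁ y₂ : ℕ → EuclideanSpace ℝ (Fin d)}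
    (hy₁ : vec d (s.arr 12) 0 = approxMean K n (1 / (b * σ)) y₁ 0)
    (hy₂ : ∀ i < n, vec d (s.arr 3) (i * d) = y₂ i) :
    Runs ω searchProg s (4000 * B ^ 4) fun s' =>
      (∃ i < n, ∃ k < N, ‖clipResidual K n (1 / (b * σ)) y₁ y₂
        (clipDescent K n (1 / (b * σ)) y₁ y₂ (y₂ i) k)‖ ≤ 1 / (a * b ^ 2)) →
      ‖clipResidual K n (1 / (b * σ)) y₁ y₂ (output d s')‖ ≤ 1 / (a * b ^ 2) := by
  set r := 1 / ((b : ℝ) * σ) with hr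
  set R := clipResidual K n r y₁ y₂ with hR
  set U := clipDescent K n r y₁ y₂ with hU
  set τ := 1 / ((a : ℝ) * b ^ 2) with hτ
  have hout : ∀ s' : State, output d s' = vec d (s'.arr 1) 0 := fun s' => by
    ext c; simp [output, vec_apply]
  have hstep : ∀ s', s'.arr 3 = s.arr 3 → s'.arr 12 = s.arr 12 → Params d a b n N K σ s' →
      Runs ω stepProg s' (900 * B ^ 2) fun s'' =>
      vec d (s''.arr 4) 0 = vec d (s'.arr 4) 0 + ((b : ℝ) * σ) • R (vec d (s'.arr 4) 0) ∧
      vec d (s''.arr 1) 0 = if 1 < ‖R (vec d (s'.arr 4) 0)‖ ^ 2 * ((a : ℝ) * b ^ 2) ^ 2 then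
        vec d (s'.arr 1) 0 else vec d (s'.arr 4) 0 := by
    intro s' e3 e12 hp'
    refine runs_stepProg hp' hB hdB hKB hnB rfl ?_
    rw [e12, hy₁, e3, hR, clipResidual, approxMean, approxMean, ← hr]
    congr 2
    refine Finset.sum_congr rfl fun j hj => ?_
    rw [hy₂ j (Finset.mem_range.1 hj)]
  have htest : ∀ g : EuclideanSpace ℝ (Fin d),
      1 < ‖g‖ ^ 2 * ((a : ℝ) * b ^ 2) ^ 2 ↔ ¬ ‖g‖ ≤ τ := by
    intro g
    have hpos : 0 < (a : ℝ) * b ^ 2 := by positivity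
    rw [hτ, le_div_iff₀ hpos, not_le, ← mul_pow, one_lt_sq_iff₀ (by positivity)]
  -- Once some visited point has passed the test, the output has small residual for good: it is
  -- overwritten only by points that pass too.
  refine Runs.mono (Runs.for (T := (d + 1) * 20 + (N + 1) * (900 * B ^ 2 + 1 + 7)) n (fun i s' =>
    (∃ i' < i, ∃ k < N, ‖R (U (y₂ i') k)‖ ≤ τ) → ‖R (vec d (s'.arr 1) 0)‖ ≤ τ)
    (by simp [Prog.regs, stepProg, residualProg, copyProg, moveProg, meanProg, addClipProg,
      loadProg, newtonProg, accumProg, forLoop])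
    (fun s' hF => (hF.reg 5 (by simp [Prog.regs, stepProg, residualProg, copyProg, moveProg,
      meanProg, addClipProg, loadProg, newtonProg, accumProg, forLoop])).trans hp.size)
    (by simp) ?_) ?_ (fun s' _ h => by rw [hout]; exact h)
  · intro i hi s' hF hri hI
    have hp' := hF.params (by simp [Prog.regs, stepProg, residualProg, copyProg, moveProg,
      meanProg, addClipProg, loadProg, newtonProg, accumProg, forLoop])
      (by simp [Prog.arrs, stepProg, residualProg, copyProg, moveProg,
        meanProg, addClipProg, loadProg, newtonProg, accumProg, forLoop]) hp
    have e3 : s'.arr 3 = s.arr 3 := hF.arr 3 (by simp [Prog.arrs, stepProg, residualProg,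
      copyProg, moveProg, meanProg, addClipProg, loadProg, newtonProg, accumProg, forLoop])
    have e12 : s'.arr 12 = s.arr 12 := hF.arr 12 (by simp [Prog.arrs, stepProg, residualProg,
      copyProg, moveProg, meanProg, addClipProg, loadProg, newtonProg, accumProg, forLoop])
    refine Runs.seq (runs_copyProg (o₀ := i * d) (by norm_num) (fun s'' hF' => ?_)
      (by simp [IExp.cost]) hp'.dim) ?_
    · simp only [IExp.eval]
      rw [hF'.reg 8 (by simp), hF'.reg 0 (by simp), hri, hp'.dim]
    intro s₁ hF₁ h₁
    have hp₁ := hF₁.params (by simp [Prog.regs, copyProg, forLoop])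
      (by simp [Prog.arrs, copyProg, forLoop]) hp'
    have e3₁ : s₁.arr 3 = s.arr 3 :=
      (hF₁.arr 3 (by simp [Prog.arrs, copyProg, forLoop])).trans e3
    have e12₁ : s₁.arr 12 = s.arr 12 :=
      (hF₁.arr 12 (by simp [Prog.arrs, copyProg, forLoop])).trans e12
    have e1₁ : s₁.arr 1 = s'.arr 1 := hF₁.arr 1 (by simp [Prog.arrs, copyProg, forLoop])
    rw [e3, hy₂ i hi] at h₁
    refine Runs.mono (Runs.for (T := 900 * B ^ 2) N (fun k s₂ =>
      vec d (s₂.arr 4) 0 = U (y₂ i) k ∧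
      (((∃ i' < i, ∃ k < N, ‖R (U (y₂ i') k)‖ ≤ τ) ∨ ∃ k' < k, ‖R (U (y₂ i) k')‖ ≤ τ) →
        ‖R (vec d (s₂.arr 1) 0)‖ ≤ τ))
      (by simp [Prog.regs, stepProg, residualProg, copyProg, moveProg, meanProg, addClipProg,
        loadProg, newtonProg, accumProg, forLoop])
      (fun s' hF => (hF.reg 6 (by simp [Prog.regs, stepProg, residualProg, copyProg, moveProg,
        meanProg, addClipProg, loadProg, newtonProg, accumProg, forLoop])).trans hp₁.steps)
      ⟨h₁, ?_⟩ ?_) (by simp [IExp.cost]) ?_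
    · rintro (h | ⟨k', hk', -⟩)
      · rw [State.setI_arr, e1₁]; exact hI h
      · omega
    · rintro k hk s₂ hF₂ hrk ⟨h4, h1⟩
      have hp₂ := hF₂.params (by simp [Prog.regs, stepProg, residualProg, copyProg, moveProg,
        meanProg, addClipProg, loadProg, newtonProg, accumProg, forLoop])
        (by simp [Prog.arrs, stepProg, residualProg, copyProg, moveProg,
          meanProg, addClipProg, loadProg, newtonProg, accumProg, forLoop]) hp₁
      refine (hstep s₂ ((hF₂.arr 3 (by simp [Prog.arrs, stepProg, residualProg,
        copyProg, moveProg, meanProg, addClipProg, loadProg, newtonProg, accumProg,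
        forLoop])).trans e3₁) ((hF₂.arr 12 (by simp [Prog.arrs, stepProg, residualProg,
        copyProg, moveProg, meanProg, addClipProg, loadProg, newtonProg, accumProg,
        forLoop])).trans e12₁) hp₂).mono le_rfl ?_
      rintro s₃ - ⟨q4, q1⟩
      rw [h4] at q4 q1
      rw [State.setI_arr]
      refine ⟨?_, ?_⟩
      · rw [q4, hU, clipDescent, ← hU, ← hR, hr, one_div_one_div]
      · intro hor
        rw [q1]
        split_ifs with hlt
        · rcases hor with h | ⟨k', hk', h⟩
          · exact h1 (Or.inl h)
          · rcases Nat.lt_succ_iff_lt_or_eq.1 hk' with h' | h'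
            · exact h1 (Or.inr ⟨k', h', h⟩)
            · subst h'
              exact absurd h ((htest _).1 hlt)
        · exact not_not.1 fun hcon => hlt ((htest _).2 hcon)
    · rintro s₂ - ⟨-, h⟩ ⟨i', hi', k, hk, hle⟩
      rw [State.setI_arr]
      refine h ?_
      rcases Nat.lt_succ_iff_lt_or_eq.1 hi' with h' | h'
      · exact Or.inl ⟨i', h', k, hk, hle⟩
      · subst h'
        exact Or.inr ⟨k, hk, hle⟩
  · simp only [IExp.cost]
    have h1 : (d + 1) * 20 + (N + 1) * (900 * B ^ 2 + 1 + 7) ≤ 1900 * B ^ 3 := by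
      have : (N + 1) * (900 * B ^ 2 + 1 + 7) ≤ (2 * B) * (908 * B ^ 2) := by
        gcongr <;> nlinarith
      have h2 : d + 1 ≤ 2 * B ^ 3 := by nlinarith [Nat.one_le_pow 2 B hB, sq_nonneg B]
      nlinarith
    have h3 : 1 ≤ B ^ 3 := Nat.one_le_pow _ _ hB
    calc (n + 1) * ((d + 1) * 20 + (N + 1) * (900 * B ^ 2 + 1 + 7) + 1 + 7)
        ≤ (2 * B) * (1908 * B ^ 3) := by gcongr <;> omega
      _ ≤ _ := by nlinarith [pow_succ B 3, Nat.zero_le (B ^ 4)]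

end RealRAM

/-! ### The complete program -/

namespace RealRAM

/-- Compute the least natural number `k` with `1 ≤ k * p` in the register `x`, where `p` is the
input parameter number `i`. -/
def invProg (x i : ℕ) : Prog :=
  .seq (.setI x (.lit 0)) <| .while (.ltR (.mul (.ofNat (.reg x)) (.cell 0 (.lit i)))
    (.ofNat (.lit 1))) (.setI x (.add (.reg x) (.lit 1)))

/-- Compute the least natural number `k` with `1 ≤ 2 ^ k * δ` in the register `3`. -/
def logProg : Prog :=
  .seq (.setI 3 (.lit 0)) <| .seq (.setI 4 (.lit 1)) <|
  .while (.ltR (.mul (.ofNat (.reg 4)) (.cell 0 (.lit 2))) (.ofNat (.lit 1)))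
    (.seq (.setI 4 (.add (.reg 4) (.reg 4))) (.setI 3 (.add (.reg 3) (.lit 1))))

/-- Draw the samples. -/
def drawProg : Prog := forLoop 10 (.reg 5) <|
  .seq (.draw 0 2 (.mul (.reg 10) (.reg 0))) (.draw 1 3 (.mul (.reg 10) (.reg 0)))

/-- The expression for `24 * a ^ 2 * b ^ 4 * (L + 3)`. -/
def sizeExp : IExp :=
  .mul (.mul (.mul (.mul (.mul (.mul (.mul (.lit 24) (.reg 1)) (.reg 1)) (.reg 2)) (.reg 2))
    (.reg 2)) (.reg 2)) (.add (.reg 3) (.lit 3))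

/-- The expression for `96 * a ^ 2 * b ^ 2 + 1`. -/
def stepsExp : IExp :=
  .add (.mul (.mul (.mul (.mul (.lit 96) (.reg 1)) (.reg 1)) (.reg 2)) (.reg 2)) (.lit 1)

/-- The expression for `256 * a ^ 2 * b ^ 2 * d`. -/
def newtonExp : IExp :=
  .mul (.mul (.mul (.mul (.mul (.lit 256) (.reg 1)) (.reg 1)) (.reg 2)) (.reg 2)) (.reg 0)

/-- The algorithm for noisy location estimation. -/
def locationProg : Prog :=
  .seq (invProg 1 0) <| .seq (invProg 2 1) <| .seq (.setI 2 (.mul (.lit 64) (.reg 2))) <|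
  .seq logProg <| .seq (.setI 5 sizeExp) <| .seq (.setI 6 stepsExp) <| .seq (.setI 7 newtonExp) <|
  .seq drawProg <| .seq (meanProg 2 12) searchProg

variable {d : ℕ} {s : State} {ω : Tape d}

/-- There is no rounding operation, so the ceiling is found by counting, in time proportional to `1
/ p`. -/
theorem runs_invProg {x i : ℕ} {p : ℝ} (hp : 0 < p) (h : s.arr 0 i = p) :
    Runs ω (invProg x i) s (20 * (⌈1 / p⌉₊ + 1)) fun s' => s'.reg x = ⌈1 / p⌉₊ := by
  refine Runs.mono (Runs.setI_seq (Runs.while (T := 4) ⌈1 / p⌉₊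
    (fun k s' => s'.reg x = k ∧ s'.arr 0 i = p) ?_ ?_ (by simp [IExp.eval, h])))
    (by simp only [IExp.cost, RExp.cost, BExp.cost]; omega) fun s' _ h => h.1
  · rintro k hk s' ⟨hr, ha⟩
    refine ⟨?_, Runs.setI (e := .add (.reg x) (.lit 1)) ?_⟩
    · have := Nat.lt_ceil.1 hk
      rw [lt_div_iff₀ hp] at this
      simpa [BExp.Holds, RExp.eval, IExp.eval, hr, ha] using this
    · simp [IExp.eval, hr, ha]
  · rintro s' ⟨hr, ha⟩
    have := Nat.le_ceil (1 / p)
    rw [div_le_iff₀ hp] at this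
    simpa [BExp.Holds, RExp.eval, IExp.eval, hr, ha] using this

/-- The least natural number `k` with `1 ≤ 2 ^ k * δ`. -/
noncomputable def logCeil (δ : ℝ) : ℕ := ⌈Real.logb 2 (1 / δ)⌉₊

theorem lt_logCeil_iff {δ : ℝ} (hδ : 0 < δ) {k : ℕ} : k < logCeil δ ↔ 2 ^ k * δ < 1 := by
  rw [logCeil, Nat.lt_ceil, Real.lt_logb_iff_rpow_lt (by norm_num) (by positivity),
    Real.rpow_natCast, lt_div_iff₀ hδ]

/-- Register `4` holds `2 ^ k`, obtained by doubling, so the ceiling of the logarithm is found by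
comparisons alone. -/
theorem runs_logProg {δ : ℝ} (hδ : 0 < δ) (h : s.arr 0 2 = δ) :
    Runs ω logProg s (30 * (logCeil δ + 1)) fun s' => s'.reg 3 = logCeil δ := by
  refine Runs.mono (Runs.setI_seq (Runs.setI_seq (Runs.while (T := 8) (logCeil δ)
    (fun k s' => s'.reg 3 = k ∧ s'.reg 4 = 2 ^ k ∧ s'.arr 0 2 = δ) ?_ ?_
    (by simp [IExp.eval, h]))))
    (by simp only [IExp.cost, RExp.cost, BExp.cost]; omega) fun s' _ h => h.1
  · rintro k hk s' ⟨h3, h4, ha⟩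
    refine ⟨?_, Runs.setI_seq (T := 4) (Runs.setI (e := .add (.reg 3) (.lit 1)) ?_)⟩
    · have := (lt_logCeil_iff hδ).1 hk
      simpa [BExp.Holds, RExp.eval, IExp.eval, h4, ha] using this
    · simp [IExp.eval, h3, h4, ha, pow_succ, mul_two]
  · rintro s' ⟨h3, h4, ha⟩
    have := fun hc => lt_irrefl _ ((lt_logCeil_iff hδ (k := logCeil δ)).2 hc)
    simpa [BExp.Holds, RExp.eval, IExp.eval, h4, ha] using this

theorem vec_draw_self (b : Fin 2) (A i : ℕ) :
    vec d ((s.draw ω b A i).arr A) i = ω.sample b (s.drawn b) := by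
  ext c
  simp [vec_apply, State.draw]

/-- Samples occupy disjoint consecutive blocks, so a later draw leaves the earlier ones intact. -/
theorem vec_draw_of_le (b : Fin 2) (A i o : ℕ) (h : o + d ≤ i) :
    vec d ((s.draw ω b A i).arr A) o = vec d (s.arr A) o := by
  ext c
  have : ¬ (i ≤ o + c ∧ o + c - i < d) := by omega
  simp [vec_apply, State.draw, this]

theorem draw_arr_of_ne (b : Fin 2) {A A' : ℕ} (i : ℕ) (h : A' ≠ A) :
    (s.draw ω b A i).arr A' = s.arr A' := by
  funext j; simp [State.draw, h]

theorem runs_drawProg {n : ℕ} (h0 : s.reg 0 = d) (h5 : s.reg 5 = n) (hd : s.drawn = fun _ => 0) :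
    Runs ω drawProg s ((n + 1) * (2 * d + 20)) fun s' => (∀ b, s'.drawn b = n) ∧
      (∀ j < n, vec d (s'.arr 2) (j * d) = ω.2.1 j) ∧
      ∀ j < n, vec d (s'.arr 3) (j * d) = ω.2.2 j := by
  refine Runs.le (Runs.for (T := 2 * d + 8) n (fun k s' => (∀ b, s'.drawn b = k) ∧
      (∀ j < k, vec d (s'.arr 2) (j * d) = ω.2.1 j) ∧
      ∀ j < k, vec d (s'.arr 3) (j * d) = ω.2.2 j)
    (by simp [Prog.regs]) (fun s' hF => (hF.reg 5 (by simp [Prog.regs])).trans h5)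
    (by simp [hd]) ?_) (Nat.mul_le_mul_left _ (by simp only [IExp.cost]; omega))
  rintro k hk s' hF hr ⟨hdr, h2, h3⟩
  have e0 : s'.reg 0 = d := (hF.reg 0 (by simp [Prog.regs])).trans h0
  refine Runs.le (Runs.seq (Runs.draw (Q := fun s₁ => s₁ = s'.draw ω 0 2 (k * d)) ?_)
    (T' := d + 4) fun s₁ _ h₁ => Runs.draw_le ?_ (by simp only [IExp.cost]; omega)) (by simp only [IExp.cost]; omega)
  · simp [IExp.eval, hr, e0]
  · subst h₁
    have hi : (IExp.mul (.reg 10) (.reg 0)).eval (s'.draw ω 0 2 (k * d)) = k * d := by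
      simp [IExp.eval, State.draw, hr, e0]
    have hlt : ∀ j < k, j * d + d ≤ k * d := fun j hj => by
      rw [← Nat.succ_mul]; exact Nat.mul_le_mul_right d hj
    rw [hi]
    refine ⟨fun b => ?_, fun j hj => ?_, fun j hj => ?_⟩
    · fin_cases b <;> simp [State.draw, hdr]
    · rw [State.setI_arr, draw_arr_of_ne _ _ (by norm_num)]
      rcases Nat.lt_succ_iff_lt_or_eq.1 hj with h | h
      · rw [vec_draw_of_le _ _ _ _ (hlt j h), h2 j h]
      · rw [h, vec_draw_self, hdr]; simp [Tape.sample]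
    · rw [State.setI_arr]
      rcases Nat.lt_succ_iff_lt_or_eq.1 hj with h | h
      · rw [vec_draw_of_le _ _ _ _ (hlt j h), draw_arr_of_ne _ _ (by norm_num), h3 j h]
      · rw [h, vec_draw_self]; simp [Tape.sample, State.draw, hdr]

/-- The number of samples that the algorithm draws from each source. -/
def sampleSize (a b L : ℕ) : ℕ := 24 * a * a * b * b * b * b * (L + 3)

theorem locationProg_cost_le {a b d L n B : ℕ} (hB : 1 ≤ B) (ha : a ≤ B) (hb : b ≤ B) (hd : d ≤ B)
    (hL : L ≤ B) (hn : n ≤ B) :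
    20 * (a + 1) + (20 * (b + 1) + (4 + (30 * (L + 1) + (20 + (20 + (20 + ((n + 1) * (2 * d + 20) +
      (600 * B ^ 2 + 4000 * B ^ 4)))))))) ≤ 5000 * B ^ 4 := by
  have h2 : B ≤ B ^ 2 := by nlinarith
  have h4 : B ^ 2 ≤ B ^ 4 := Nat.pow_le_pow_right hB (by norm_num)
  have h5 : (n + 1) * (2 * d + 20) ≤ (2 * B) * (22 * B) := Nat.mul_le_mul (by omega) (by omega)
  have h6 : (2 * B) * (22 * B) = 44 * B ^ 2 := by ring
  omega

theorem runs_locationProg {α η δ σ : ℝ} (hα : 0 < α) (hη : 0 < η) (hδ : 0 < δ) {a b L n K : ℕ}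
    (hd : 0 < d) (ha : a = ⌈1 / α⌉₊) (hb : b = 64 * ⌈1 / η⌉₊) (hL : L = logCeil δ)
    (hn : n = sampleSize a b L) (hK : K = 256 * a * a * b * b * d) :
    Runs ω locationProg (input d α η δ σ) (5000 * (256 * (d + a + b + L + 3) ^ 7) ^ 4) fun s =>
      (∀ b, s.drawn b = n) ∧ ((∃ i < n, ‖clipResidual K n (1 / (b * σ)) ω.2.1 ω.2.2
        (clipDescent K n (1 / (b * σ)) ω.2.1 ω.2.2 (ω.2.2 i) (96 * a * a * b * b))‖
          ≤ 1 / (a * b ^ 2)) →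
      ‖clipResidual K n (1 / (b * σ)) ω.2.1 ω.2.2 (output d s)‖ ≤ 1 / (a * b ^ 2)) := by
  set M := d + a + b + L + 3 with hM
  -- The exponent `7` is the degree of `sampleSize` in `a`, `b` and `L`; the factor `256` comes from
  -- the number of Newton steps.
  set B := 256 * M ^ 7 with hBd
  have hM1 : 1 ≤ M := by omega
  have hMB : M ≤ B := by
    calc M = 1 * M ^ 1 := by ring
      _ ≤ 256 * M ^ 7 := by gcongr <;> omega
  have hB : 1 ≤ B := hM1.trans hMB
  have ha0 : 0 < a := by rw [ha, Nat.ceil_pos]; positivity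
  have hb0 : 0 < b := by
    have : 0 < ⌈1 / η⌉₊ := by rw [Nat.ceil_pos]; positivity
    omega
  -- The points with index below `N` are tested, so the extra `1` includes the point after `96 * a *
  -- a * b * b` moves.
  set N := 96 * a * a * b * b + 1 with hN
  have haM : a ≤ M := by omega
  have hbM : b ≤ M := by omega
  have hdM : d ≤ M := by omega
  have hLM : L + 3 ≤ M := by omega
  have hnB : n ≤ B := by
    rw [hn, sampleSize]
    calc _ ≤ 24 * M * M * M * M * M * M * M := by gcongr
      _ = 24 * M ^ 7 := by ring
      _ ≤ B := by rw [hBd]; gcongr; norm_num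
  have hKB : K ≤ B := by
    rw [hK]
    calc _ ≤ 256 * M * M * M * M * M := by gcongr
      _ = 256 * M ^ 5 := by ring
      _ ≤ B := by rw [hBd]; gcongr; omega
  have hNB : N ≤ B := by
    rw [hN]
    calc _ ≤ 96 * M * M * M * M + M := by gcongr
      _ = 96 * M ^ 4 + M ^ 1 := by ring
      _ ≤ 96 * M ^ 7 + M ^ 7 := by gcongr <;> omega
      _ ≤ B := by omega
  clear_value B
  set s₀ := input d α η δ σ with hs₀
  have i0 : s₀.reg 0 = d := by simp [hs₀, input]
  have iα : s₀.arr 0 0 = α := by simp [hs₀, input]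
  have iη : s₀.arr 0 1 = η := by simp [hs₀, input]
  have iδ : s₀.arr 0 2 = δ := by simp [hs₀, input]
  have iσ : s₀.arr 0 3 = σ := by simp [hs₀, input]
  have i4 : vec d (s₀.arr 4) 0 = 0 := by ext c; simp [hs₀, input, vec_apply]
  have id0 : s₀.drawn = fun _ => 0 := rfl
  refine Runs.le (Runs.seq ((runs_invProg hα iα).drawn rfl)
    (T' := 20 * (b + 1) + (4 + (30 * (L + 1) + (20 + (20 + (20 + ((n + 1) * (2 * d + 20) +
      (600 * B ^ 2 + 4000 * B ^ 4)))))))) ?_) ?_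
  swap
  · rw [← ha]
    exact locationProg_cost_le hB (haM.trans hMB) (hbM.trans hMB) (hdM.trans hMB)
      (by omega) hnB
  rintro s₁ hF₁ ⟨d₁, r₁⟩
  rw [← ha] at r₁
  have f₁ : s₁.arr = s₀.arr := by
    funext x; exact hF₁.arr x (by simp [Prog.arrs, invProg])
  refine Runs.seq (((runs_invProg hη (by rw [f₁, iη])).drawn rfl).le (by omega)) ?_
  rintro s₂ hF₂ ⟨d₂, r₂⟩
  have f₂ : s₂.arr = s₀.arr := by
    funext x; exact (hF₂.arr x (by simp [Prog.arrs, invProg])).trans (by rw [f₁])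
  refine Runs.setI_seq ?_
  set s₃ := s₂.setI 2 ((IExp.mul (.lit 64) (.reg 2)).eval s₂) with hs₃
  refine Runs.seq (((runs_logProg (s := s₃) hδ
    (by rw [hs₃, State.setI_arr, f₂, iδ])).drawn rfl).le (by rw [hL])) ?_
  rintro s₄ hF₄ ⟨d₄, r₄⟩
  have f₄ : s₄.arr = s₀.arr := by
    funext x; exact (hF₄.arr x (by simp [Prog.arrs, logProg])).trans (by rw [hs₃, State.setI_arr, f₂])
  have r1 : s₄.reg 1 = a := (hF₄.reg 1 (by simp [Prog.regs, logProg])).trans (by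
    rw [hs₃, State.setI_reg, if_neg (by norm_num), hF₂.reg 1 (by simp [Prog.regs, invProg]), r₁])
  have r2 : s₄.reg 2 = b := (hF₄.reg 2 (by simp [Prog.regs, logProg])).trans (by
    rw [hs₃, State.setI_reg, if_pos rfl, hb]
    simp [IExp.eval, r₂])
  have r0 : s₄.reg 0 = d := (hF₄.reg 0 (by simp [Prog.regs, logProg])).trans (by
    rw [hs₃, State.setI_reg, if_neg (by norm_num), hF₂.reg 0 (by simp [Prog.regs, invProg]),
      hF₁.reg 0 (by simp [Prog.regs, invProg]), i0])
  have dr : s₄.drawn = fun _ => 0 := by rw [d₄, hs₃, State.setI_drawn, d₂, d₁, id0]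
  rw [← hL] at r₄
  refine Runs.le (Runs.setI_seq (Runs.setI_seq (Runs.setI_seq (T := (n + 1) * (2 * d + 20) +
      (600 * B ^ 2 + 4000 * B ^ 4)) ?_)))
    (by simp only [sizeExp, stepsExp, newtonExp, IExp.cost]; omega)
  have hs₅ : ((s₄.setI 5 n).setI 6 N).setI 7 K = ((s₄.setI 5 (sizeExp.eval s₄)).setI 6
      (stepsExp.eval (s₄.setI 5 (sizeExp.eval s₄)))).setI 7 (newtonExp.eval
        ((s₄.setI 5 (sizeExp.eval s₄)).setI 6
          (stepsExp.eval (s₄.setI 5 (sizeExp.eval s₄))))) := by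
    simp [sizeExp, stepsExp, newtonExp, IExp.eval, r0, r1, r2, r₄, hn, sampleSize, hN, hK]
  rw [← hs₅]
  set s₅ := ((s₄.setI 5 n).setI 6 N).setI 7 K with hs₅'
  have hp₅ : Params d a b n N K σ s₅ :=
    ⟨by simp [hs₅', r0], by simp [hs₅', r1], by simp [hs₅', r2], by simp [hs₅'], by simp [hs₅'],
      by simp [hs₅'], by simp [hs₅', f₄, iσ]⟩
  refine Runs.seq (runs_drawProg hp₅.dim hp₅.size (by simp [hs₅', dr])) ?_
  rintro s₆ hF₆ ⟨d₆, y1, y2⟩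
  have hp₆ := hF₆.params (by simp [Prog.regs, drawProg, forLoop])
    (by simp [Prog.arrs, drawProg, forLoop]) hp₅
  refine Runs.seq ((runs_meanProg (by norm_num) (by norm_num) (by norm_num) hp₆ hB
    (hdM.trans hMB) hKB hnB).drawn rfl) ?_
  rintro s₇ hF₇ ⟨d₇, h₇⟩
  have hp₇ := hF₇.params
    (by simp [Prog.regs, meanProg, addClipProg, loadProg, newtonProg, accumProg, forLoop])
    (by simp [Prog.arrs, meanProg, addClipProg, loadProg, newtonProg, accumProg, forLoop]) hp₆
  -- The candidate array is still zero here, so the mean for the first source is taken at shift `0`,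
  -- as the equation requires.
  have e4 : vec d (s₆.arr 4) 0 = 0 := by
    rw [hF₆.arr 4 (by simp [Prog.arrs, drawProg, forLoop]), hs₅', State.setI_arr, State.setI_arr,
      State.setI_arr, f₄, i4]
  refine ((runs_searchProg ha0 hb0 hp₇ hB (hdM.trans hMB) hKB hnB hNB (y₁ := ω.2.1) (y₂ := ω.2.2)
    ?_ ?_).drawn rfl).mono le_rfl ?_
  · rw [h₇, e4, approxMean, approxMean]
    congr 1
    refine Finset.sum_congr rfl fun j hj => ?_
    rw [y1 j (Finset.mem_range.1 hj)]
  · intro i hi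
    rw [hF₇.arr 3 (by simp [Prog.arrs, meanProg, addClipProg, loadProg, newtonProg, accumProg,
      forLoop]), y2 i hi]
  · rintro s₈ - ⟨d₈, h₈⟩
    refine ⟨fun c => by rw [d₈, d₇, d₆], fun ⟨i, hi, h⟩ => h₈ ⟨i, hi, _, Nat.lt_succ_self _, h⟩⟩

end RealRAM

/-! ### The theorem -/

section Final

variable {α η δ : ℝ}

/-- The algorithm is polynomial in `1 / α` itself; as `1 / η ≥ 1`, the permitted quantity `(1 / α) ^
(1 / η)` dominates it. -/
theorem ceil_le_rpow_add_one (hα : 0 < α) (hα1 : α ≤ 1) (hη : 0 < η) (hη1 : η < 1) :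
    (⌈1 / α⌉₊ : ℝ) ≤ (1 / α) ^ (1 / η) + 1 := by
  have h1 : 1 ≤ 1 / α := by rw [le_div_iff₀ hα]; linarith
  have h2 : 1 ≤ 1 / η := by rw [le_div_iff₀ hη]; linarith
  have h3 : (1 / α) ^ (1 : ℝ) ≤ (1 / α) ^ (1 / η) := Real.rpow_le_rpow_of_exponent_le h1 h2
  rw [Real.rpow_one] at h3
  have := Nat.ceil_lt_add_one (show 0 ≤ 1 / α by positivity)
  linarith

/-- The factor `2` covers `1 / log 2`, and `δ * η * α ≤ δ`. -/
theorem logCeil_le (hα : 0 < α) (hα1 : α ≤ 1) (hη : 0 < η) (hη1 : η < 1) (hδ : 0 < δ)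
    (hδ1 : δ < 1) : (RealRAM.logCeil δ : ℝ) ≤ 2 * Real.log (1 / (δ * η * α)) + 1 := by
  have h0 : 0 ≤ Real.log (1 / δ) := Real.log_nonneg (by rw [le_div_iff₀ hδ]; linarith)
  have h1 : Real.log (1 / δ) ≤ Real.log (1 / (δ * η * α)) := by
    apply Real.log_le_log (by positivity)
    apply one_div_le_one_div_of_le (by positivity)
    rw [mul_assoc]
    have : η * α ≤ 1 := mul_le_one₀ hη1.le hα.le hα1
    nlinarith
  have h2 : Real.logb 2 (1 / δ) ≤ 2 * Real.log (1 / δ) := by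
    rw [Real.logb, div_le_iff₀ (Real.log_pos (by norm_num))]
    nlinarith [Real.log_two_gt_d9]
  have h3 : 0 ≤ Real.logb 2 (1 / δ) :=
    Real.logb_nonneg (by norm_num) (by rw [le_div_iff₀ hδ]; linarith)
  have := Nat.ceil_lt_add_one h3
  rw [RealRAM.logCeil]
  linarith

/-- The sample size makes the exponent exactly `-(L + 2)`, and `exp (-(L + 2)) ≤ 2 ^ (-L) / 4 ≤ δ /
4`. -/
theorem exp_sampleSize_le (hδ : 0 < δ) {a b : ℕ} (ha : 0 < a) (hb : 0 < b) :
    Real.exp (1 - (RealRAM.sampleSize a b (RealRAM.logCeil δ) : ℕ)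
      * (1 / ((a : ℝ) * b ^ 2)) ^ 2 / 24) ≤ δ / 4 := by
  set L := RealRAM.logCeil δ
  have e : ((RealRAM.sampleSize a b L : ℕ) : ℝ) * (1 / ((a : ℝ) * b ^ 2)) ^ 2 / 24 = L + 3 := by
    rw [RealRAM.sampleSize]
    push_cast
    field_simp
  have h2 : (2 : ℝ) ≤ Real.exp 1 := by linarith [Real.add_one_le_exp 1]
  have hL : 1 ≤ 2 ^ L * δ := not_lt.1 fun hc =>
    lt_irrefl _ ((RealRAM.lt_logCeil_iff hδ (k := L)).2 hc)
  have h3 : Real.exp (L + 2) = Real.exp 1 ^ L * Real.exp 1 ^ 2 := by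
    rw [← pow_add, ← Real.exp_nat_mul]; push_cast; ring_nf
  have h4 : (2 : ℝ) ^ L * 2 ^ 2 ≤ Real.exp (L + 2) := by rw [h3]; gcongr
  rw [e, show 1 - ((L : ℝ) + 3) = -(L + 2) by ring, Real.exp_neg, inv_le_comm₀ (Real.exp_pos _)
    (by positivity), inv_div]
  refine le_trans ?_ h4
  rw [div_le_iff₀ hδ]
  linarith

end Final

/-- Noisy location estimation. A single program and universal constants `C`, `K` and polynomials
`m`, `T` work for all dimensions, parameters, distributions and shifts. -/
theorem theorem2 :
    ∃ (P : RealRAM.Prog) (C K : ℝ) (m : MvPolynomial (Fin 3) ℝ) (T : MvPolynomial (Fin 4) ℝ),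
      0 < C ∧ 0 < K ∧
      ∀ (d : ℕ) (α η δ σ : ℝ), 0 < d → 0 < α → α ≤ 1 → 0 < η → η < 1 → 0 < δ → δ < 1 → 0 < σ →
        -- Every run halts within the stated number of steps and samples from each source.
        (∀ ω : RealRAM.Tape d, ∃ (s : RealRAM.State) (t : ℕ),
          RealRAM.Exec ω P (RealRAM.input d α η δ σ) s t ∧
          (∀ b : Fin 2, (s.drawn b : ℝ) ≤
            MvPolynomial.eval
              ![1 / η, (K / α) ^ (1 / η), Real.log (1 / (δ * η * α))] m) ∧
          (t : ℝ) ≤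
            MvPolynomial.eval
              ![(d : ℝ), 1 / η, (K / α) ^ (1 / η), Real.log (1 / (δ * η * α))] T) ∧
        -- Except with probability at most `δ`, the output is within `C * η * σ` of the shift.
        (∀ (Dξ D₁ D₂ : Measure (EuclideanSpace ℝ (Fin d)))
          [IsProbabilityMeasure Dξ] [IsProbabilityMeasure D₁] [IsProbabilityMeasure D₂]
          (v : EuclideanSpace ℝ (Fin d)),
          ENNReal.ofReal α ≤ Dξ {0} → IsCenteredNoise D₁ σ → IsCenteredNoise D₂ σ →
          tapeLaw Dξ D₁ D₂ v
            {ω | ¬ ∃ (s : RealRAM.State) (t : ℕ),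
              RealRAM.Exec ω P (RealRAM.input d α η δ σ) s t ∧
              ‖RealRAM.output d s - v‖ ≤ C * η * σ} ≤ ENNReal.ofReal δ) := by
  -- In both polynomials the factors come from `a ≤ (1 / α) ^ (1 / η) + 1`, `b ≤ 64 * (1 / η + 1)`
  -- and `L ≤ 2 * log (1 / (δ * η * α)) + 1`, inserted into the sample size and the step count.
  refine ⟨RealRAM.locationProg, 2, 1,
    24 * (MvPolynomial.X 1 + 1) ^ 2 * (64 * (MvPolynomial.X 0 + 1)) ^ 4
      * (2 * MvPolynomial.X 2 + 1 + 3),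
    5000 * (256 * (MvPolynomial.X 0 + (MvPolynomial.X 2 + 1) + 64 * (MvPolynomial.X 1 + 1)
      + (2 * MvPolynomial.X 3 + 1) + 3) ^ 7) ^ 4, by norm_num, by norm_num, ?_⟩
  intro d α η δ σ hd hα hα1 hη hη1 hδ hδ1 hσ
  set a := ⌈1 / α⌉₊ with ha
  set b := 64 * ⌈1 / η⌉₊ with hb
  set L := RealRAM.logCeil δ with hL
  set n := RealRAM.sampleSize a b L with hn
  have hrun := fun ω : RealRAM.Tape d => RealRAM.runs_locationProg (ω := ω) (σ := σ) hα hη hδ hd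
    ha hb hL hn rfl
  have haX : (a : ℝ) ≤ (1 / α) ^ (1 / η) + 1 := ceil_le_rpow_add_one hα hα1 hη hη1
  have hbX : (b : ℝ) ≤ 64 * (1 / η + 1) := by
    rw [hb]
    push_cast
    have := Nat.ceil_lt_add_one (show 0 ≤ 1 / η by positivity)
    linarith
  have hLX : (L : ℝ) ≤ 2 * Real.log (1 / (δ * η * α)) + 1 := logCeil_le hα hα1 hη hη1 hδ hδ1
  have ha0 : 0 < a := by rw [ha, Nat.ceil_pos]; positivity
  have hc0 : 0 < ⌈1 / η⌉₊ := by rw [Nat.ceil_pos]; positivity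
  have hb64 : 64 ≤ b := by omega
  have hb0 : (0 : ℝ) < b := by
    have : 0 < b := by omega
    exact_mod_cast this
  refine ⟨fun ω => ?_, ?_⟩
  · obtain ⟨s, t, hE, ht, hdr, -⟩ := hrun ω
    refine ⟨s, t, hE, fun c => ?_, ?_⟩
    · rw [hdr c, hn, RealRAM.sampleSize]
      simp only [map_mul, map_pow, map_add, map_ofNat, map_one, MvPolynomial.eval_X,
        Matrix.cons_val]
      push_cast
      calc (24 : ℝ) * a * a * b * b * b * b * (L + 3) = 24 * (a : ℝ) ^ 2 * (b : ℝ) ^ 4 * (L + 3) := by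
            ring
        _ ≤ _ := by gcongr
    · have ht' : (t : ℝ) ≤ (5000 * (256 * (d + a + b + L + 3) ^ 7) ^ 4 : ℕ) := by
        exact_mod_cast ht
      refine ht'.trans ?_
      simp only [map_mul, map_pow, map_add, map_ofNat, map_one, MvPolynomial.eval_X,
        Matrix.cons_val]
      push_cast
      gcongr
  · intro Dξ D₁ D₂ _ _ _ v hDξ h₁ h₂
    have hr : (1 / (b * σ) * σ) ^ 2 = 1 / (b : ℝ) ^ 2 := by field_simp
    have hαa : 1 ≤ α * a := by
      have := Nat.le_ceil (1 / α)
      rwa [div_le_iff₀' hα] at this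
    have hbη : 64 ≤ b * η := by
      have := Nat.le_ceil (1 / η)
      rw [div_le_iff₀ hη] at this
      rw [hb]
      push_cast
      linarith
    have hn0 : 0 < n := by
      have : 0 < b := by omega
      rw [hn, RealRAM.sampleSize]
      positivity
    refine le_trans (measure_mono ?_) (tapeLaw_not_goodSample_le (Dξ := Dξ) ha0 hb64 hn0 hαa hDξ hr
      h₁ h₂ v (exp_sampleSize_le hδ ha0 (by omega)))
    intro ω hω hgood
    apply hω
    obtain ⟨s, t, hE, -, -, hout⟩ := hrun ω
    refine ⟨s, t, hE, ?_⟩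
    have hrne : 1 / (b * σ) ≠ 0 := by positivity
    have h := hgood.norm_sub_le ha0 hb64 (hout (hgood.exists_descent hrne ha0 hb64))
    rw [norm_smul, Real.norm_of_nonneg (by positivity), div_mul_eq_mul_div, one_mul,
      div_le_iff₀ (by positivity)] at h
    refine h.trans ?_
    -- Since `b * η ≥ 64`, the error is at most `112 / 64 * η * σ`, below `2 * η * σ`.
    have e : 112 / (b : ℝ) ^ 2 * (b * σ) = 112 * σ / b := by field_simp
    rw [e, div_le_iff₀ hb0]
    nlinarith
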